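/- Let $(M,J,g)$ be a connected six-dimensional strict nearly Kähler manifold: $g$ is a smooth Riemannian metric with Levi-Civita connection $\nabla$, $J$ is a smooth almost complex structure with $g(JX,JY)=g(X,Y)$, $(\nabla_XJ)X=0$ for all $X\in TM$, and $\nabla_XJ\neq0$ for all $X\neq 0$. Put $\omega(X,Y)=g(JX,Y)$ and $T(X,Y)=-J(\nabla_XJ)Y$, and let $s$ be the scalar curvature of $g$. Let $L$ be a smooth 3-manifold and $F:L\times(-\epsilon,\epsilon)\to M$ a smooth map such that every $F_t=F(\cdot,t):L\to M$ is a Lagrangian immersion, i.e. an immersion with $F_t^*\omega=0$. Let $V=\frac{d}{dt}F_t$ be the variation field and let $\theta=V\lrcorner\,\omega$ be the variation 1-form on $L$ at time $t$, i.e. $\theta(X)=\omega(V,dF_t(X))$ for $X\in TL$. Then $M$ has a type constant $\alpha>0$, i.e. a constant with $$|(\nabla_XJ)Y|^2=\alpha\left(|X|^2|Y|^2-g(X,Y)^2-g(X,JY)^2\right)\qquad\text{for all tangent vectors }X,Y\text{ of }M\text{ at a common point},$$ and $9\alpha=\frac{3}{10}s$ everywhere on $M$. For every $t\in(-\epsilon,\epsilon)$,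 the form $\theta$ is smooth, the 3-form $g(T(dF_tX,dF_tY),dF_tZ)$ on $L$ vanishes nowhere and hence orients $L$, and with respect to this orientation and the induced metric $F_t^*g$ on $L$, $$d\theta=3\sqrt{\alpha}\,{*\theta},\qquad \delta\theta=0,\qquad \Delta_{\mathrm{Hodge}}\theta=(d\delta+\delta d)\theta=9\alpha\,\theta=\tfrac{3}{10}\,s\,\theta .$$ In particular $\theta$ is a coclosed eigenform of the Hodge Laplacian for the eigenvalue $9\alpha=\frac{3}{10}s$ (whenever $\theta\not\equiv0$). -/

import Mathlib

open Bundle Set Module VectorField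
open scoped Manifold ContDiff

namespace RiemGeom

noncomputable section

section Inner

variable {E : Type*} [NormedAddCommGroup E] [NormedSpace ℝ E]
  {H : Type*} [TopologicalSpace H] {I : ModelWithCorners ℝ E H}
  {M : Type*} [TopologicalSpace M] [ChartedSpace H M] [IsManifold I ∞ M]
  [RiemannianBundle (fun x : M ↦ TangentSpace I x)]
  [IsContMDiffRiemannianBundle I ∞ E (fun x : M ↦ TangentSpace I x)]

lemma mdifferentiableAt_inner {X Y : Π x : M, TangentSpace I x} {x : M}
    (hX : MDiffAt (T% X) x) (hY : MDiffAt (T% Y) x) :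
    MDiffAt (fun y ↦ (inner ℝ (X y) (Y y) : ℝ)) x :=
  MDifferentiableAt.inner_bundle (E := fun x : M ↦ TangentSpace I x) (b := fun y : M ↦ y) hX hY

end Inner

section LC

variable {E : Type*} [NormedAddCommGroup E] [NormedSpace ℝ E] [FiniteDimensional ℝ E]
  {H : Type*} [TopologicalSpace H] {I : ModelWithCorners ℝ E H}
  {M : Type*} [TopologicalSpace M] [ChartedSpace H M] [IsManifold I ∞ M]
  [RiemannianBundle (fun x : M ↦ TangentSpace I x)]

/-- The right hand side of the Koszul formula
`2⟨∇_X Y, Z⟩ = X⟨Y,Z⟩ + Y⟨Z,X⟩ - Z⟨X,Y⟩ + ⟨[X,Y],Z⟩ - ⟨[X,Z],Y⟩ - ⟨[Y,Z],X⟩`. -/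
def koszul (X Y Z : Π x : M, TangentSpace I x) (x : M) : ℝ :=
  mvfderiv I (fun y ↦ inner ℝ (Y y) (Z y)) x (X x)
    + mvfderiv I (fun y ↦ inner ℝ (Z y) (X y)) x (Y x)
    - mvfderiv I (fun y ↦ inner ℝ (X y) (Y y)) x (Z x)
    + inner ℝ (mlieBracket I X Y x) (Z x)
    - inner ℝ (mlieBracket I X Z x) (Y x)
    - inner ℝ (mlieBracket I Y Z x) (X x)

variable [IsContMDiffRiemannianBundle I ∞ E (fun x : M ↦ TangentSpace I x)]

lemma koszul_tensorial_right {X Y : Π x : M, TangentSpace I x} {x : M}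
    (hX : MDiffAt (T% X) x) (hY : MDiffAt (T% Y) x) :
    TensorialAt I E (fun Z ↦ koszul X Y Z x) x where
  smul {f Z} hf hZ := by
    have := FiniteDimensional.complete ℝ E
    simp only [koszul, Pi.smul_apply', inner_smul_left, inner_smul_right, mlieBracket_smul_right hf hZ,
      inner_add_left, RCLike.conj_to_real, map_smul, smul_eq_mul]
    rw [mvfderiv_fun_mul hf (mdifferentiableAt_inner hY hZ), mvfderiv_fun_mul hf (mdifferentiableAt_inner hZ hX)]
    simp [real_inner_comm]
    ring
  add {Z Z'} hZ hZ' := by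
    have := FiniteDimensional.complete ℝ E
    simp only [koszul, Pi.add_apply, inner_add_right, inner_add_left,
      mlieBracket_add_right hZ hZ', map_add]
    rw [mvfderiv_fun_add (mdifferentiableAt_inner hY hZ) (mdifferentiableAt_inner hY hZ'),
      mvfderiv_fun_add (mdifferentiableAt_inner hZ hX) (mdifferentiableAt_inner hZ' hX)]
    simp
    ring

lemma koszul_tensorial_left {Y Z : Π x : M, TangentSpace I x} {x : M}
    (hY : MDiffAt (T% Y) x) (hZ : MDiffAt (T% Z) x) :
    TensorialAt I E (fun X ↦ koszul X Y Z x) x where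
  smul {f X} hf hX := by
    have := FiniteDimensional.complete ℝ E
    simp only [koszul, Pi.smul_apply', inner_smul_left, inner_smul_right, mlieBracket_smul_left hf hX,
      inner_add_left, RCLike.conj_to_real, map_smul, smul_eq_mul]
    rw [mvfderiv_fun_mul hf (mdifferentiableAt_inner hZ hX), mvfderiv_fun_mul hf (mdifferentiableAt_inner hX hY)]
    simp [real_inner_comm]
    ring
  add {X X'} hX hX' := by
    have := FiniteDimensional.complete ℝ E
    simp only [koszul, Pi.add_apply, inner_add_right, inner_add_left,
      mlieBracket_add_left hX hX', map_add]
    rw [mvfderiv_fun_add (mdifferentiableAt_inner hZ hX) (mdifferentiableAt_inner hZ hX'),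
      mvfderiv_fun_add (mdifferentiableAt_inner hX hY) (mdifferentiableAt_inner hX' hY)]
    simp
    ring


variable (I M) in
instance instFiniteDimensionalTangentSpace (x : M) : FiniteDimensional ℝ (TangentSpace I x) :=
  inferInstanceAs (FiniteDimensional ℝ E)

open Classical in
/-- `∇σ` at `x`, obtained from the Koszul formula; it is `0` where `σ` is not differentiable. -/
def leviCivitaFun (σ : Π x : M, TangentSpace I x) (x : M) :
    TangentSpace I x →L[ℝ] TangentSpace I x :=
  have : CompleteSpace (TangentSpace I x) := FiniteDimensional.complete ℝ _
  if hσ : MDiffAt (T% σ) x then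
    InnerProductSpace.continuousLinearMapOfBilin (𝕜 := ℝ)
      ((1 / 2 : ℝ) • TensorialAt.mkHom₂ (I := I) (F := E) (F' := E) (fun X Z ↦ koszul X σ Z x) x
        (fun _ hZ ↦ koszul_tensorial_left hσ hZ) (fun _ hX ↦ koszul_tensorial_right hX hσ))
  else 0

lemma inner_leviCivitaFun {X σ Z : Π x : M, TangentSpace I x} {x : M}
    (hX : MDiffAt (T% X) x) (hσ : MDiffAt (T% σ) x) (hZ : MDiffAt (T% Z) x) :
    inner ℝ (leviCivitaFun σ x (X x)) (Z x) = 1 / 2 * koszul X σ Z x := by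
  have : CompleteSpace (TangentSpace I x) := FiniteDimensional.complete ℝ _
  rw [leviCivitaFun, dif_pos hσ]
  rw [InnerProductSpace.continuousLinearMapOfBilin_apply]
  erw [smul_apply, smul_apply, TensorialAt.mkHom₂_apply _ _ hX hZ]
  simp

lemma koszul_add_mid {X Y Y' Z : Π x : M, TangentSpace I x} {x : M} (hX : MDiffAt (T% X) x)
    (hY : MDiffAt (T% Y) x) (hY' : MDiffAt (T% Y') x) (hZ : MDiffAt (T% Z) x) :
    koszul X (Y + Y') Z x = koszul X Y Z x + koszul X Y' Z x := by
  have := FiniteDimensional.complete ℝ E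
  simp only [koszul, Pi.add_apply, inner_add_right, inner_add_left,
    mlieBracket_add_left hY hY', mlieBracket_add_right hY hY', map_add]
  rw [mvfderiv_fun_add (mdifferentiableAt_inner hY hZ) (mdifferentiableAt_inner hY' hZ),
    mvfderiv_fun_add (mdifferentiableAt_inner hX hY) (mdifferentiableAt_inner hX hY')]
  simp
  ring

lemma koszul_smul_mid {X Y Z : Π x : M, TangentSpace I x} {f : M → ℝ} {x : M}
    (hf : MDiffAt f x) (hX : MDiffAt (T% X) x) (hY : MDiffAt (T% Y) x) (hZ : MDiffAt (T% Z) x) :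
    koszul X (f • Y) Z x
      = f x * koszul X Y Z x + 2 * (mvfderiv I f x (X x) * inner ℝ (Y x) (Z x)) := by
  have := FiniteDimensional.complete ℝ E
  simp only [koszul, Pi.smul_apply', inner_smul_left, inner_smul_right,
    mlieBracket_smul_left hf hY, mlieBracket_smul_right hf hY,
    inner_add_left, RCLike.conj_to_real, map_smul, smul_eq_mul]
  rw [mvfderiv_fun_mul hf (mdifferentiableAt_inner hY hZ),
    mvfderiv_fun_mul hf (mdifferentiableAt_inner hX hY)]
  simp [real_inner_comm]
  ring

variable (I M) in
/-- The Levi-Civita connection of a Riemannian manifold; `leviCivita I M Y x v` is `∇_v Y`. -/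
def leviCivita : CovariantDerivative I E (fun x : M ↦ TangentSpace I x) where
  toFun := leviCivitaFun
  isCovariantDerivativeOnUniv :=
    { add := by
        intro σ σ' x hσ hσ' _
        have hs : MDiffAt (T% (σ + σ')) x := mdifferentiableAt_add_section hσ hσ'
        ext1 v
        refine ext_inner_right ℝ fun w ↦ ?_
        have hv := FiberBundle.extend_apply_self E (E := fun x : M ↦ TangentSpace I x) v
        have hw := FiberBundle.extend_apply_self E (E := fun x : M ↦ TangentSpace I x) w
        rw [← hv, ← hw, add_apply, inner_add_left]
        rw [inner_leviCivitaFun (FiberBundle.mdifferentiableAt_extend ..) hs (FiberBundle.mdifferentiableAt_extend ..),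
          inner_leviCivitaFun (FiberBundle.mdifferentiableAt_extend ..) hσ (FiberBundle.mdifferentiableAt_extend ..),
          inner_leviCivitaFun (FiberBundle.mdifferentiableAt_extend ..) hσ' (FiberBundle.mdifferentiableAt_extend ..),
          koszul_add_mid (FiberBundle.mdifferentiableAt_extend ..) hσ hσ' (FiberBundle.mdifferentiableAt_extend ..)]
        ring
      leibniz := by
        intro σ g x hσ hg _
        have hs : MDiffAt (T% (g • σ)) x := hg.smul_section hσ
        ext1 v
        refine ext_inner_right ℝ fun w ↦ ?_
        have hv := FiberBundle.extend_apply_self E (E := fun x : M ↦ TangentSpace I x) v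
        have hw := FiberBundle.extend_apply_self E (E := fun x : M ↦ TangentSpace I x) w
        rw [← hv, ← hw, add_apply, inner_add_left, smul_apply, inner_smul_left,
          ContinuousLinearMap.smulRight_apply, inner_smul_left]
        rw [inner_leviCivitaFun (FiberBundle.mdifferentiableAt_extend ..) hs (FiberBundle.mdifferentiableAt_extend ..),
          inner_leviCivitaFun (FiberBundle.mdifferentiableAt_extend ..) hσ (FiberBundle.mdifferentiableAt_extend ..),
          koszul_smul_mid hg (FiberBundle.mdifferentiableAt_extend ..) hσ (FiberBundle.mdifferentiableAt_extend ..)]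
        simp
        ring }

lemma inner_leviCivita {X σ Z : Π x : M, TangentSpace I x} {x : M}
    (hX : MDiffAt (T% X) x) (hσ : MDiffAt (T% σ) x) (hZ : MDiffAt (T% Z) x) :
    inner ℝ (leviCivita I M σ x (X x)) (Z x) = 1 / 2 * koszul X σ Z x :=
  inner_leviCivitaFun hX hσ hZ

lemma leviCivita_torsion [CompleteSpace E] : (leviCivita I M).torsion = 0 := by
  rw [CovariantDerivative.torsion_eq_zero_iff]
  intro X Y x hX hY
  refine ext_inner_right ℝ fun w ↦ ?_
  have hw := FiberBundle.extend_apply_self E (E := fun x : M ↦ TangentSpace I x) w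
  have hW := FiberBundle.mdifferentiableAt_extend I E (V := fun x : M ↦ TangentSpace I x) w
  rw [← hw, inner_sub_left, inner_leviCivita hX hY hW, inner_leviCivita hY hX hW]
  simp only [koszul]
  rw [mlieBracket_swap_apply (V := Y) (W := X)]
  simp only [inner_neg_left]
  simp only [real_inner_comm]
  ring

lemma leviCivita_metric {X σ τ : Π x : M, TangentSpace I x} {x : M}
    (hX : MDiffAt (T% X) x) (hσ : MDiffAt (T% σ) x) (hτ : MDiffAt (T% τ) x) :
    mvfderiv I (fun y ↦ (inner ℝ (σ y) (τ y) : ℝ)) x (X x)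
      = inner ℝ (leviCivita I M σ x (X x)) (τ x) + inner ℝ (σ x) (leviCivita I M τ x (X x)) := by
  rw [inner_leviCivita hX hσ hτ, real_inner_comm, inner_leviCivita hX hτ hσ]
  simp only [koszul]
  rw [mlieBracket_swap_apply (V := τ) (W := σ)]
  simp only [inner_neg_left]
  simp only [real_inner_comm]
  ring

/-- The curvature tensor `R(u,v)w = ∇_u ∇_v w - ∇_v ∇_u w - ∇_{[u,v]} w` at a point, computed with
local smooth extensions of the three vectors. -/
def curvature (x : M) (u v w : TangentSpace I x) : TangentSpace I x :=
  let U : Π y : M, TangentSpace I y := FiberBundle.extend E u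
  let V : Π y : M, TangentSpace I y := FiberBundle.extend E v
  let W : Π y : M, TangentSpace I y := FiberBundle.extend E w
  leviCivita I M (fun y ↦ leviCivita I M W y (V y)) x u
    - leviCivita I M (fun y ↦ leviCivita I M W y (U y)) x v
    - leviCivita I M W x (mlieBracket I U V x)

/-- `Ric(v,w) = ∑ᵢ ⟨R(v,eᵢ)eᵢ, w⟩` for an orthonormal basis `eᵢ`. -/
def ricci (x : M) (v w : TangentSpace I x) : ℝ :=
  ∑ i, inner ℝ (curvature x v (stdOrthonormalBasis ℝ (TangentSpace I x) i)
    (stdOrthonormalBasis ℝ (TangentSpace I x) i)) w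

variable (I) in
/-- The scalar curvature, the trace of the Ricci tensor. -/
def scalarCurvature (x : M) : ℝ :=
  ∑ i, ricci x (stdOrthonormalBasis ℝ (TangentSpace I x) i)
    (stdOrthonormalBasis ℝ (TangentSpace I x) i)

/-- `(∇_v J) w = ∇_v (J W) - J (∇_v W)` for a local smooth extension `W` of `w`. -/
def covDerivEnd (J : Π x : M, TangentSpace I x →L[ℝ] TangentSpace I x) (x : M)
    (v w : TangentSpace I x) : TangentSpace I x :=
  let W : Π y : M, TangentSpace I y := FiberBundle.extend E w
  leviCivita I M (fun y ↦ J y (W y)) x v - J x (leviCivita I M W x v)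

/-- `J` is a smooth almost complex structure which is orthogonal for the Riemannian metric. -/
structure IsAlmostHermitian (J : Π x : M, TangentSpace I x →L[ℝ] TangentSpace I x) : Prop where
  contMDiff : ContMDiff I (I.prod 𝓘(ℝ, E →L[ℝ] E)) ∞ (fun x ↦
    TotalSpace.mk' (E →L[ℝ] E) (E := fun x : M ↦ TangentSpace I x →L[ℝ] TangentSpace I x) x (J x))
  sq : ∀ (x : M) (v : TangentSpace I x), J x (J x v) = -v
  inner_map_map : ∀ (x : M) (u v : TangentSpace I x),
    (inner ℝ (J x u) (J x v) : ℝ) = inner ℝ u v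

/-- Nearly Kähler: almost Hermitian with `(∇_X J) X = 0`. -/
structure IsNearlyKahler (J : Π x : M, TangentSpace I x →L[ℝ] TangentSpace I x) : Prop
    extends IsAlmostHermitian J where
  covDerivEnd_self : ∀ (x : M) (v : TangentSpace I x), covDerivEnd J x v v = 0

/-- Strict nearly Kähler: moreover `∇_X J ≠ 0` for every `X ≠ 0`. -/
structure IsStrictNearlyKahler (J : Π x : M, TangentSpace I x →L[ℝ] TangentSpace I x) : Prop
    extends IsNearlyKahler J where
  strict : ∀ (x : M) (v : TangentSpace I x), v ≠ 0 → ∃ w, covDerivEnd J x v w ≠ 0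

/-- `α` is the type constant:
`|(∇_X J) Y|² = α (|X|² |Y|² - ⟨X,Y⟩² - ⟨X,JY⟩²)` for all tangent vectors `X`, `Y`. -/
def IsTypeConstant (J : Π x : M, TangentSpace I x →L[ℝ] TangentSpace I x) (α : ℝ) : Prop :=
  ∀ (x : M) (u v : TangentSpace I x), ‖covDerivEnd J x u v‖ ^ 2
    = α * (‖u‖ ^ 2 * ‖v‖ ^ 2 - (inner ℝ u v : ℝ) ^ 2 - (inner ℝ u (J x v) : ℝ) ^ 2)

/-- The torsion `T(u,v) = -J (∇_u J) v` of the canonical Hermitian connection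
`∇_X Y - (1/2) J (∇_X J) Y`. -/
def nkTorsion (J : Π x : M, TangentSpace I x →L[ℝ] TangentSpace I x) (x : M)
    (u v : TangentSpace I x) : TangentSpace I x :=
  -J x (covDerivEnd J x u v)

end LC

section Kahler

variable {E : Type*} [NormedAddCommGroup E] [NormedSpace ℝ E]
  {H : Type*} [TopologicalSpace H] {I : ModelWithCorners ℝ E H}
  {M : Type*} [TopologicalSpace M] [ChartedSpace H M]
  [RiemannianBundle (fun x : M ↦ TangentSpace I x)]

/-- The fundamental form `ω(u,v) = ⟨J u, v⟩`, as `u ↦ ω(u, ·)`. -/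
def fundamentalForm (J : Π x : M, TangentSpace I x →L[ℝ] TangentSpace I x) (x : M)
    (u : TangentSpace I x) : TangentSpace I x →L[ℝ] ℝ :=
  innerSL ℝ (J x u)

/-- `f : L → M` is a smooth Lagrangian immersion: `dim M = 2 dim L` and `f^* ω = 0`. -/
structure IsLagrangianImmersion (n : ℕ) {L : Type*}
    [TopologicalSpace L] [ChartedSpace (EuclideanSpace ℝ (Fin n)) L]
    (J : Π x : M, TangentSpace I x →L[ℝ] TangentSpace I x) (f : L → M) : Prop where
  finrank_eq : finrank ℝ E = 2 * n
  contMDiff : ContMDiff (𝓡 n) I ∞ f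
  injective : ∀ x : L, Function.Injective (mfderiv (𝓡 n) I f x)
  isotropic : ∀ (x : L) (u v : TangentSpace (𝓡 n) x),
    fundamentalForm J (f x) (mfderiv (𝓡 n) I f x u) (mfderiv (𝓡 n) I f x v) = 0

/-- `F` restricts to a smooth map on `L × (-ε, ε)` all of whose time slices `F (·, t)` are
Lagrangian immersions. -/
structure IsLagrangianVariation (n : ℕ) {L : Type*}
    [TopologicalSpace L] [ChartedSpace (EuclideanSpace ℝ (Fin n)) L]
    (J : Π x : M, TangentSpace I x →L[ℝ] TangentSpace I x)
    (ε : ℝ) (F : L × ℝ → M) : Prop where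
  contMDiffOn : ContMDiffOn ((𝓡 n).prod 𝓘(ℝ, ℝ)) I ∞ F (univ ×ˢ Ioo (-ε) ε)
  isLagrangian : ∀ t ∈ Ioo (-ε) ε, IsLagrangianImmersion n J (fun x : L ↦ F (x, t))

variable {n : ℕ} {L : Type*} [TopologicalSpace L] [ChartedSpace (EuclideanSpace ℝ (Fin n)) L]

/-- The variation vector field `V = d/dt F_t` along `F_t`. -/
def variationField (F : L × ℝ → M) (t : ℝ) (x : L) : TangentSpace I (F (x, t)) :=
  mfderiv 𝓘(ℝ, ℝ) I (fun s : ℝ ↦ F (x, s)) t (1 : ℝ)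

/-- The variation 1-form `θ = V ⌟ ω` on `L` at time `t`, that is `θ(u) = ω(V, dF_t u)`. -/
def variationForm (J : Π x : M, TangentSpace I x →L[ℝ] TangentSpace I x) (F : L × ℝ → M) (t : ℝ)
    (x : L) : TangentSpace (𝓡 n) x →L[ℝ] ℝ :=
  (fundamentalForm J (F (x, t)) (variationField F t x)).comp
    (mfderiv (𝓡 n) I (fun y : L ↦ F (y, t)) x)

/-- The Riemannian metric induced on `L` by an immersion into a Riemannian manifold. -/
def inducedMetric (f : L → M) (hf : ∀ x : L, Function.Injective (mfderiv (𝓡 n) I f x)) :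
    RiemannianMetric (fun x : L ↦ TangentSpace (𝓡 n) x) where
  inner x := (ContinuousLinearMap.precomp ℝ (mfderiv (𝓡 n) I f x)).comp
    ((RiemannianBundle.g (E := fun x : M ↦ TangentSpace I x).inner (f x)).comp
      (mfderiv (𝓡 n) I f x))
  symm x v w := RiemannianMetric.symm _ (f x) _ _
  pos x v hv := RiemannianMetric.pos _ (f x) _
    fun h ↦ hv (hf x (h.trans (map_zero (mfderiv (𝓡 n) I f x)).symm))
  continuousAt x := by
    have hA := (mfderiv (𝓡 n) I f x : TangentSpace (𝓡 n) x →L[ℝ] TangentSpace I (f x)).continuous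
    exact (hA.inner (𝕜 := ℝ) hA).continuousAt
  isVonNBounded x := by
    let A : EuclideanSpace ℝ (Fin n) →ₗ[ℝ] TangentSpace I (f x) :=
      (mfderiv (𝓡 n) I f x : TangentSpace (𝓡 n) x →L[ℝ] TangentSpace I (f x)).toLinearMap
    obtain ⟨K, -, hK⟩ := A.exists_antilipschitzWith (LinearMap.ker_eq_bot.2 (hf x))
    have hb : Bornology.IsBounded (A ⁻¹' Metric.ball 0 1) :=
      hK.isBounded_preimage Metric.isBounded_ball
    refine ((NormedSpace.isVonNBounded_iff (𝕜 := ℝ)).2 hb).subset fun v hv ↦ ?_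
    have h1 : (inner ℝ (A v) (A v) : ℝ) < 1 := hv
    rw [real_inner_self_eq_norm_sq] at h1
    refine mem_ball_zero_iff.2 (?_ : ‖A v‖ < 1)
    nlinarith [norm_nonneg (A v)]

end Kahler

lemma append_update_right {n : ℕ} {V : Type*} {p q : ℕ} (h : p + q = n) [DecidableEq (Fin q)] (u : Fin p → V)
    (w : Fin q → V) (i : Fin q) (a : V) :
    Fin.append u (Function.update w i a) ∘ Fin.cast h.symm
      = Function.update (Fin.append u w ∘ Fin.cast h.symm) (Fin.cast h (Fin.natAdd p i)) a := by
  subst h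
  ext j
  refine Fin.addCases (fun k ↦ ?_) (fun k ↦ ?_) j
  · simp [Function.update_apply, Fin.ext_iff]
    omega
  · simp [Function.update_apply]

section Forms

variable {n : ℕ}

section Linear

variable {V : Type*} [NormedAddCommGroup V] [InnerProductSpace ℝ V] [Fact (finrank ℝ V = n)]

/-- `w ↦ vol(u, w)`, for an oriented inner product space of dimension `p + q = n` with volume form
`vol` and `u` a `p`-tuple of vectors. -/
def volContract (o : Orientation ℝ V (Fin n)) {p q : ℕ} (h : p + q = n) (u : Fin p → V) :
    V [⋀^Fin q]→L[ℝ] ℝ :=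
  AlternatingMap.mkContinuous
    { toFun := fun w ↦ o.volumeForm (Fin.append u w ∘ Fin.cast h.symm)
      map_update_add' := by
        intro _ w i a b
        rw [append_update_right h, append_update_right h, append_update_right h,
          AlternatingMap.map_update_add]
      map_update_smul' := by
        intro _ w i c a
        rw [append_update_right h, append_update_right h, AlternatingMap.map_update_smul]
      map_eq_zero_of_eq' := by
        intro w i j hw hij
        refine o.volumeForm.map_eq_zero_of_eq (i := Fin.cast h (Fin.natAdd p i))
          (j := Fin.cast h (Fin.natAdd p j)) _ ?_ ?_
        · simpa using hw
        · simpa [Fin.ext_iff] using hij }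
    (∏ i, ‖u i‖) (by
      intro w
      refine (o.abs_volumeForm_apply_le _).trans (le_of_eq ?_)
      subst h
      simp [Fin.prod_univ_add])

/-- The Hodge star on `p`-forms on an oriented inner product space of dimension `n = p + q`:
`(*η)(w) = ∑_{i₁ < ⋯ < i_p} η(e_{i₁}, …, e_{i_p}) vol(e_{i₁}, …, e_{i_p}, w)`
for an orthonormal basis `e`. -/
def hodgeStarLinear [FiniteDimensional ℝ V] (o : Orientation ℝ V (Fin n)) {p q : ℕ} (h : p + q = n)
    (η : V [⋀^Fin p]→L[ℝ] ℝ) : V [⋀^Fin q]→L[ℝ] ℝ :=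
  let e : OrthonormalBasis (Fin n) ℝ V :=
    (stdOrthonormalBasis ℝ V).reindex (finCongr (Fact.out : finrank ℝ V = n))
  ∑ s : Fin p ↪o Fin n, η (fun i ↦ e (s i)) • volContract o h (fun i ↦ e (s i))

end Linear

variable {L : Type*} [TopologicalSpace L] [ChartedSpace (EuclideanSpace ℝ (Fin n)) L]

variable (n L) in
/-- Differential `k`-forms (without regularity) on an `n`-manifold `L`. -/
abbrev DiffForm (k : ℕ) : Type _ := Π x : L, TangentSpace (𝓡 n) x [⋀^Fin k]→L[ℝ] ℝ

/-- The exterior derivative of a differential form on a manifold: transport the form to the model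
space with the preferred chart at `x`, differentiate there, and transport the result back. -/
def mextDeriv {k : ℕ} (η : DiffForm n L k) : DiffForm n L (k + 1) := fun x ↦
  (extDeriv (E := EuclideanSpace ℝ (Fin n))
    (fun y ↦ (η ((extChartAt (𝓡 n) x).symm y)).compContinuousLinearMap
      (mfderiv 𝓘(ℝ, EuclideanSpace ℝ (Fin n)) (𝓡 n) (extChartAt (𝓡 n) x).symm y))
    (extChartAt (𝓡 n) x x)).compContinuousLinearMap
      (mfderiv (𝓡 n) 𝓘(ℝ, EuclideanSpace ℝ (Fin n)) (extChartAt (𝓡 n) x) x)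

/-- A field of covectors as a differential 1-form. -/
def oneForm (θ : Π x : L, TangentSpace (𝓡 n) x →L[ℝ] ℝ) : DiffForm n L 1 := fun x ↦
  ContinuousAlternatingMap.ofSubsingleton ℝ (TangentSpace (𝓡 n) x) ℝ (0 : Fin 1) (θ x)

instance factFinrankTangentSpace (x : L) : Fact (finrank ℝ (TangentSpace (𝓡 n) x) = n) :=
  ⟨finrank_euclideanSpace_fin (𝕜 := ℝ) (n := n)⟩

variable [RiemannianBundle (fun x : L ↦ TangentSpace (𝓡 n) x)]
  (o : Π x : L, Orientation ℝ (TangentSpace (𝓡 n) x) (Fin n))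

/-- The Hodge star on an oriented Riemannian `n`-manifold. -/
def hodgeStar {p q : ℕ} (h : p + q = n) (η : DiffForm n L p) : DiffForm n L q := fun x ↦
  hodgeStarLinear (o x) h (η x)

/-- The codifferential `δ = (-1)^(n(k+1)+1) * d *` on `k`-forms, `k = p + 1`. -/
def codiff {p q : ℕ} (h : p + 1 + q = n) (η : DiffForm n L (p + 1)) : DiffForm n L p := fun x ↦
  (-1 : ℝ) ^ (n * (p + 2) + 1) •
    hodgeStar o (p := q + 1) (q := p) (by omega) (mextDeriv (hodgeStar o h η)) x

/-- The Hodge Laplacian `Δ = d δ + δ d` on `k`-forms, `k = p + 1 < n`. -/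
def hodgeLaplacian {p q : ℕ} (h : p + 2 + q = n) (η : DiffForm n L (p + 1)) :
    DiffForm n L (p + 1) := fun x ↦
  mextDeriv (codiff o (p := p) (q := q + 1) (by omega) η) x
    + codiff o (p := p + 1) (q := q) (by omega) (mextDeriv η) x

end Forms

section Orientation

variable {E : Type*} [NormedAddCommGroup E] [NormedSpace ℝ E] [FiniteDimensional ℝ E]
  {H : Type*} [TopologicalSpace H] {I : ModelWithCorners ℝ E H}
  {M : Type*} [TopologicalSpace M] [ChartedSpace H M] [IsManifold I ∞ M]
  [RiemannianBundle (fun x : M ↦ TangentSpace I x)]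
  [IsContMDiffRiemannianBundle I ∞ E (fun x : M ↦ TangentSpace I x)]
  {L : Type*} [TopologicalSpace L] [ChartedSpace (EuclideanSpace ℝ (Fin 3)) L]

/-- `o` is the orientation of the 3-manifold `L` for which the pull-back by `f : L → M` of the
3-form `τ(X,Y,Z) = ⟨T(X,Y), Z⟩` is positive: a basis is positively oriented iff `τ` is positive
on it. -/
def IsTorsionOrientation (J : Π x : M, TangentSpace I x →L[ℝ] TangentSpace I x) (f : L → M)
    (o : Π x : L, Orientation ℝ (TangentSpace (𝓡 3) x) (Fin 3)) : Prop :=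
  ∀ (x : L) (b : Basis (Fin 3) ℝ (TangentSpace (𝓡 3) x)), b.orientation = o x ↔
    0 < (inner ℝ (nkTorsion J (f x) (mfderiv (𝓡 3) I f x (b 0)) (mfderiv (𝓡 3) I f x (b 1)))
      (mfderiv (𝓡 3) I f x (b 2)) : ℝ)

end Orientation

end

end RiemGeom

/-! The analytic half rests on `dω(X,Y,Z) = 3⟨(∇_X J)Y, Z⟩`, which holds because `⟨(∇_X J)Y, Z⟩` is
totally skew and `∇` is torsion-free. Pull `ω` back to `L × (-ε, ε)`. Its components in two
`L`-directions vanish identically, also as `t` varies. On three `L`-directions the identity says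
that `⟨(∇J)·,·⟩` vanishes on each Lagrangian (`inner_covDerivEnd_eq_zero`). On the time direction
and two `L`-directions it says `dθ(u,v) = -3⟨(∇_u J)v, V⟩` (`fderiv_chartVariationForm`).

The rest is linear algebra at a point. Since `⟨(∇J)·,·⟩` vanishes on the Lagrangian, `T = -J(∇J)`
maps pairs of tangent vectors to tangent vectors. By the type constant, `⟨T(·,·),·⟩` takes the value
`±√α` on orthonormal bases, so it is `√α` times the volume form of the orientation it defines.
Pairing with `JV` turns the formula for `dθ` into `dθ = 3√α *θ`. Then `d*θ = 0` because `d² = 0` and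
`√α ≠ 0`, hence `δθ = 0` and `Δθ = δdθ = 9α θ`.

The geometric half produces `α` and its relation to `s`. Near each point strictness gives a smooth
unitary frame `a, b, c` with `(∇_a J)b = f c` and cyclically, and then `f²` is the type constant at
that point. The derivative of `f` and the trace `∑⟨∇eᵢ, Jeᵢ⟩` of the connection form are components
of `∇²J`. The Ricci identity for `J`, the Bianchi identity and the curvature symmetries force a
component `σ` of this kind to satisfy `σ = 25σ`, so it is zero
(`IsNearlyKahler.secondForm_eq_zero`). Hence `df = 0`, and connectedness makes `α = f²` a global
constant.

Differentiating the vanishing trace gives `∑ᵢ R(a,Ja,eᵢ,Jeᵢ) = -f²`. Gray's identity expresses the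
scalar curvature through these sums and `|∇J|²`. The outcome is `s = 24f² + 6f² = 30α`, that is `9α
= (3/10)s`. -/

namespace RiemGeom
noncomputable section
-- Smooth vector fields and Lie brackets acting on functions.
section Calculus
set_option linter.unusedSectionVars false
open Filter Topology

variable {E : Type*} [NormedAddCommGroup E] [NormedSpace ℝ E] [FiniteDimensional ℝ E]
  {H : Type*} [TopologicalSpace H] {I : ModelWithCorners ℝ E H}
  {M : Type*} [TopologicalSpace M] [ChartedSpace H M] [IsManifold I ∞ M]

lemma one_le_infty : (1 : WithTop ℕ∞) ≤ ∞ :=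
  (WithTop.coe_le_coe.2 le_top : ((1 : ℕ∞) : WithTop ℕ∞) ≤ ∞)

variable (I) in
/-- A vector field which is smooth at a point. -/
abbrev SmoothAt (X : Π x : M, TangentSpace I x) (x : M) : Prop :=
  CMDiffAt ∞ (T% X) x

lemma SmoothAt.mdiff {X : Π x : M, TangentSpace I x} {x : M} (h : SmoothAt I X x) :
    MDiffAt (T% X) x :=
  ContMDiffAt.mdifferentiableAt h (by simp)

lemma SmoothAt.eventually_mdiff {X : Π x : M, TangentSpace I x} {x : M} (h : SmoothAt I X x) :
    ∀ᶠ y in 𝓝 x, MDiffAt (T% X) y := by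
  have h1 : CMDiffAt 1 (T% X) x :=
    ContMDiffAt.of_le h one_le_infty
  filter_upwards [(contMDiffAt_iff_contMDiffAt_nhds (by simp)).1 h1] with y hy using hy.mdifferentiableAt (by simp)

lemma contMDiffAt_eventually_mdiff {f : M → ℝ} {x : M} (h : ContMDiffAt I 𝓘(ℝ, ℝ) ∞ f x) :
    ∀ᶠ y in 𝓝 x, MDiffAt f y := by
  have h1 : ContMDiffAt I 𝓘(ℝ, ℝ) 1 f x := ContMDiffAt.of_le h one_le_infty
  filter_upwards [(contMDiffAt_iff_contMDiffAt_nhds (by simp)).1 h1] with y hy using hy.mdifferentiableAt (by simp)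

variable {X Y Z W : Π x : M, TangentSpace I x} {f : M → ℝ} {x : M}

lemma SmoothAt.add (hX : SmoothAt I X x) (hY : SmoothAt I Y x) :
    SmoothAt I (X + Y) x := ContMDiffAt.add_section hX hY

lemma SmoothAt.sub (hX : SmoothAt I X x) (hY : SmoothAt I Y x) :
    SmoothAt I (X - Y) x := ContMDiffAt.sub_section hX hY

lemma SmoothAt.smul (hf : ContMDiffAt I 𝓘(ℝ, ℝ) ∞ f x) (hX : SmoothAt I X x) :
    SmoothAt I (f • X) x := ContMDiffAt.smul_section hf hX

lemma SmoothAt.congr (hX : SmoothAt I X x) (h : ∀ᶠ y in 𝓝 x, Y y = X y) : SmoothAt I Y x :=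
  ContMDiffAt.congr_of_eventuallyEq hX (h.mono fun y hy ↦ by simp [hy])

lemma smoothAt_extend (v : TangentSpace I x) :
    SmoothAt I (FiberBundle.extend E v : Π y : M, TangentSpace I y) x :=
  FiberBundle.contMDiffAt_extend I E (V := fun x : M ↦ TangentSpace I x) v

lemma SmoothAt.mlieBracket (hX : SmoothAt I X x) (hY : SmoothAt I Y x) :
    SmoothAt I (mlieBracket I X Y) x := by
  have := FiniteDimensional.complete ℝ E
  have : IsManifold I (((⊤ : ℕ∞) : WithTop ℕ∞) + 1) M := by
    simpa using! (inferInstance : IsManifold I ∞ M)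
  have : IsManifold I (minSmoothness ℝ 2) M := by
    simp only [minSmoothness_of_isRCLikeNormedField]
    exact IsManifold.of_le (n := ∞) (WithTop.coe_le_coe.2 le_top : ((2 : ℕ∞) : WithTop ℕ∞) ≤ ∞)
  exact ContMDiffAt.mlieBracket_vectorField (m := ⊤) (n := ⊤) hX hY (by simp)

lemma contMDiffAt_mvfderiv (hf : ContMDiffAt I 𝓘(ℝ, ℝ) ∞ f x) (hX : SmoothAt I X x) :
    ContMDiffAt I 𝓘(ℝ, ℝ) ∞ (fun y ↦ mvfderiv I f y (X y)) x := by
  have h1 := hf.mfderiv_const (m := ∞) (by simp)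
  have h2 : ContMDiffAt I (𝓘(ℝ, ℝ).prod 𝓘(ℝ, ℝ)) ∞
      (fun m ↦ (TotalSpace.mk' ℝ (f m) (mfderiv I 𝓘(ℝ, ℝ) f m (X m)) : TangentBundle 𝓘(ℝ, ℝ) ℝ)) x :=
    ContMDiffAt.clm_apply_of_inCoordinates h1 hX hf
  exact (contMDiff_snd_tangentBundle_modelSpace ℝ 𝓘(ℝ, ℝ)).contMDiffAt.comp x h2

/-- The Lie bracket acts on functions as a commutator. -/
lemma mvfderiv_mlieBracket (hX : SmoothAt I X x) (hY : SmoothAt I Y x)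
    (hf : ContMDiffAt I 𝓘(ℝ, ℝ) ∞ f x) :
    mvfderiv I f x (mlieBracket I X Y x) = mvfderiv I (fun y ↦ mvfderiv I f y (Y y)) x (X x)
      - mvfderiv I (fun y ↦ mvfderiv I f y (X y)) x (Y x) := by
  have := FiniteDimensional.complete ℝ E
  rcases subsingleton_or_nontrivial (TangentSpace I x) with h | h
  · rw [Subsingleton.elim (mlieBracket I X Y x) 0, Subsingleton.elim (X x) 0,
      Subsingleton.elim (Y x) 0]
    simp
  obtain ⟨z, hz⟩ := exists_ne (0 : TangentSpace I x)
  set Z : Π y : M, TangentSpace I y := FiberBundle.extend E z with hZdef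
  have hZ : SmoothAt I Z x := smoothAt_extend z
  have hZx : Z x = z := FiberBundle.extend_apply_self E (E := fun x : M ↦ TangentSpace I x) z
  have hXf := contMDiffAt_mvfderiv hf hX
  have hYf := contMDiffAt_mvfderiv hf hY
  have hm : ∀ {g : M → ℝ}, ContMDiffAt I 𝓘(ℝ, ℝ) ∞ g x → MDiffAt g x :=
    fun h ↦ h.mdifferentiableAt (by simp)
  have : IsManifold I (minSmoothness ℝ 3) M := by
    simp only [minSmoothness_of_isRCLikeNormedField]
    exact IsManifold.of_le (n := ∞) (WithTop.coe_le_coe.2 le_top : ((3 : ℕ∞) : WithTop ℕ∞) ≤ ∞)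
  have le2 : (minSmoothness ℝ 2) ≤ (∞ : WithTop ℕ∞) := by
    simp only [minSmoothness_of_isRCLikeNormedField]; exact (WithTop.coe_le_coe.2 le_top : ((2 : ℕ∞) : WithTop ℕ∞) ≤ ∞)
  -- The Jacobi identity for `X, Y, fZ`, reduced by `f` times the one for `X, Y, Z`, leaves `([X,Y]f
  -- - X(Yf) + Y(Xf)) Z = 0`. Since `Z` is nonzero at `x`, the coefficient vanishes.
  have key := leibniz_identity_mlieBracket_apply (I := I) (U := X) (V := Y) (W := f • Z)
    (ContMDiffAt.of_le hX le2) (ContMDiffAt.of_le hY le2)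
    (ContMDiffAt.of_le (SmoothAt.smul hf hZ) le2)
  have key' := leibniz_identity_mlieBracket_apply (I := I) (U := X) (V := Y) (W := Z)
    (ContMDiffAt.of_le hX le2) (ContMDiffAt.of_le hY le2) (ContMDiffAt.of_le hZ le2)
  have e1 : ∀ {V : Π x : M, TangentSpace I x}, mlieBracket I V (f • Z) =ᶠ[𝓝 x]
      (fun y ↦ mvfderiv I f y (V y)) • Z + f • mlieBracket I V Z := by
    intro V
    filter_upwards [contMDiffAt_eventually_mdiff hf, hZ.eventually_mdiff] with y h1 h2
    rw [mlieBracket_smul_right h1 h2]; rfl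
  have e2 : ∀ {V U : Π x : M, TangentSpace I x}, SmoothAt I V x → SmoothAt I U x →
      mlieBracket I U (mlieBracket I V (f • Z)) x =
      mvfderiv I (fun y ↦ mvfderiv I f y (V y)) x (U x) • Z x
        + mvfderiv I f x (V x) • mlieBracket I U Z x
        + mvfderiv I f x (U x) • mlieBracket I V Z x
        + f x • mlieBracket I U (mlieBracket I V Z) x := by
    intro V U hV hU
    have hVf := contMDiffAt_mvfderiv hf hV
    rw [EventuallyEq.mlieBracket_vectorField_eq (EventuallyEq.refl _ U) e1,
      mlieBracket_add_right (V := U) (W := (fun y ↦ mvfderiv I f y (V y)) • Z)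
      (W₁ := f • mlieBracket I V Z) (SmoothAt.smul hVf hZ).mdiff
      (SmoothAt.smul hf (hV.mlieBracket hZ)).mdiff,
      mlieBracket_smul_right (V := U) (hm hVf) hZ.mdiff,
      mlieBracket_smul_right (V := U) (hm hf) (hV.mlieBracket hZ).mdiff]
    simp only [add_assoc]
  rw [e2 hY hX, e2 hX hY, mlieBracket_smul_right (hm hf) hZ.mdiff, key'] at key
  rw [← sub_eq_zero]
  refine (smul_eq_zero.1 (?_ : _ • Z x = 0)).resolve_right (by rwa [hZx])
  rw [← sub_eq_zero] at key
  rw [← neg_eq_zero, ← key]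
  simp only [smul_add]
  module

end Calculus
end
end RiemGeom

namespace RiemGeom
noncomputable section
-- Orthonormal frames and smoothness of covariant derivatives.
section Connection
open Filter Topology
set_option linter.unusedSectionVars false

variable {E : Type*} [NormedAddCommGroup E] [NormedSpace ℝ E] [FiniteDimensional ℝ E]
  {H : Type*} [TopologicalSpace H] {I : ModelWithCorners ℝ E H}
  {M : Type*} [TopologicalSpace M] [ChartedSpace H M] [IsManifold I ∞ M]
  [RiemannianBundle (fun x : M ↦ TangentSpace I x)]
  [IsContMDiffRiemannianBundle I ∞ E (fun x : M ↦ TangentSpace I x)]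
  {X Y Z W : Π x : M, TangentSpace I x} {f : M → ℝ} {x : M}

lemma SmoothAt.inner (hX : SmoothAt I X x) (hY : SmoothAt I Y x) :
    ContMDiffAt I 𝓘(ℝ, ℝ) ∞ (fun y ↦ (inner ℝ (X y) (Y y) : ℝ)) x :=
  ContMDiffAt.inner_bundle (E := fun x : M ↦ TangentSpace I x) (b := fun y : M ↦ y) hX hY

lemma SmoothAt.sum {ι : Type*} (s : Finset ι) {X : ι → Π x : M, TangentSpace I x}
    (h : ∀ i ∈ s, SmoothAt I (X i) x) : SmoothAt I (fun y ↦ ∑ i ∈ s, X i y) x :=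
  ContMDiffAt.sum_section h

/-- Induction along the recursion: each step subtracts projections whose coefficients are quotients
of smooth functions. The denominators are nonzero at `x` because the fields are independent there.
-/
lemma smoothAt_gramSchmidt {n : ℕ} {s : Fin n → Π x : M, TangentSpace I x}
    (hs : ∀ i, SmoothAt I (s i) x) (hli : LinearIndependent ℝ (fun i ↦ s i x)) (i : Fin n) :
    SmoothAt I (fun y ↦ InnerProductSpace.gramSchmidt ℝ (fun j ↦ s j y) i) x := by
  induction i using WellFoundedLT.induction with
  | _ i ih =>
    have h : (fun y ↦ InnerProductSpace.gramSchmidt ℝ (fun j ↦ s j y) i) = s i - fun y ↦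
        ∑ j ∈ Finset.Iio i, ((inner ℝ (InnerProductSpace.gramSchmidt ℝ (fun j ↦ s j y) j) (s i y) /
          inner ℝ (InnerProductSpace.gramSchmidt ℝ (fun j ↦ s j y) j)
            (InnerProductSpace.gramSchmidt ℝ (fun j ↦ s j y) j) : ℝ) •
              InnerProductSpace.gramSchmidt ℝ (fun j ↦ s j y) j) := by
      funext y
      have := InnerProductSpace.gramSchmidt_def'' ℝ (fun j ↦ s j y) i
      simp only [real_inner_self_eq_norm_sq]
      exact eq_sub_of_add_eq this.symm
    rw [h]
    refine (hs i).sub (SmoothAt.sum _ fun j hj ↦ ?_)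
    have hj := ih j (Finset.mem_Iio.1 hj)
    refine SmoothAt.smul (ContMDiffAt.div₀ (hj.inner (hs i)) (hj.inner hj) ?_) hj
    have := InnerProductSpace.gramSchmidt_ne_zero j hli
    simpa using this

variable (I) in
/-- Near every point there is a smooth orthonormal frame. -/
lemma exists_orthonormal_frame (x : M) : ∃ e : Fin (finrank ℝ E) → Π x : M, TangentSpace I x,
    (∀ i, SmoothAt I (e i) x) ∧ ∀ᶠ y in 𝓝 x, Orthonormal ℝ (fun i ↦ e i y) := by
  let t := trivializationAt E (fun x : M ↦ TangentSpace I x) x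
  let b := finBasis ℝ E
  have hx : x ∈ t.baseSet := FiberBundle.mem_baseSet_trivializationAt' x
  have hfr := t.isLocalFrameOn_localFrame_baseSet I ∞ b
  have hs : ∀ i, SmoothAt I (t.localFrame b i) x :=
    fun i ↦ (hfr.contMDiffOn i).contMDiffAt (t.open_baseSet.mem_nhds hx)
  refine ⟨fun i y ↦ InnerProductSpace.gramSchmidtNormed ℝ (fun j ↦ t.localFrame b j y) i,
    fun i ↦ ?_, ?_⟩
  · have h := smoothAt_gramSchmidt hs (hfr.linearIndependent hx) i
    refine SmoothAt.smul (f := fun y ↦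
      ‖InnerProductSpace.gramSchmidt ℝ (fun j ↦ t.localFrame b j y) i‖⁻¹) ?_ h
    have h0 := InnerProductSpace.gramSchmidt_ne_zero i (hfr.linearIndependent hx)
    have h1 := h.inner h
    simp only [real_inner_self_eq_norm_sq] at h1
    have h2 : ContMDiffAt I 𝓘(ℝ, ℝ) ∞ (fun y ↦
        (√(‖InnerProductSpace.gramSchmidt ℝ (fun j ↦ t.localFrame b j y) i‖ ^ 2))⁻¹) x := by
      have h3 : ContDiffAt ℝ ∞ (fun r : ℝ ↦ (√r)⁻¹)
          (‖InnerProductSpace.gramSchmidt ℝ (fun j ↦ t.localFrame b j x) i‖ ^ 2) := by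
        have : ‖InnerProductSpace.gramSchmidt ℝ (fun j ↦ t.localFrame b j x) i‖ ^ 2 ≠ 0 := by
          simpa using h0
        refine (Real.contDiffAt_sqrt this).inv ?_
        simpa using h0
      exact ContMDiffAt.comp (I' := 𝓘(ℝ, ℝ)) (g := fun r : ℝ ↦ (√r)⁻¹) x h3.contMDiffAt h1
    simpa using h2
  · filter_upwards [t.open_baseSet.mem_nhds hx] with y hy
    exact InnerProductSpace.gramSchmidtNormed_orthonormal (hfr.linearIndependent hy)

lemma orthonormal_sum_inner_smul {ι V : Type*} [Fintype ι] [NormedAddCommGroup V]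
    [InnerProductSpace ℝ V] [FiniteDimensional ℝ V] {e : ι → V} (he : Orthonormal ℝ e)
    (hc : Fintype.card ι = finrank ℝ V) (v : V) : ∑ i, (inner ℝ (e i) v : ℝ) • e i = v := by
  let b : OrthonormalBasis ι ℝ V := OrthonormalBasis.mk he
    (he.linearIndependent.span_eq_top_of_card_eq_finrank' hc).ge
  simpa [b] using b.sum_repr' v

lemma finrank_tangentSpace (x : M) : finrank ℝ (TangentSpace I x) = finrank ℝ E := rfl

/-- A vector field is smooth as soon as its inner products with smooth fields are. -/
lemma smoothAt_of_inner
    (h : ∀ Z : Π x : M, TangentSpace I x, SmoothAt I Z x →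
      ContMDiffAt I 𝓘(ℝ, ℝ) ∞ (fun y ↦ (inner ℝ (Z y) (Y y) : ℝ)) x) : SmoothAt I Y x := by
  obtain ⟨e, he, ho⟩ := exists_orthonormal_frame I x
  refine SmoothAt.congr (SmoothAt.sum Finset.univ (X := fun i y ↦ (inner ℝ (e i y) (Y y) : ℝ) • e i y)
    fun i _ ↦ SmoothAt.smul (h (e i) (he i)) (he i)) ?_
  filter_upwards [ho] with y hy
  exact (orthonormal_sum_inner_smul hy (by simp [finrank_tangentSpace]) (Y y)).symm

/-- The field `∇_X Y`. -/
def nabla (X Y : Π x : M, TangentSpace I x) : Π x : M, TangentSpace I x :=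
  fun x ↦ leviCivita I M Y x (X x)

lemma contMDiffAt_koszul (hX : SmoothAt I X x) (hY : SmoothAt I Y x) (hZ : SmoothAt I Z x) :
    ContMDiffAt I 𝓘(ℝ, ℝ) ∞ (fun y ↦ koszul X Y Z y) x := by
  unfold koszul
  exact (((((contMDiffAt_mvfderiv (hY.inner hZ) hX).add (contMDiffAt_mvfderiv (hZ.inner hX) hY)).sub
    (contMDiffAt_mvfderiv (hX.inner hY) hZ)).add ((hX.mlieBracket hY).inner hZ)).sub
    ((hX.mlieBracket hZ).inner hY)).sub ((hY.mlieBracket hZ).inner hX)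

/-- The Koszul formula makes all pairings of `∇_X Y` with smooth fields smooth, and these determine
the field in a smooth orthonormal frame. -/
lemma SmoothAt.nabla (hX : SmoothAt I X x) (hY : SmoothAt I Y x) : SmoothAt I (nabla X Y) x := by
  refine smoothAt_of_inner fun Z hZ ↦ ?_
  refine ((contMDiffAt_const (c := (1 / 2 : ℝ))).mul
    (contMDiffAt_koszul hX hY hZ)).congr_of_eventuallyEq ?_
  filter_upwards [hX.eventually_mdiff, hY.eventually_mdiff, hZ.eventually_mdiff] with y h1 h2 h3
  rw [real_inner_comm]
  exact inner_leviCivita h1 h2 h3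

lemma leviCivita_congr {Y' : Π x : M, TangentSpace I x} (hY : SmoothAt I Y x)
    (h : ∀ᶠ y in 𝓝 x, Y' y = Y y) : leviCivita I M Y' x = leviCivita I M Y x :=
  (leviCivita I M).isCovariantDerivativeOnUniv.congr_of_eventuallyEq
    (hY.congr h).mdiff hY.mdiff univ_mem h

lemma leviCivita_add (hX : MDiffAt (T% X) x) (hY : MDiffAt (T% Y) x) :
    leviCivita I M (X + Y) x = leviCivita I M X x + leviCivita I M Y x :=
  (leviCivita I M).isCovariantDerivativeOnUniv.add hX hY

lemma leviCivita_smul (hf : MDiffAt f x) (hX : MDiffAt (T% X) x) (v : TangentSpace I x) :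
    leviCivita I M (f • X) x v = f x • leviCivita I M X x v + mvfderiv I f x v • X x := by
  rw [(leviCivita I M).isCovariantDerivativeOnUniv.leibniz hX hf]
  rfl

lemma leviCivita_neg (hX : MDiffAt (T% X) x) : leviCivita I M (-X) x = -leviCivita I M X x := by
  have := (leviCivita I M).isCovariantDerivativeOnUniv.smul_const (-1 : ℝ) hX
  simpa using this

lemma leviCivita_sub (hX : MDiffAt (T% X) x) (hY : MDiffAt (T% Y) x) :
    leviCivita I M (X - Y) x = leviCivita I M X x - leviCivita I M Y x := by
  rw [sub_eq_add_neg, leviCivita_add hX (mdifferentiableAt_neg_section hY), leviCivita_neg hY,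
    sub_eq_add_neg]

lemma leviCivita_torsionFree (hX : MDiffAt (T% X) x) (hY : MDiffAt (T% Y) x) :
    leviCivita I M Y x (X x) - leviCivita I M X x (Y x) = mlieBracket I X Y x := by
  have := FiniteDimensional.complete ℝ E
  exact ((CovariantDerivative.torsion_eq_zero_iff _).1 (leviCivita_torsion (I := I) (M := M))) hX hY

lemma leviCivita_metric_apply (v : TangentSpace I x) (hX : MDiffAt (T% X) x)
    (hY : MDiffAt (T% Y) x) :
    mvfderiv I (fun y ↦ (inner ℝ (X y) (Y y) : ℝ)) x v
      = inner ℝ (leviCivita I M X x v) (Y x) + inner ℝ (X x) (leviCivita I M Y x v) := by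
  have hv := FiberBundle.extend_apply_self E (E := fun x : M ↦ TangentSpace I x) v
  have := leviCivita_metric (smoothAt_extend (I := I) v).mdiff hX hY
  rwa [hv] at this

lemma mvfderiv_congr {f g : M → ℝ} (h : ∀ᶠ y in 𝓝 x, f y = g y) :
    mvfderiv I f x = mvfderiv I g x := by
  unfold mvfderiv
  have h0 : f x = g x := h.self_of_nhds
  have : mfderiv I 𝓘(ℝ, ℝ) f x = mfderiv I 𝓘(ℝ, ℝ) g x :=
    Filter.EventuallyEq.mfderiv_eq (I := I) (I' := 𝓘(ℝ, ℝ)) h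
  ext v
  exact congrArg (fun T : E →L[ℝ] ℝ ↦ T v) this

end Connection
end
end RiemGeom

namespace RiemGeom
noncomputable section
-- Symmetries of the Riemann tensor, and the scalar curvature as a trace.
section Curvature
open Filter Topology
set_option linter.unusedSectionVars false

variable {E : Type*} [NormedAddCommGroup E] [NormedSpace ℝ E] [FiniteDimensional ℝ E]
  {H : Type*} [TopologicalSpace H] {I : ModelWithCorners ℝ E H}
  {M : Type*} [TopologicalSpace M] [ChartedSpace H M] [IsManifold I ∞ M]
  [RiemannianBundle (fun x : M ↦ TangentSpace I x)]
  [IsContMDiffRiemannianBundle I ∞ E (fun x : M ↦ TangentSpace I x)]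
  {X Y Z W : Π x : M, TangentSpace I x} {f : M → ℝ} {x : M}

/-- The curvature of the Levi-Civita connection, on vector fields. -/
def curv (X Y Z : Π x : M, TangentSpace I x) : Π x : M, TangentSpace I x := fun x ↦
  leviCivita I M (nabla Y Z) x (X x) - leviCivita I M (nabla X Z) x (Y x)
    - leviCivita I M Z x (mlieBracket I X Y x)

/-- The curvature tensor `⟨R(u,v)w, z⟩` with all indices down. -/
def riem (x : M) (u v w z : TangentSpace I x) : ℝ := inner ℝ (curvature x u v w) z

lemma extend_self (v : TangentSpace I x) :
    (FiberBundle.extend E v : Π y : M, TangentSpace I y) x = v :=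
  FiberBundle.extend_apply_self E (E := fun x : M ↦ TangentSpace I x) v

lemma curvature_eq_curv (u v w : TangentSpace I x) :
    curvature x u v w = curv (FiberBundle.extend E u) (FiberBundle.extend E v)
      (FiberBundle.extend E w) x := by
  unfold curv
  rw [extend_self, extend_self]
  rfl

lemma curv_swap : curv X Y Z x = -curv Y X Z x := by
  unfold curv
  rw [mlieBracket_swap_apply (V := X) (W := Y), map_neg]
  abel

/-- Apply `[X,Y] = XY - YX` to the function `|Z|²`. By metric compatibility `X(Y|Z|²) = 2⟨∇_X∇_Y Z,
Z⟩ + 2⟨∇_Y Z, ∇_X Z⟩`, and the last term is symmetric in `X, Y`. -/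
lemma inner_curv_self (hX : SmoothAt I X x) (hY : SmoothAt I Y x) (hZ : SmoothAt I Z x) :
    (inner ℝ (curv X Y Z x) (Z x) : ℝ) = 0 := by
  have h1 : ∀ {V : Π x : M, TangentSpace I x}, SmoothAt I V x →
      ∀ᶠ y in 𝓝 x, mvfderiv I (fun y ↦ (inner ℝ (Z y) (Z y) : ℝ)) y (V y)
        = 2 * inner ℝ (nabla V Z y) (Z y) := by
    intro V hV
    filter_upwards [hZ.eventually_mdiff] with y h
    rw [leviCivita_metric_apply (V y) h h, real_inner_comm (leviCivita I M Z y (V y)) (Z y)]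
    unfold nabla
    ring
  have h2 : ∀ {U V : Π x : M, TangentSpace I x}, SmoothAt I U x → SmoothAt I V x →
      mvfderiv I (fun y ↦ mvfderiv I (fun y ↦ (inner ℝ (Z y) (Z y) : ℝ)) y (V y)) x (U x)
        = 2 * (inner ℝ (leviCivita I M (nabla V Z) x (U x)) (Z x)
          + inner ℝ (nabla V Z x) (nabla U Z x)) := by
    intro U V hU hV
    have hn := (hV.nabla hZ)
    rw [mvfderiv_congr (h1 hV), mvfderiv_fun_mul mdifferentiableAt_const
      (mdifferentiableAt_inner hn.mdiff hZ.mdiff)]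
    simp only [mvfderiv_const, smul_zero, add_zero]
    rw [smul_apply, leviCivita_metric_apply (U x) hn.mdiff hZ.mdiff]
    simp [nabla]
  have h3 := mvfderiv_mlieBracket hX hY (hZ.inner hZ)
  rw [h2 hX hY, h2 hY hX, leviCivita_metric_apply _ hZ.mdiff hZ.mdiff,
    real_inner_comm (nabla X Z x) (nabla Y Z x)] at h3
  unfold curv
  rw [inner_sub_left, inner_sub_left]
  rw [real_inner_comm _ (Z x)] at h3
  linarith

lemma curv_add_right (hX : SmoothAt I X x) (hY : SmoothAt I Y x) (hZ : SmoothAt I Z x)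
    (hW : SmoothAt I W x) : curv X Y (Z + W) x = curv X Y Z x + curv X Y W x := by
  have h : ∀ {V : Π x : M, TangentSpace I x}, SmoothAt I V x →
      leviCivita I M (nabla V (Z + W)) x
        = leviCivita I M (nabla V Z) x + leviCivita I M (nabla V W) x := by
    intro V hV
    rw [leviCivita_congr (Y := nabla V Z + nabla V W) ((hV.nabla hZ).add (hV.nabla hW)),
      leviCivita_add (hV.nabla hZ).mdiff (hV.nabla hW).mdiff]
    filter_upwards [hZ.eventually_mdiff, hW.eventually_mdiff] with y h1 h2
    simp [nabla, leviCivita_add h1 h2]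
  unfold curv
  rw [h hX, h hY, leviCivita_add hZ.mdiff hW.mdiff]
  simp only [add_apply]
  abel

lemma inner_curv_antisymm (hX : SmoothAt I X x) (hY : SmoothAt I Y x) (hZ : SmoothAt I Z x)
    (hW : SmoothAt I W x) :
    (inner ℝ (curv X Y Z x) (W x) : ℝ) = -inner ℝ (curv X Y W x) (Z x) := by
  have h := inner_curv_self hX hY (hZ.add hW)
  rw [curv_add_right hX hY hZ hW, Pi.add_apply, inner_add_left, inner_add_right, inner_add_right,
    inner_curv_self hX hY hZ, inner_curv_self hX hY hW] at h
  linarith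

/-- Using torsion-freeness twice, the cyclic sum becomes the cyclic sum of `[X,[Y,Z]]`, so this is
the Jacobi identity. -/
lemma curv_bianchi (hX : SmoothAt I X x) (hY : SmoothAt I Y x) (hZ : SmoothAt I Z x) :
    curv X Y Z x + curv Y Z X x + curv Z X Y x = 0 := by
  have := FiniteDimensional.complete ℝ E
  have : IsManifold I (minSmoothness ℝ 3) M := by
    simp only [minSmoothness_of_isRCLikeNormedField]
    exact IsManifold.of_le (n := ∞) (WithTop.coe_le_coe.2 le_top : ((3 : ℕ∞) : WithTop ℕ∞) ≤ ∞)
  have le2 : (minSmoothness ℝ 2) ≤ (∞ : WithTop ℕ∞) := by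
    simp only [minSmoothness_of_isRCLikeNormedField]
    exact (WithTop.coe_le_coe.2 le_top : ((2 : ℕ∞) : WithTop ℕ∞) ≤ ∞)
  have jac := leibniz_identity_mlieBracket_apply (I := I) (U := X) (V := Y) (W := Z)
    (ContMDiffAt.of_le hX le2) (ContMDiffAt.of_le hY le2) (ContMDiffAt.of_le hZ le2)
  have h : ∀ {U V : Π x : M, TangentSpace I x}, SmoothAt I U x → SmoothAt I V x →
      leviCivita I M (nabla U V) x - leviCivita I M (nabla V U) x
        = leviCivita I M (mlieBracket I U V) x := by
    intro U V hU hV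
    rw [← leviCivita_sub (hU.nabla hV).mdiff (hV.nabla hU).mdiff]
    symm
    refine leviCivita_congr ((hU.nabla hV).sub (hV.nabla hU)) ?_
    filter_upwards [hU.eventually_mdiff, hV.eventually_mdiff] with y h1 h2
    exact (leviCivita_torsionFree h1 h2).symm
  have e : curv X Y Z x + curv Y Z X x + curv Z X Y x =
      ((leviCivita I M (nabla Y Z) x - leviCivita I M (nabla Z Y) x) (X x)
        - leviCivita I M X x (mlieBracket I Y Z x))
      + ((leviCivita I M (nabla Z X) x - leviCivita I M (nabla X Z) x) (Y x)
        - leviCivita I M Y x (mlieBracket I Z X x))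
      + ((leviCivita I M (nabla X Y) x - leviCivita I M (nabla Y X) x) (Z x)
        - leviCivita I M Z x (mlieBracket I X Y x)) := by
    unfold curv
    simp only [sub_apply]
    abel
  rw [e, h hY hZ, h hZ hX, h hX hY, leviCivita_torsionFree hX.mdiff (hY.mlieBracket hZ).mdiff,
    leviCivita_torsionFree hY.mdiff (hZ.mlieBracket hX).mdiff,
    leviCivita_torsionFree hZ.mdiff (hX.mlieBracket hY).mdiff, jac,
    mlieBracket_swap (V := Z) (W := X), mlieBracket_swap_apply (V := Z) (W := mlieBracket I X Y)]
  have : mlieBracket I Y (-mlieBracket I X Z) x = -mlieBracket I Y (mlieBracket I X Z) x := by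
    have h := mlieBracket_const_smul_right (V := Y) (c := (-1 : ℝ)) (hX.mlieBracket hZ).mdiff
    simpa using h
  rw [this]
  abel

lemma curv_bianchi_inner (hX : SmoothAt I X x) (hY : SmoothAt I Y x) (hZ : SmoothAt I Z x)
    (w : TangentSpace I x) : (inner ℝ (curv X Y Z x) w : ℝ) + inner ℝ (curv Y Z X x) w
      + inner ℝ (curv Z X Y x) w = 0 := by
  rw [← inner_add_left, ← inner_add_left, curv_bianchi hX hY hZ, inner_zero_left]

/-- The usual octahedron argument: a linear combination of four Bianchi identities and the two
skew-symmetries. -/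
lemma inner_curv_pair (hX : SmoothAt I X x) (hY : SmoothAt I Y x) (hZ : SmoothAt I Z x)
    (hW : SmoothAt I W x) :
    (inner ℝ (curv X Y Z x) (W x) : ℝ) = inner ℝ (curv Z W X x) (Y x) := by
  have s : ∀ {X Y Z W : Π x : M, TangentSpace I x},
      (inner ℝ (curv X Y Z x) (W x) : ℝ) = -inner ℝ (curv Y X Z x) (W x) := by
    intro X Y Z W
    rw [curv_swap, inner_neg_left]
  have b1 := curv_bianchi_inner hX hY hZ (W x)
  have b2 := curv_bianchi_inner hY hZ hW (X x)
  have b3 := curv_bianchi_inner hZ hW hX (Y x)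
  have b4 := curv_bianchi_inner hW hX hY (Z x)
  have a1 := inner_curv_antisymm hX hY hZ hW
  have a2 := inner_curv_antisymm hY hZ hX hW
  have a3 := inner_curv_antisymm hZ hX hY hW
  have a4 := inner_curv_antisymm hZ hW hY hX
  have a5 := inner_curv_antisymm hW hY hZ hX
  have a6 := inner_curv_antisymm hW hX hZ hY
  have s1 := @s X Z Y W
  have s2 := @s X W Y Z
  have s3 := @s X W Z Y
  have s4 := @s Y W X Z
  have s5 := @s Z W X Y
  have s6 := @s Y X W Z
  have s7 := @s W Y X Z
  have s8 := @s Z X W Y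
  linarith

/-- Tensoriality comes from the symmetries alone. Only the fourth slot visibly depends on a value at
`x`; the symmetries carry each other slot there in turn, where a field may be exchanged for the
extension of its value. Hence `curvature` does not depend on the chosen extensions. -/
lemma inner_curv_eq_riem (hX : SmoothAt I X x) (hY : SmoothAt I Y x) (hZ : SmoothAt I Z x)
    (hW : SmoothAt I W x) :
    (inner ℝ (curv X Y Z x) (W x) : ℝ) = riem x (X x) (Y x) (Z x) (W x) := by
  unfold riem
  rw [curvature_eq_curv]
  set X' : Π y : M, TangentSpace I y := FiberBundle.extend E (X x)
  set Y' : Π y : M, TangentSpace I y := FiberBundle.extend E (Y x)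
  set Z' : Π y : M, TangentSpace I y := FiberBundle.extend E (Z x)
  have hX' : SmoothAt I X' x := smoothAt_extend (X x)
  have hY' : SmoothAt I Y' x := smoothAt_extend (Y x)
  have hZ' : SmoothAt I Z' x := smoothAt_extend (Z x)
  have eX : X' x = X x := extend_self (X x)
  have eY : Y' x = Y x := extend_self (Y x)
  have eZ : Z' x = Z x := extend_self (Z x)
  rw [inner_curv_antisymm hX hY hZ hW, ← eZ, ← inner_curv_antisymm hX hY hZ' hW,
    inner_curv_pair hX hY hZ' hW, ← eY, inner_curv_antisymm hZ' hW hX hY', ← eX,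
    ← inner_curv_antisymm hZ' hW hX' hY', ← inner_curv_pair hX' hY' hZ' hW]

variable (u v w z : TangentSpace I x)

lemma riem_eq : riem x u v w z = inner ℝ (curv (FiberBundle.extend E u) (FiberBundle.extend E v)
      (FiberBundle.extend E w) x) ((FiberBundle.extend E z : Π y : M, TangentSpace I y) x) := by
  rw [riem, curvature_eq_curv, extend_self]

lemma riem_swap : riem x u v w z = -riem x v u w z := by
  rw [riem_eq, riem_eq, curv_swap, inner_neg_left]

lemma riem_antisymm : riem x u v w z = -riem x u v z w := by
  rw [riem_eq, riem_eq, inner_curv_antisymm (smoothAt_extend _) (smoothAt_extend _)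
    (smoothAt_extend _) (smoothAt_extend _)]

lemma riem_pair : riem x u v w z = riem x w z u v := by
  rw [riem_eq, riem_eq, inner_curv_pair (smoothAt_extend _) (smoothAt_extend _)
    (smoothAt_extend _) (smoothAt_extend _)]

lemma riem_bianchi : riem x u v w z + riem x v w u z + riem x w u v z = 0 := by
  rw [riem_eq, riem_eq, riem_eq]
  exact curv_bianchi_inner (smoothAt_extend _) (smoothAt_extend _) (smoothAt_extend _) _

lemma riem_add_four (z' : TangentSpace I x) :
    riem x u v w (z + z') = riem x u v w z + riem x u v w z' := inner_add_right _ _ _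

lemma riem_smul_four (c : ℝ) : riem x u v w (c • z) = c * riem x u v w z :=
  real_inner_smul_right _ _ _

lemma riem_add_three (w' : TangentSpace I x) :
    riem x u v (w + w') z = riem x u v w z + riem x u v w' z := by
  rw [riem_antisymm, riem_add_four, riem_antisymm u v w, riem_antisymm u v w']; ring

lemma riem_smul_three (c : ℝ) : riem x u v (c • w) z = c * riem x u v w z := by
  rw [riem_antisymm, riem_smul_four, riem_antisymm u v w]; ring

lemma riem_add_two (v' : TangentSpace I x) :
    riem x u (v + v') w z = riem x u v w z + riem x u v' w z := by
  rw [riem_pair, riem_add_four, riem_pair u v, riem_pair u v']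

lemma riem_smul_two (c : ℝ) : riem x u (c • v) w z = c * riem x u v w z := by
  rw [riem_pair, riem_smul_four, riem_pair u v]

lemma riem_add_one (u' : TangentSpace I x) :
    riem x (u + u') v w z = riem x u v w z + riem x u' v w z := by
  rw [riem_swap, riem_add_two, riem_swap u v, riem_swap u' v]; ring

lemma riem_smul_one (c : ℝ) : riem x (c • u) v w z = c * riem x u v w z := by
  rw [riem_swap, riem_smul_two, riem_swap u v]; ring

/-- Expand one basis in the other and use Parseval. This allows the scalar curvature to be computed
in a frame adapted to `J`. -/
lemma trace_basis_indep {V ι κ : Type*} [NormedAddCommGroup V] [InnerProductSpace ℝ V]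
    [Fintype ι] [Fintype κ] (B : V →ₗ[ℝ] V →ₗ[ℝ] ℝ) (b : OrthonormalBasis ι ℝ V)
    (b' : OrthonormalBasis κ ℝ V) : ∑ i, B (b i) (b i) = ∑ i, B (b' i) (b' i) := by
  have h : ∀ i, B (b i) (b i) = ∑ k, ∑ l,
      (inner ℝ (b' k) (b i) : ℝ) * (inner ℝ (b i) (b' l) : ℝ) * B (b' k) (b' l) := by
    intro i
    conv_lhs => rw [← b'.sum_repr' (b i)]
    simp only [map_sum, LinearMap.map_smul, LinearMap.sum_apply, LinearMap.smul_apply, smul_eq_mul]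
    rw [Finset.sum_comm]
    refine Finset.sum_congr rfl fun k _ ↦ Finset.sum_congr rfl fun l _ ↦ ?_
    rw [real_inner_comm (b' l) (b i)]
    ring
  simp only [h]
  rw [Finset.sum_comm]
  refine Finset.sum_congr rfl fun k _ ↦ ?_
  rw [Finset.sum_comm]
  classical
  rw [Finset.sum_eq_single k]
  · simp_rw [← Finset.sum_mul]
    rw [b.sum_inner_mul_inner]
    simp
  · intro l _ hl
    rw [← Finset.sum_mul, b.sum_inner_mul_inner, b'.inner_eq_zero hl.symm, zero_mul]
  · simp

/-- The scalar curvature, computed with any orthonormal basis. -/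
lemma scalarCurvature_eq {ι : Type*} [Fintype ι] (b : OrthonormalBasis ι ℝ (TangentSpace I x)) :
    scalarCurvature I x = ∑ i, ∑ j, riem x (b i) (b j) (b j) (b i) := by
  have h1 : ∀ v w : TangentSpace I x, ricci x v w = ∑ j, riem x v (b j) (b j) w := by
    intro v w
    exact trace_basis_indep (LinearMap.mk₂ ℝ (fun a c ↦ riem x v a c w)
      (fun a a' c ↦ riem_add_two _ _ _ _ _) (fun r a c ↦ riem_smul_two _ _ _ _ _)
      (fun a c c' ↦ riem_add_three _ _ _ _ _) (fun r a c ↦ riem_smul_three _ _ _ _ _)) _ b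
  unfold scalarCurvature
  simp only [h1]
  refine trace_basis_indep (LinearMap.mk₂ ℝ (fun a c ↦ ∑ j, riem x a (b j) (b j) c) ?_ ?_ ?_ ?_) _ b
  · intro a a' c
    simp only [riem_add_one, Finset.sum_add_distrib]
  · intro r a c
    simp only [riem_smul_one, smul_eq_mul, Finset.mul_sum]
  · intro a a' c
    simp only [riem_add_four, Finset.sum_add_distrib]
  · intro r a c
    simp only [riem_smul_four, smul_eq_mul, Finset.mul_sum]

end Curvature
end
end RiemGeom

namespace RiemGeom
noncomputable section
-- The tensor `∇J` and its pointwise symmetries.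
section Endomorphism
open Filter Topology
set_option linter.unusedSectionVars false

variable {E : Type*} [NormedAddCommGroup E] [NormedSpace ℝ E] [FiniteDimensional ℝ E]
  {H : Type*} [TopologicalSpace H] {I : ModelWithCorners ℝ E H}
  {M : Type*} [TopologicalSpace M] [ChartedSpace H M] [IsManifold I ∞ M]
  [RiemannianBundle (fun x : M ↦ TangentSpace I x)]
  [IsContMDiffRiemannianBundle I ∞ E (fun x : M ↦ TangentSpace I x)]
  {J : Π x : M, TangentSpace I x →L[ℝ] TangentSpace I x}
  {X Y Z W : Π x : M, TangentSpace I x} {f : M → ℝ} {x : M}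

/-- The field `J X`. -/
def appJ (J : Π x : M, TangentSpace I x →L[ℝ] TangentSpace I x) (X : Π x : M, TangentSpace I x) :
    Π x : M, TangentSpace I x := fun y ↦ J y (X y)

/-- The field `(∇_X J) Y`. -/
def covJ (J : Π x : M, TangentSpace I x →L[ℝ] TangentSpace I x) (X Y : Π x : M, TangentSpace I x) :
    Π x : M, TangentSpace I x := fun y ↦ covDerivEnd J y (X y) (Y y)

namespace IsAlmostHermitian

lemma mdiff_appJ (hJ : IsAlmostHermitian J) (hX : MDiffAt (T% X) x) :
    MDiffAt (T% (appJ J X)) x :=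
  MDifferentiableAt.clm_bundle_apply
    ((hJ.contMDiff x).mdifferentiableAt (by simp)) hX

lemma smooth_appJ (hJ : IsAlmostHermitian J) (hX : SmoothAt I X x) : SmoothAt I (appJ J X) x :=
  ContMDiffAt.clm_bundle_apply (hJ.contMDiff x) hX

/-- The derivative terms `df(v) JY` of the two summands cancel. So the extension chosen in
`covDerivEnd` is immaterial, and the product rule `leviCivita_appJ` holds for every differentiable
field. -/
lemma tensorial (hJ : IsAlmostHermitian J) (v : TangentSpace I x) :
    TensorialAt I E (fun Y : Π x : M, TangentSpace I x ↦
      leviCivita I M (appJ J Y) x v - J x (leviCivita I M Y x v)) x where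
  smul {f Y} hf hY := by
    have h : appJ J (f • Y) = f • appJ J Y := by
      ext y; simp [appJ]
    rw [h, leviCivita_smul hf (hJ.mdiff_appJ hY), leviCivita_smul hf hY]
    simp [appJ, smul_sub]
  add {Y Z} hY hZ := by
    have h : appJ J (Y + Z) = appJ J Y + appJ J Z := by
      ext y; simp [appJ]
    rw [h, leviCivita_add (hJ.mdiff_appJ hY) (hJ.mdiff_appJ hZ), leviCivita_add hY hZ]
    simp only [add_apply, map_add]
    abel

lemma leviCivita_appJ (hJ : IsAlmostHermitian J) (hY : MDiffAt (T% Y) x) (v : TangentSpace I x) :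
    leviCivita I M (appJ J Y) x v = covDerivEnd J x v (Y x) + J x (leviCivita I M Y x v) := by
  have h := (hJ.tensorial v).pointwise hY (smoothAt_extend (I := I) (Y x)).mdiff
    (extend_self (Y x)).symm
  rw [← sub_eq_iff_eq_add, h]
  rfl

lemma smooth_covJ (hJ : IsAlmostHermitian J) (hX : SmoothAt I X x) (hY : SmoothAt I Y x) :
    SmoothAt I (covJ J X Y) x := by
  refine ((hX.nabla (hJ.smooth_appJ hY)).sub (hJ.smooth_appJ (hX.nabla hY))).congr ?_
  filter_upwards [hY.eventually_mdiff] with y h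
  simp only [Pi.sub_apply, nabla, hJ.leviCivita_appJ h, covJ, appJ]
  abel

variable (u v w z : TangentSpace I x)

lemma covDerivEnd_add_left : covDerivEnd J x (u + v) w = covDerivEnd J x u w + covDerivEnd J x v w := by
  simp only [covDerivEnd, map_add]
  abel

lemma covDerivEnd_smul_left (c : ℝ) : covDerivEnd J x (c • u) w = c • covDerivEnd J x u w := by
  simp only [covDerivEnd, map_smul, smul_sub]

lemma covDerivEnd_add_right (hJ : IsAlmostHermitian J) :
    covDerivEnd J x u (v + w) = covDerivEnd J x u v + covDerivEnd J x u w := by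
  have hv := smoothAt_extend (I := I) v
  have hw := smoothAt_extend (I := I) w
  have h1 := hJ.leviCivita_appJ hv.mdiff u
  have h2 := hJ.leviCivita_appJ hw.mdiff u
  have h3 := hJ.leviCivita_appJ (hv.add hw).mdiff u
  rw [Pi.add_apply, extend_self, extend_self] at h3
  rw [extend_self] at h1 h2
  have h : appJ J (FiberBundle.extend E v + FiberBundle.extend E w : Π y : M, TangentSpace I y)
      = appJ J (FiberBundle.extend E v) + appJ J (FiberBundle.extend E w) := by
    ext y; simp [appJ]
  rw [h, leviCivita_add (hJ.smooth_appJ hv).mdiff (hJ.smooth_appJ hw).mdiff,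
    leviCivita_add hv.mdiff hw.mdiff, add_apply, add_apply, h1, h2, map_add] at h3
  rw [← sub_eq_zero] at h3 ⊢
  rw [← neg_eq_zero, ← h3]
  abel

lemma covDerivEnd_smul_right (hJ : IsAlmostHermitian J) (c : ℝ) :
    covDerivEnd J x u (c • v) = c • covDerivEnd J x u v := by
  have hv := smoothAt_extend (I := I) v
  have hc : MDiffAt (fun _ : M ↦ c) x := mdifferentiableAt_const
  have h1 := hJ.leviCivita_appJ hv.mdiff u
  have h3 := hJ.leviCivita_appJ (SmoothAt.smul (contMDiffAt_const (c := c)) hv).mdiff u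
  rw [Pi.smul_apply', extend_self] at h3
  rw [extend_self] at h1
  have h : appJ J ((fun _ : M ↦ c) • (FiberBundle.extend E v : Π y : M, TangentSpace I y))
      = (fun _ : M ↦ c) • appJ J (FiberBundle.extend E v) := by
    ext y; simp [appJ]
  rw [h, leviCivita_smul hc (hJ.smooth_appJ hv).mdiff, leviCivita_smul hc hv.mdiff, h1] at h3
  simp only [mvfderiv_const, zero_apply, zero_smul, add_zero, smul_add, map_smul] at h3
  exact (add_right_cancel h3).symm

lemma inner_J_left (hJ : IsAlmostHermitian J) :
    (inner ℝ (J x u) v : ℝ) = -inner ℝ u (J x v) := by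
  rw [← hJ.inner_map_map x u (J x v), hJ.sq, inner_neg_right, neg_neg]

lemma inner_J_self (hJ : IsAlmostHermitian J) : (inner ℝ u (J x u) : ℝ) = 0 := by
  have := hJ.inner_J_left u u
  rw [real_inner_comm] at this
  linarith

lemma norm_J (hJ : IsAlmostHermitian J) : ‖J x u‖ = ‖u‖ := by
  rw [@norm_eq_sqrt_real_inner, @norm_eq_sqrt_real_inner, hJ.inner_map_map]

/-- The covariant derivative of the skew-symmetry `⟨Jv, w⟩ = -⟨v, Jw⟩`. -/
lemma inner_covDerivEnd (hJ : IsAlmostHermitian J) :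
    (inner ℝ (covDerivEnd J x u v) w : ℝ) = -inner ℝ v (covDerivEnd J x u w) := by
  have hv := smoothAt_extend (I := I) v
  have hw := smoothAt_extend (I := I) w
  have h1 := leviCivita_metric_apply u (hJ.smooth_appJ hv).mdiff hw.mdiff
  have h2 := leviCivita_metric_apply u hv.mdiff (hJ.smooth_appJ hw).mdiff
  have h : (fun y : M ↦ (inner ℝ (appJ J (FiberBundle.extend E v) y)
      ((FiberBundle.extend E w : Π y : M, TangentSpace I y) y) : ℝ))
      = -(fun y : M ↦ (inner ℝ ((FiberBundle.extend E v : Π y : M, TangentSpace I y) y)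
        (appJ J (FiberBundle.extend E w) y) : ℝ)) := by
    ext y; simp only [appJ, hJ.inner_J_left, Pi.neg_apply]
  rw [h, mvfderiv_neg, neg_apply, h2, hJ.leviCivita_appJ hv.mdiff, hJ.leviCivita_appJ hw.mdiff,
    extend_self, extend_self, inner_add_left, inner_add_right] at h1
  simp only [appJ, extend_self, hJ.inner_J_left] at h1
  linarith

/-- The covariant derivative of `J² = -1`. -/
lemma covDerivEnd_J (hJ : IsAlmostHermitian J) :
    covDerivEnd J x u (J x v) = -J x (covDerivEnd J x u v) := by
  have hv := smoothAt_extend (I := I) v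
  have h1 := hJ.leviCivita_appJ (hJ.smooth_appJ hv).mdiff u
  have h : appJ J (appJ J (FiberBundle.extend E v : Π y : M, TangentSpace I y))
      = -(FiberBundle.extend E v) := by
    ext y; simp only [appJ, hJ.sq, Pi.neg_apply]
  rw [h, leviCivita_neg hv.mdiff, hJ.leviCivita_appJ hv.mdiff, extend_self, map_add, hJ.sq] at h1
  simp only [appJ, extend_self] at h1
  rw [neg_apply] at h1
  rw [← sub_eq_zero] at h1 ⊢
  rw [← neg_eq_zero, ← h1]
  abel

end IsAlmostHermitian

namespace IsNearlyKahler

variable (u v w z : TangentSpace I x)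

/-- Polarisation of the nearly Kähler condition. Together with `inner_covDerivEnd` it makes `⟨(∇_u
J)v, w⟩` a 3-form. -/
lemma covDerivEnd_swap (hJ : IsNearlyKahler J) : covDerivEnd J x u v = -covDerivEnd J x v u := by
  have h := hJ.covDerivEnd_self x (u + v)
  rw [hJ.covDerivEnd_add_right, IsAlmostHermitian.covDerivEnd_add_left,
    IsAlmostHermitian.covDerivEnd_add_left, hJ.covDerivEnd_self, hJ.covDerivEnd_self] at h
  simp only [zero_add, add_zero] at h
  exact eq_neg_of_add_eq_zero_right h

lemma covDerivEnd_J_left (hJ : IsNearlyKahler J) :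
    covDerivEnd J x (J x u) v = -J x (covDerivEnd J x u v) := by
  rw [hJ.covDerivEnd_swap, hJ.covDerivEnd_J, hJ.covDerivEnd_swap u v, map_neg]

end IsNearlyKahler

end Endomorphism
end
end RiemGeom

namespace RiemGeom
noncomputable section
-- The second derivative of `J` and the Ricci identity.
section SecondDerivative
open Filter Topology
set_option linter.unusedSectionVars false

variable {E : Type*} [NormedAddCommGroup E] [NormedSpace ℝ E] [FiniteDimensional ℝ E]
  {H : Type*} [TopologicalSpace H] {I : ModelWithCorners ℝ E H}
  {M : Type*} [TopologicalSpace M] [ChartedSpace H M] [IsManifold I ∞ M]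
  [RiemannianBundle (fun x : M ↦ TangentSpace I x)]
  [IsContMDiffRiemannianBundle I ∞ E (fun x : M ↦ TangentSpace I x)]
  {J : Π x : M, TangentSpace I x →L[ℝ] TangentSpace I x}
  {X Y Z W : Π x : M, TangentSpace I x} {f : M → ℝ} {x : M}

/-- The second covariant derivative `(∇²_{w,X} J) Y`. -/
def secondCovJ (J : Π x : M, TangentSpace I x →L[ℝ] TangentSpace I x) (x : M)
    (w : TangentSpace I x) (X Y : Π x : M, TangentSpace I x) : TangentSpace I x :=
  leviCivita I M (covJ J X Y) x w - covDerivEnd J x (leviCivita I M X x w) (Y x)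
    - covDerivEnd J x (X x) (leviCivita I M Y x w)

namespace IsNearlyKahler

lemma secondCovJ_swap (hJ : IsNearlyKahler J) (hX : SmoothAt I X x) (hY : SmoothAt I Y x)
    (w : TangentSpace I x) : secondCovJ J x w X Y = -secondCovJ J x w Y X := by
  have h : covJ J X Y = -covJ J Y X := by
    ext y; exact hJ.covDerivEnd_swap _ _
  unfold secondCovJ
  rw [h, leviCivita_neg (hJ.smooth_covJ hY hX).mdiff, hJ.covDerivEnd_swap _ (Y x),
    hJ.covDerivEnd_swap (X x)]
  simp only [neg_apply]
  abel

lemma inner_secondCovJ (hJ : IsNearlyKahler J) (hX : SmoothAt I X x) (hY : SmoothAt I Y x)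
    (hZ : SmoothAt I Z x) (w : TangentSpace I x) :
    (inner ℝ (secondCovJ J x w X Y) (Z x) : ℝ) = -inner ℝ (Y x) (secondCovJ J x w X Z) := by
  have h1 := leviCivita_metric_apply w (hJ.smooth_covJ hX hY).mdiff hZ.mdiff
  have h2 := leviCivita_metric_apply w hY.mdiff (hJ.smooth_covJ hX hZ).mdiff
  have h : (fun y : M ↦ (inner ℝ (covJ J X Y y) (Z y) : ℝ))
      = -(fun y : M ↦ (inner ℝ (Y y) (covJ J X Z y) : ℝ)) := by
    ext y; exact hJ.inner_covDerivEnd _ _ _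
  rw [h, mvfderiv_neg, neg_apply, h2] at h1
  unfold secondCovJ
  simp only [inner_sub_left, inner_sub_right, hJ.inner_covDerivEnd] at *
  unfold covJ at *
  simp only [hJ.inner_covDerivEnd] at *
  linarith

/-- One more derivative of `(∇_X J)J = -J(∇_X J)`; the quadratic terms arise where the derivative
falls on `J` itself. -/
lemma secondCovJ_appJ (hJ : IsNearlyKahler J) (hX : SmoothAt I X x) (hY : SmoothAt I Y x)
    (w : TangentSpace I x) : secondCovJ J x w X (appJ J Y) = -J x (secondCovJ J x w X Y)
      - covDerivEnd J x (X x) (covDerivEnd J x w (Y x))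
      - covDerivEnd J x w (covDerivEnd J x (X x) (Y x)) := by
  have h : covJ J X (appJ J Y) = -appJ J (covJ J X Y) := by
    ext y; exact hJ.covDerivEnd_J _ _
  unfold secondCovJ
  rw [h, leviCivita_neg (hJ.smooth_appJ (hJ.smooth_covJ hX hY)).mdiff, neg_apply,
    hJ.leviCivita_appJ (hJ.smooth_covJ hX hY).mdiff, hJ.leviCivita_appJ hY.mdiff,
    hJ.covDerivEnd_add_right, hJ.covDerivEnd_J]
  simp only [appJ, covJ, hJ.covDerivEnd_J, map_sub]
  abel

/-- The Ricci identity: the curvature acts on `J` as the commutator of second covariant derivatives.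
Torsion-freeness absorbs the bracket term. -/
lemma curv_appJ (hJ : IsNearlyKahler J) (hW : SmoothAt I W x) (hX : SmoothAt I X x)
    (hY : SmoothAt I Y x) : curv W X (appJ J Y) x - J x (curv W X Y x)
      = secondCovJ J x (W x) X Y - secondCovJ J x (X x) W Y := by
  have h : ∀ {U V : Π x : M, TangentSpace I x}, SmoothAt I U x → SmoothAt I V x →
      leviCivita I M (nabla V (appJ J Y)) x (U x) = leviCivita I M (covJ J V Y) x (U x)
        + covDerivEnd J x (U x) (nabla V Y x) + J x (leviCivita I M (nabla V Y) x (U x)) := by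
    intro U V hU hV
    rw [leviCivita_congr (Y := covJ J V Y + appJ J (nabla V Y))
      ((hJ.smooth_covJ hV hY).add (hJ.smooth_appJ (hV.nabla hY))),
      leviCivita_add (hJ.smooth_covJ hV hY).mdiff (hJ.smooth_appJ (hV.nabla hY)).mdiff, add_apply,
      hJ.leviCivita_appJ (hV.nabla hY).mdiff, add_assoc]
    filter_upwards [hY.eventually_mdiff] with y h
    exact hJ.leviCivita_appJ h _
  unfold curv secondCovJ
  rw [h hW hX, h hX hW, hJ.leviCivita_appJ hY.mdiff, ← leviCivita_torsionFree hW.mdiff hX.mdiff]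
  have e : ∀ a b c : TangentSpace I x, covDerivEnd J x (a - b) c
      = covDerivEnd J x a c - covDerivEnd J x b c := by
    intro a b c
    rw [sub_eq_add_neg, IsAlmostHermitian.covDerivEnd_add_left, ← neg_one_smul ℝ b,
      IsAlmostHermitian.covDerivEnd_smul_left, neg_one_smul, sub_eq_add_neg]
  rw [e]
  simp only [map_sub, nabla]
  abel

variable (J x) in
/-- The components `⟨(∇²_{w,X} J) Y, Z⟩`. -/
def secondForm (w : TangentSpace I x) (X Y Z : Π x : M, TangentSpace I x) : ℝ :=
  inner ℝ (secondCovJ J x w X Y) (Z x)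

variable {w : TangentSpace I x}

lemma secondForm_swap (hJ : IsNearlyKahler J) (hX : SmoothAt I X x) (hY : SmoothAt I Y x) :
    secondForm J x w X Y Z = -secondForm J x w Y X Z := by
  rw [secondForm, hJ.secondCovJ_swap hX hY, inner_neg_left]; rfl

lemma secondForm_swap_right (hJ : IsNearlyKahler J) (hX : SmoothAt I X x) (hY : SmoothAt I Y x)
    (hZ : SmoothAt I Z x) : secondForm J x w X Y Z = -secondForm J x w X Z Y := by
  rw [secondForm, hJ.inner_secondCovJ hX hY hZ, real_inner_comm]; rfl

lemma secondForm_self (hJ : IsNearlyKahler J) (hX : SmoothAt I X x) :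
    secondForm J x w X X Z = 0 := by
  have := hJ.secondForm_swap hX hX (w := w) (Z := Z)
  linarith

lemma secondForm_appJ_appJ (hJ : IsNearlyKahler J) :
    secondForm J x w X Y (appJ J (appJ J Z)) = -secondForm J x w X Y Z := by
  simp only [secondForm, appJ, hJ.sq, inner_neg_right]

lemma secondForm_appJ (hJ : IsNearlyKahler J) (hX : SmoothAt I X x) (hY : SmoothAt I Y x) :
    secondForm J x w X (appJ J Y) Z = secondForm J x w X Y (appJ J Z)
      + inner ℝ (covDerivEnd J x w (Y x)) (covDerivEnd J x (X x) (Z x))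
      + inner ℝ (covDerivEnd J x (X x) (Y x)) (covDerivEnd J x w (Z x)) := by
  simp only [secondForm, hJ.secondCovJ_appJ hX hY, inner_sub_left, inner_neg_left, appJ]
  rw [hJ.inner_J_left, hJ.inner_covDerivEnd (X x) (covDerivEnd J x w (Y x)),
    hJ.inner_covDerivEnd w (covDerivEnd J x (X x) (Y x))]
  ring

lemma riem_appJ (hJ : IsNearlyKahler J) (hW : SmoothAt I W x) (hX : SmoothAt I X x)
    (hY : SmoothAt I Y x) (hZ : SmoothAt I Z x) :
    riem x (W x) (X x) (appJ J Y x) (Z x) + riem x (W x) (X x) (Y x) (appJ J Z x)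
      = secondForm J x (W x) X Y Z - secondForm J x (X x) W Y Z := by
  rw [← inner_curv_eq_riem hW hX (hJ.smooth_appJ hY) hZ,
    ← inner_curv_eq_riem hW hX hY (hJ.smooth_appJ hZ), secondForm, secondForm, ← inner_sub_left,
    ← hJ.curv_appJ hW hX hY, inner_sub_left, hJ.inner_J_left]
  simp only [appJ]
  ring

/-- Write `Ψ` for `secondForm`, `σ = Ψ(X;X,Y,Z)` and `ρ = Ψ(JX;X,Y,JZ)`. Under `h` the quadratic
errors in moving `J` between slots vanish, so the Ricci identities `d1`-`d4` have right-hand sides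
`±σ`. The Bianchi identity writes `R(X,JX,Y,Z)` as `R(X,Y,JX,Z) - R(X,Z,JX,Y)`, and similarly for
`JY, JZ`. Thus `R(X,JX,JY,JZ) - R(X,JX,Y,Z)` equals `4σ` by `d1`-`d4` and pair symmetry. By `d5` it
equals `-σ - ρ`, whence `ρ = -5σ`. -/
lemma secondForm_appJ_five (hJ : IsNearlyKahler J) (hX : SmoothAt I X x) (hY : SmoothAt I Y x)
    (hZ : SmoothAt I Z x)
    (h : (inner ℝ (covDerivEnd J x (X x) (Y x)) (covDerivEnd J x (X x) (J x (Z x))) : ℝ) = 0) :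
    secondForm J x (J x (X x)) X Y (appJ J Z) = -5 * secondForm J x (X x) X Y Z
    ∧ secondForm J x (X x) (appJ J X) Y (appJ J Z) = -secondForm J x (X x) X Y Z := by
  have jX := hJ.smooth_appJ hX
  have jY := hJ.smooth_appJ hY
  have jZ := hJ.smooth_appJ hZ
  have d1 := hJ.riem_appJ hX hY hX hZ
  have d2 := hJ.riem_appJ hX hZ hX hY
  have d3 := hJ.riem_appJ hX jY hX jZ
  have d4 := hJ.riem_appJ hX jZ hX jY
  have d5 := hJ.riem_appJ hX jX hY jZ
  rw [hJ.secondForm_self hX] at d1 d2 d3 d4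
  have nJ : ∀ a : TangentSpace I x, J x (J x a) = (-1 : ℝ) • a := fun a ↦ by
    rw [hJ.sq, neg_one_smul]
  have c1 : secondForm J x (X x) Y X Z = -secondForm J x (X x) X Y Z := hJ.secondForm_swap hY hX
  have c2 : secondForm J x (X x) Z X Y = secondForm J x (X x) X Y Z := by
    rw [hJ.secondForm_swap hZ hX, hJ.secondForm_swap_right hX hZ hY, neg_neg]
  have c3 : secondForm J x (X x) X (appJ J Y) (appJ J Z) = -secondForm J x (X x) X Y Z := by
    rw [hJ.secondForm_appJ hX hY, hJ.secondForm_appJ_appJ]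
    simp only [appJ]
    rw [h]; ring
  have c4 : secondForm J x (X x) (appJ J Y) X (appJ J Z) = secondForm J x (X x) X Y Z := by
    rw [hJ.secondForm_swap jY hX, c3, neg_neg]
  have c5 : secondForm J x (X x) (appJ J Z) X (appJ J Y) = -secondForm J x (X x) X Y Z := by
    rw [hJ.secondForm_swap jZ hX, hJ.secondForm_swap_right hX jZ jY, c3]; ring
  have c6 : secondForm J x (X x) (appJ J X) Y (appJ J Z) = -secondForm J x (X x) X Y Z := by
    rw [hJ.secondForm_swap jX hY, hJ.secondForm_appJ hY hX, hJ.secondForm_appJ_appJ,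
      hJ.secondForm_swap hY hX]
    simp only [appJ]
    rw [hJ.covDerivEnd_self, hJ.covDerivEnd_swap (Y x) (X x), inner_neg_left, h]
    simp
  refine ⟨?_, c6⟩
  rw [c1] at d1
  rw [c2] at d2
  rw [c4] at d3
  rw [c5] at d4
  rw [c6] at d5
  simp only [appJ, nJ, riem_smul_four] at d1 d2 d3 d4 d5
  generalize X x = u at *
  generalize Y x = v at *
  generalize Z x = z at *
  have b1 := riem_bianchi u v (J x u) z
  have b2 := riem_bianchi u (J x v) (J x u) (J x z)
  have p1 := riem_pair u v u (J x z)
  have p2 := riem_pair u (J x v) u z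
  have p3 := riem_pair v (J x u) u z
  have p4 := riem_pair (J x v) (J x u) u (J x z)
  have a1 := riem_antisymm u z v (J x u)
  have a2 := riem_antisymm u (J x z) (J x v) (J x u)
  have s1 := riem_swap (J x u) u v z
  have s2 := riem_swap (J x u) u (J x v) (J x z)
  have p5 := riem_pair u (J x z) u v
  have p6 := riem_pair u z u (J x v)
  linarith

/-- If `⟨(∇_X J) Y, (∇_X J) J Z⟩ = 0`, the `(3,0)`-part of `∇²J` vanishes on `(X; X, Y, Z)`. -/
lemma secondForm_eq_zero (hJ : IsNearlyKahler J) (hX : SmoothAt I X x) (hY : SmoothAt I Y x)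
    (hZ : SmoothAt I Z x)
    (h : (inner ℝ (covDerivEnd J x (X x) (Y x)) (covDerivEnd J x (X x) (J x (Z x))) : ℝ) = 0) :
    secondForm J x (X x) X Y Z = 0 ∧ secondForm J x (J x (X x)) X Y (appJ J Z) = 0 := by
  have jX := hJ.smooth_appJ hX
  obtain ⟨h1, h2⟩ := hJ.secondForm_appJ_five hX hY hZ h
  have h' : (inner ℝ (covDerivEnd J x (appJ J X x) (Y x))
      (covDerivEnd J x (appJ J X x) (J x (Z x))) : ℝ) = 0 := by
    simp only [appJ, hJ.covDerivEnd_J_left, inner_neg_left, inner_neg_right, hJ.inner_map_map, h,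
      neg_zero]
  -- The same relation with `JX` in place of `X`. By `e1`, `e2` and `h2` it reads `σ = -5ρ`, where
  -- `σ` and `ρ` are the values at `(X; X, Y, Z)` and `(JX; X, Y, JZ)`. With `ρ = -5σ` this gives `σ
  -- = 25σ`, so both vanish.
  obtain ⟨h3, -⟩ := hJ.secondForm_appJ_five jX hY hZ h'
  have e1 : secondForm J x (J x (appJ J X x)) (appJ J X) Y (appJ J Z)
      = -secondForm J x (X x) (appJ J X) Y (appJ J Z) := by
    simp only [secondForm, appJ, hJ.sq, secondCovJ, map_neg, inner_sub_left]
    have e : ∀ a c : TangentSpace I x, covDerivEnd J x (-a) c = -covDerivEnd J x a c := by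
      intro a c
      rw [← neg_one_smul ℝ a, IsAlmostHermitian.covDerivEnd_smul_left, neg_one_smul]
    have e' : ∀ a c : TangentSpace I x, covDerivEnd J x c (-a) = -covDerivEnd J x c a := by
      intro a c
      rw [← neg_one_smul ℝ a, hJ.covDerivEnd_smul_right, neg_one_smul]
    rw [e, e']
    simp only [inner_neg_left]
    ring
  have e2 : secondForm J x (appJ J X x) (appJ J X) Y Z
      = secondForm J x (J x (X x)) X Y (appJ J Z) := by
    rw [hJ.secondForm_swap jX hY, hJ.secondForm_appJ hY hX, hJ.secondForm_swap hY hX]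
    have : (inner ℝ (covDerivEnd J x (X x) (Y x)) (J x (covDerivEnd J x (X x) (Z x))) : ℝ) = 0 := by
      rwa [hJ.covDerivEnd_J, inner_neg_right, neg_eq_zero] at h
    simp only [appJ, hJ.covDerivEnd_J_left, hJ.covDerivEnd_self, map_zero, neg_zero,
      inner_zero_left, hJ.covDerivEnd_swap (Y x) (X x), inner_neg_left, inner_neg_right, this]
    ring
  rw [e1, h2, e2] at h3
  constructor <;> linarith

end IsNearlyKahler
end SecondDerivative
end
end RiemGeom

namespace RiemGeom
noncomputable section
-- Linear algebra of nearly Kähler tensors in dimension six.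
section Algebra
set_option linter.unusedSectionVars false

variable {V : Type*} [NormedAddCommGroup V] [InnerProductSpace ℝ V] [FiniteDimensional ℝ V]

/-- The algebraic properties of `B u v = (∇_u J) v` at a point of a nearly Kähler manifold. -/
structure IsNKTensor (J : V →L[ℝ] V) (B : V → V → V) : Prop where
  sq : ∀ v, J (J v) = -v
  inner_J : ∀ u v, (inner ℝ (J u) v : ℝ) = -inner ℝ u (J v)
  add_right : ∀ u v w, B u (v + w) = B u v + B u w
  smul_right : ∀ (c : ℝ) u v, B u (c • v) = c • B u v
  swap : ∀ u v, B u v = -B v u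
  skew : ∀ u v w, (inner ℝ (B u v) w : ℝ) = -inner ℝ v (B u w)
  J_right : ∀ u v, B u (J v) = -J (B u v)

/-- A unitary basis `a, b, c` for which `B` takes the standard form with factor `f`. -/
structure IsAdapted (J : V →L[ℝ] V) (B : V → V → V) (a b c : V) (f : ℝ) : Prop where
  aa : (inner ℝ a a : ℝ) = 1
  bb : (inner ℝ b b : ℝ) = 1
  cc : (inner ℝ c c : ℝ) = 1
  ab : (inner ℝ a b : ℝ) = 0
  bc : (inner ℝ b c : ℝ) = 0
  ca : (inner ℝ c a : ℝ) = 0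
  aJb : (inner ℝ a (J b) : ℝ) = 0
  bJc : (inner ℝ b (J c) : ℝ) = 0
  cJa : (inner ℝ c (J a) : ℝ) = 0
  Bab : B a b = f • c
  Bbc : B b c = f • a
  Bca : B c a = f • b

namespace IsNKTensor

variable {J : V →L[ℝ] V} {B : V → V → V} {a b c u v w : V} {f : ℝ}

lemma self (h : IsNKTensor J B) : B u u = 0 := by
  have h2 : (2 : ℝ) • B u u = 0 := by
    rw [two_smul]; nth_rewrite 2 [h.swap u u]; rw [add_neg_cancel]
  exact (smul_eq_zero.1 h2).resolve_left two_ne_zero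

lemma inner_J_self (h : IsNKTensor J B) : (inner ℝ u (J u) : ℝ) = 0 := by
  have := h.inner_J u u
  rw [real_inner_comm] at this
  linarith

lemma inner_J_J (h : IsNKTensor J B) : (inner ℝ (J u) (J v) : ℝ) = inner ℝ u v := by
  rw [h.inner_J, h.sq, inner_neg_right, neg_neg]

lemma smul_left (h : IsNKTensor J B) (r : ℝ) : B (r • u) v = r • B u v := by
  rw [h.swap, h.smul_right, h.swap u v, smul_neg]

lemma J_left (h : IsNKTensor J B) : B (J u) v = -J (B u v) := by
  rw [h.swap, h.J_right, h.swap u v, map_neg]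

lemma inner_cyc (h : IsNKTensor J B) : (inner ℝ (B u v) w : ℝ) = inner ℝ (B w u) v := by
  rw [h.skew, h.swap u w, inner_neg_right, neg_neg, real_inner_comm]

lemma inner_left_self (h : IsNKTensor J B) : (inner ℝ (B u v) u : ℝ) = 0 := by
  rw [h.skew, h.self, inner_zero_right, neg_zero]

lemma inner_right_self (h : IsNKTensor J B) : (inner ℝ (B u v) v : ℝ) = 0 := by
  have := h.skew u v v
  rw [real_inner_comm] at this
  linarith [real_inner_comm v (B u v)]

lemma inner_left_J (h : IsNKTensor J B) : (inner ℝ (B u v) (J u) : ℝ) = 0 := by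
  have : (inner ℝ (J (B u v)) u : ℝ) = 0 := by
    rw [← neg_eq_zero, ← inner_neg_left, ← h.J_right, h.inner_left_self]
  rw [h.inner_J] at this
  linarith

lemma inner_right_J (h : IsNKTensor J B) : (inner ℝ (B u v) (J v) : ℝ) = 0 := by
  rw [h.swap, inner_neg_left, h.inner_left_J, neg_zero]

lemma orthonormal (h : IsNKTensor J B) (aa : (inner ℝ a a : ℝ) = 1) (bb : (inner ℝ b b : ℝ) = 1)
    (cc : (inner ℝ c c : ℝ) = 1) (ab : (inner ℝ a b : ℝ) = 0) (bc : (inner ℝ b c : ℝ) = 0)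
    (ca : (inner ℝ c a : ℝ) = 0) (aJb : (inner ℝ a (J b) : ℝ) = 0)
    (bJc : (inner ℝ b (J c) : ℝ) = 0) (cJa : (inner ℝ c (J a) : ℝ) = 0) :
    Orthonormal ℝ ![a, b, c, J a, J b, J c] := by
  have ba : (inner ℝ b a : ℝ) = 0 := by rw [real_inner_comm, ab]
  have cb : (inner ℝ c b : ℝ) = 0 := by rw [real_inner_comm, bc]
  have ac : (inner ℝ a c : ℝ) = 0 := by rw [real_inner_comm, ca]
  have bJa : (inner ℝ b (J a) : ℝ) = 0 := by
    rw [real_inner_comm, h.inner_J, aJb, neg_zero]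
  have cJb : (inner ℝ c (J b) : ℝ) = 0 := by
    rw [real_inner_comm, h.inner_J, bJc, neg_zero]
  have aJc : (inner ℝ a (J c) : ℝ) = 0 := by
    rw [real_inner_comm, h.inner_J, cJa, neg_zero]
  have nr : ∀ z : V, (inner ℝ z z : ℝ) = 1 → ‖z‖ = 1 := fun z hz ↦ by
    rw [norm_eq_sqrt_real_inner, hz, Real.sqrt_one]
  have na := nr a aa
  have nb := nr b bb
  have nc := nr c cc
  have nJ : ∀ z : V, ‖J z‖ = ‖z‖ := fun z ↦ by
    rw [norm_eq_sqrt_real_inner, norm_eq_sqrt_real_inner, h.inner_J_J]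
  rw [orthonormal_iff_ite]
  intro i j
  fin_cases i <;> fin_cases j <;>
    simp [ab, bc, ca, ba, cb, ac, aJb, bJc, cJa, bJa, cJb, aJc, h.inner_J_J,
      h.inner_J_self, h.inner_J, na, nb, nc, nJ]

lemma expand (hV : finrank ℝ V = 6) (ho : Orthonormal ℝ ![a, b, c, J a, J b, J c]) (v : V) :
    v = (inner ℝ a v : ℝ) • a + (inner ℝ b v : ℝ) • b + (inner ℝ c v : ℝ) • c
      + (inner ℝ (J a) v : ℝ) • J a + (inner ℝ (J b) v : ℝ) • J b
      + (inner ℝ (J c) v : ℝ) • J c := by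
  have := orthonormal_sum_inner_smul ho (by simp [hV]) v
  rw [Fin.sum_univ_six] at this
  exact this.symm

lemma ext_of_inner (hV : finrank ℝ V = 6) (ho : Orthonormal ℝ ![a, b, c, J a, J b, J c])
    (h1 : (inner ℝ v a : ℝ) = inner ℝ w a) (h2 : (inner ℝ v b : ℝ) = inner ℝ w b)
    (h3 : (inner ℝ v c : ℝ) = inner ℝ w c) (h4 : (inner ℝ v (J a) : ℝ) = inner ℝ w (J a))
    (h5 : (inner ℝ v (J b) : ℝ) = inner ℝ w (J b))
    (h6 : (inner ℝ v (J c) : ℝ) = inner ℝ w (J c)) : v = w := by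
  simp only [real_inner_comm _ v, real_inner_comm _ w] at *
  rw [expand hV ho v, expand hV ho w, h1, h2, h3, h4, h5, h6]

/-- A unitary pair `a, b` with `B a b ≠ 0` extends to an adapted basis. -/
lemma isAdapted (h : IsNKTensor J B) (hV : finrank ℝ V = 6) (aa : (inner ℝ a a : ℝ) = 1)
    (bb : (inner ℝ b b : ℝ) = 1) (ab : (inner ℝ a b : ℝ) = 0) (aJb : (inner ℝ a (J b) : ℝ) = 0)
    (hB : B a b ≠ 0) : IsAdapted J B a b (‖B a b‖⁻¹ • B a b) ‖B a b‖ := by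
  have hf : ‖B a b‖ ≠ 0 := norm_ne_zero_iff.2 hB
  set c := ‖B a b‖⁻¹ • B a b with hc
  have hBc : B a b = ‖B a b‖ • c := by rw [hc, smul_inv_smul₀ hf]
  have cc : (inner ℝ c c : ℝ) = 1 := by
    rw [hc, real_inner_smul_left, real_inner_smul_right, real_inner_self_eq_norm_sq]
    field_simp
  have ca : (inner ℝ c a : ℝ) = 0 := by rw [hc, real_inner_smul_left, h.inner_left_self, mul_zero]
  have cb : (inner ℝ c b : ℝ) = 0 := by rw [hc, real_inner_smul_left, h.inner_right_self, mul_zero]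
  have cJa : (inner ℝ c (J a) : ℝ) = 0 := by rw [hc, real_inner_smul_left, h.inner_left_J, mul_zero]
  have cJb : (inner ℝ c (J b) : ℝ) = 0 := by
    rw [hc, real_inner_smul_left, h.inner_right_J, mul_zero]
  have bJc : (inner ℝ b (J c) : ℝ) = 0 := by
    rw [real_inner_comm, h.inner_J, cJb, neg_zero]
  have bc : (inner ℝ b c : ℝ) = 0 := by rw [real_inner_comm, cb]
  have bJa : (inner ℝ b (J a) : ℝ) = 0 := by
    rw [real_inner_comm, h.inner_J, aJb, neg_zero]
  have aJc : (inner ℝ a (J c) : ℝ) = 0 := by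
    rw [real_inner_comm, h.inner_J, cJa, neg_zero]
  have ho := h.orthonormal aa bb cc ab bc ca aJb bJc cJa
  have cJc := h.inner_J_self (u := c)
  refine ⟨aa, bb, cc, ab, bc, ca, aJb, bJc, cJa, hBc, ?_, ?_⟩
  -- The value is tested on the six basis vectors. Total skewness rotates each nontrivial component
  -- into a component of `B a b = ‖B a b‖ c`; the others vanish because `B u v` is orthogonal to `u,
  -- v, Ju, Jv`.
  · refine ext_of_inner hV ho ?_ ?_ ?_ ?_ ?_ ?_
    · rw [h.inner_cyc]; conv_lhs => rw [hBc]
      simp only [real_inner_smul_left, aa, cc]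
    · rw [h.inner_left_self, real_inner_smul_left, ab, mul_zero]
    · rw [h.inner_right_self, real_inner_smul_left, real_inner_comm, ca, mul_zero]
    · rw [h.inner_cyc, h.J_left, hBc, map_smul, inner_neg_left, real_inner_smul_left,
        real_inner_smul_left, h.inner_J_self, h.inner_J, cJc]
      simp
    · rw [h.inner_left_J, real_inner_smul_left, aJb, mul_zero]
    · rw [h.inner_right_J, real_inner_smul_left, aJc, mul_zero]
  · refine ext_of_inner hV ho ?_ ?_ ?_ ?_ ?_ ?_
    · rw [h.inner_right_self, real_inner_smul_left, real_inner_comm, ab, mul_zero]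
    · rw [← h.inner_cyc]; conv_lhs => rw [hBc]
      simp only [real_inner_smul_left, bb, cc]
    · rw [h.inner_left_self, real_inner_smul_left, bc, mul_zero]
    · rw [h.inner_right_J, real_inner_smul_left, bJa, mul_zero]
    · rw [← h.inner_cyc, h.J_right, hBc, map_smul, inner_neg_left, real_inner_smul_left,
        real_inner_smul_left, h.inner_J_self, h.inner_J, cJc]
      simp
    · rw [h.inner_left_J, real_inner_smul_left, bJc, mul_zero]

/-- Adapted bases exist wherever `B u ≠ 0`. -/
lemma isAdapted_of_ne_zero (h : IsNKTensor J B) (hV : finrank ℝ V = 6) (huw : B u w ≠ 0)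
    (ha : a = ‖u‖⁻¹ • u) (hv : v = w - (inner ℝ a w : ℝ) • a - (inner ℝ (J a) w : ℝ) • J a)
    (hb : b = ‖v‖⁻¹ • v) :
    u ≠ 0 ∧ v ≠ 0 ∧ B a b ≠ 0 ∧ IsAdapted J B a b (‖B a b‖⁻¹ • B a b) ‖B a b‖ := by
  have hu : u ≠ 0 := by
    rintro rfl
    refine huw ?_
    simpa using h.smul_left (u := 0) (v := w) (0 : ℝ)
  have hu' : ‖u‖ ≠ 0 := norm_ne_zero_iff.2 hu
  -- Removing the `a` and `Ja` components of `w` does not affect `B a w`, since `B a a = 0` and `B a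
  -- (Ja) = -J(B a a) = 0`.
  have hBv : B a v = ‖u‖⁻¹ • B u w := by
    rw [hv, sub_eq_add_neg, sub_eq_add_neg, ← neg_smul, ← neg_smul, h.add_right, h.add_right,
      h.smul_right, h.smul_right, h.J_right, h.self, ha, h.smul_left]
    simp
  have hv0 : v ≠ 0 := by
    intro h0
    refine smul_ne_zero (inv_ne_zero hu') huw ?_
    rw [← hBv, h0]
    simpa using h.smul_right 0 a 0
  have hv' : ‖v‖ ≠ 0 := norm_ne_zero_iff.2 hv0
  have hBb : B a b ≠ 0 := by
    rw [hb, h.smul_right, hBv]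
    exact smul_ne_zero (inv_ne_zero hv') (smul_ne_zero (inv_ne_zero hu') huw)
  have aa : (inner ℝ a a : ℝ) = 1 := by
    rw [ha, real_inner_smul_left, real_inner_smul_right, real_inner_self_eq_norm_sq]
    field_simp
  have bb : (inner ℝ b b : ℝ) = 1 := by
    rw [hb, real_inner_smul_left, real_inner_smul_right, real_inner_self_eq_norm_sq]
    field_simp
  have av : (inner ℝ a v : ℝ) = 0 := by
    rw [hv, inner_sub_right, inner_sub_right, real_inner_smul_right, real_inner_smul_right, aa,
      h.inner_J_self]
    ring
  have aJv : (inner ℝ a (J v) : ℝ) = 0 := by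
    rw [← neg_eq_zero, ← h.inner_J, hv, inner_sub_right, inner_sub_right, real_inner_smul_right,
      real_inner_smul_right, h.inner_J_J, aa, h.inner_J a a, h.inner_J_self]
    ring
  refine ⟨hu, hv0, hBb, h.isAdapted hV aa bb ?_ ?_ hBb⟩
  · rw [hb, real_inner_smul_right, av, mul_zero]
  · rw [hb, map_smul, real_inner_smul_right, aJv, mul_zero]

end IsNKTensor

namespace IsAdapted

variable {J : V →L[ℝ] V} {B : V → V → V} {a b c u v w : V} {f : ℝ}

lemma cyc (h : IsAdapted J B a b c f) : IsAdapted J B b c a f :=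
  ⟨h.bb, h.cc, h.aa, h.bc, h.ca, h.ab, h.bJc, h.cJa, h.aJb, h.Bbc, h.Bca, h.Bab⟩

lemma orthonormal (h : IsAdapted J B a b c f) (hB : IsNKTensor J B) :
    Orthonormal ℝ ![a, b, c, J a, J b, J c] :=
  hB.orthonormal h.aa h.bb h.cc h.ab h.bc h.ca h.aJb h.bJc h.cJa

/-- `B` is conjugate-linear in each argument, so its three values on the unitary basis determine it:
it is `f` times a conjugate of the complex cross product. This gives `norm_sq_B` by coordinates. -/
lemma B_apply (h : IsAdapted J B a b c f) (hB : IsNKTensor J B) (hV : finrank ℝ V = 6) (u : V) :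
    B a u = f • ((inner ℝ b u : ℝ) • c - (inner ℝ c u : ℝ) • b
      - (inner ℝ (J b) u : ℝ) • J c + (inner ℝ (J c) u : ℝ) • J b) := by
  have e1 : B a c = -(f • b) := by rw [hB.swap, h.Bca]
  conv_lhs => rw [IsNKTensor.expand hV (h.orthonormal hB) u]
  simp only [hB.add_right, hB.smul_right, hB.J_right, hB.self, h.Bab, e1, map_smul, map_neg,
    map_zero]
  module

lemma inner_B (h : IsAdapted J B a b c f) (hB : IsNKTensor J B) (hV : finrank ℝ V = 6) (u v : V) :
    (inner ℝ a (B u v) : ℝ) = f * (inner ℝ b u * inner ℝ c v - inner ℝ c u * inner ℝ b v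
      - inner ℝ (J b) u * inner ℝ (J c) v + inner ℝ (J c) u * inner ℝ (J b) v) := by
  rw [real_inner_comm, hB.inner_cyc, h.B_apply hB hV]
  simp only [inner_add_left, inner_sub_left, real_inner_smul_left]

lemma inner_J_B (h : IsAdapted J B a b c f) (hB : IsNKTensor J B) (hV : finrank ℝ V = 6) (u v : V) :
    (inner ℝ (J a) (B u v) : ℝ) = -f * (inner ℝ b u * inner ℝ (J c) v - inner ℝ c u * inner ℝ (J b) v
      + inner ℝ (J b) u * inner ℝ c v - inner ℝ (J c) u * inner ℝ b v) := by
  rw [hB.inner_J, ← inner_neg_right, ← hB.J_right, h.inner_B hB hV, hB.inner_J_J, hB.inner_J_J]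
  rw [hB.inner_J b v, hB.inner_J c v]
  ring

lemma inner_eq (h : IsAdapted J B a b c f) (hB : IsNKTensor J B) (hV : finrank ℝ V = 6) (u v : V) :
    (inner ℝ u v : ℝ) = inner ℝ a u * inner ℝ a v + inner ℝ b u * inner ℝ b v
      + inner ℝ c u * inner ℝ c v + inner ℝ (J a) u * inner ℝ (J a) v
      + inner ℝ (J b) u * inner ℝ (J b) v + inner ℝ (J c) u * inner ℝ (J c) v := by
  conv_lhs => rw [IsNKTensor.expand hV (h.orthonormal hB) u]
  simp only [inner_add_left, real_inner_smul_left]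

/-- The type constant of an adapted basis. -/
lemma norm_sq_B (h : IsAdapted J B a b c f) (hB : IsNKTensor J B) (hV : finrank ℝ V = 6) (u v : V) :
    ‖B u v‖ ^ 2 = f ^ 2 * (‖u‖ ^ 2 * ‖v‖ ^ 2 - (inner ℝ u v : ℝ) ^ 2
      - (inner ℝ u (J v) : ℝ) ^ 2) := by
  simp only [← real_inner_self_eq_norm_sq]
  rw [h.inner_eq hB hV (B u v), h.inner_eq hB hV u, h.inner_eq hB hV v, h.inner_eq hB hV u v,
    h.inner_eq hB hV u (J v)]
  rw [h.inner_B hB hV, h.cyc.inner_B hB hV, h.cyc.cyc.inner_B hB hV, h.inner_J_B hB hV,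
    h.cyc.inner_J_B hB hV, h.cyc.cyc.inner_J_B hB hV]
  simp only [hB.inner_J_J]
  have e : ∀ z, (inner ℝ z (J v) : ℝ) = -inner ℝ (J z) v := fun z ↦ by rw [hB.inner_J, neg_neg]
  rw [e a, e b, e c]
  ring

end IsAdapted
end Algebra
end
end RiemGeom

namespace RiemGeom
noncomputable section
-- Adapted frames; existence and constancy of the type constant.
section AdaptedFrame
open Filter Topology
set_option linter.unusedSectionVars false

variable {E : Type*} [NormedAddCommGroup E] [NormedSpace ℝ E] [FiniteDimensional ℝ E]
  {H : Type*} [TopologicalSpace H] {I : ModelWithCorners ℝ E H}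
  {M : Type*} [TopologicalSpace M] [ChartedSpace H M] [IsManifold I ∞ M]

/-- In the chart the derivative vanishes on a ball around the image of `x`, which is connected. -/
lemma eventually_eq_of_mvfderiv_eq_zero [I.Boundaryless] {f : M → ℝ} {x : M}
    (h : ∀ᶠ y in 𝓝 x, MDiffAt f y ∧ mvfderiv I f y = 0) : ∀ᶠ y in 𝓝 x, f y = f x := by
  set φ := extChartAt I x with hφ
  have hc : ContinuousAt φ.symm (φ x) := continuousAt_extChartAt_symm x
  have hφx : φ.symm (φ x) = x := extChartAt_to_inv x
  have h1 : ∀ᶠ z in 𝓝 (φ x), MDiffAt f (φ.symm z) ∧ mvfderiv I f (φ.symm z) = 0 := by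
    rw [← hφx] at h
    exact hc.eventually h
  obtain ⟨r, hr, hball⟩ := Metric.eventually_nhds_iff_ball.1
    (h1.and (extChartAt_target_mem_nhds (I := I) x))
  have hd : ∀ z ∈ Metric.ball (φ x) r, HasFDerivAt (f ∘ φ.symm) (0 : E →L[ℝ] ℝ) z := by
    intro z hz
    obtain ⟨⟨h2, h3⟩, h4⟩ := hball z hz
    have h5 : MDifferentiableAt 𝓘(ℝ, E) I φ.symm z :=
      ((contMDiffOn_extChartAt_symm (n := ∞) x).contMDiffAt
        ((isOpen_extChartAt_target x).mem_nhds h4)).mdifferentiableAt (by simp)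
    have h6 := (h2.comp z h5).hasMFDerivAt.hasFDerivAt
    have h7 : mfderiv 𝓘(ℝ, E) 𝓘(ℝ, ℝ) (f ∘ φ.symm) z = 0 := by
      ext v
      rw [mfderiv_comp z h2 h5]
      have := congrArg (fun T ↦ T (mfderiv 𝓘(ℝ, E) I φ.symm z v)) h3
      exact this
    rwa [h7] at h6
  have hconst : ∀ z ∈ Metric.ball (φ x) r, f (φ.symm z) = f x := by
    intro z hz
    have := Metric.isOpen_ball.is_const_of_fderiv_eq_zero (f := f ∘ φ.symm)
      (convex_ball (φ x) r).isPreconnected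
      (fun z hz ↦ (hd z hz).differentiableAt.differentiableWithinAt)
      (fun z hz ↦ (hd z hz).fderiv) hz (Metric.mem_ball_self hr)
    simpa [hφx] using this
  have h8 : ∀ᶠ y in 𝓝 x, φ y ∈ Metric.ball (φ x) r :=
    (continuousAt_extChartAt x).eventually (Metric.ball_mem_nhds _ hr)
  filter_upwards [h8, extChartAt_source_mem_nhds (I := I) x] with y hy hy'
  rw [← hconst _ hy, φ.left_inv hy']

variable [RiemannianBundle (fun x : M ↦ TangentSpace I x)]
  [IsContMDiffRiemannianBundle I ∞ E (fun x : M ↦ TangentSpace I x)]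
  {J : Π x : M, TangentSpace I x →L[ℝ] TangentSpace I x}
  {X Y Z W a b c : Π x : M, TangentSpace I x} {f : M → ℝ} {x : M}

lemma SmoothAt.norm (hX : SmoothAt I X x) (h : X x ≠ 0) :
    ContMDiffAt I 𝓘(ℝ, ℝ) ∞ (fun y ↦ ‖X y‖) x := by
  have e : (fun y ↦ ‖X y‖) = fun y ↦ √(Inner.inner ℝ (X y) (X y) : ℝ) := by
    funext y; exact norm_eq_sqrt_real_inner _
  rw [e]
  exact ContMDiffAt.comp x (Real.contDiffAt_sqrt (by simpa using h)).contMDiffAt (hX.inner hX)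

lemma SmoothAt.normalize (hX : SmoothAt I X x) (h : X x ≠ 0) :
    SmoothAt I ((fun y ↦ ‖X y‖⁻¹) • X) x :=
  SmoothAt.smul ((hX.norm h).inv₀ (by simpa using h)) hX

lemma eventually_smoothAt_extend (v : TangentSpace I x) :
    ∀ᶠ y in 𝓝 x, SmoothAt I (FiberBundle.extend E v : Π y : M, TangentSpace I y) y := by
  obtain ⟨s, hs, h⟩ := FiberBundle.exists_contMDiffOn_extend (k := ∞) I E
    (V := fun x : M ↦ TangentSpace I x) v
  filter_upwards [eventually_mem_nhds_iff.2 hs] with y hy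
  exact h.contMDiffAt hy

lemma IsNearlyKahler.isNKTensor (hJ : IsNearlyKahler J) (x : M) :
    IsNKTensor (J x) (covDerivEnd J x) where
  sq := hJ.sq x
  inner_J u v := hJ.inner_J_left u v
  add_right u v w := hJ.covDerivEnd_add_right u v w
  smul_right c u v := hJ.covDerivEnd_smul_right u v c
  swap u v := hJ.covDerivEnd_swap u v
  skew u v w := hJ.inner_covDerivEnd u v w
  J_right u v := hJ.covDerivEnd_J u v

variable (J a b c f x) in
/-- `a, b, c` is a smooth unitary frame near `x` with `(∇_a J) b = f c` and cyclically. -/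
structure IsAdaptedFrameAt : Prop where
  smooth_a : SmoothAt I a x
  smooth_b : SmoothAt I b x
  smooth_c : SmoothAt I c x
  smooth_f : ContMDiffAt I 𝓘(ℝ, ℝ) ∞ f x
  adapted : ∀ᶠ y in 𝓝 x, IsAdapted (J y) (covDerivEnd J y) (a y) (b y) (c y) (f y)
  ne_zero : f x ≠ 0

lemma IsAdaptedFrameAt.cyc (h : IsAdaptedFrameAt J a b c f x) : IsAdaptedFrameAt J b c a f x :=
  ⟨h.smooth_b, h.smooth_c, h.smooth_a, h.smooth_f, h.adapted.mono fun _ h ↦ h.cyc, h.ne_zero⟩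

/-- Strictness gives `u, w` with `(∇_u J)w ≠ 0`, and this persists for their extensions near `x`.
Hermitian Gram-Schmidt yields `a, b`, and `c` is the normalised `(∇_a J)b`; all norms divided by are
nonzero, so the frame is smooth. It is adapted at every nearby point because its defining relations
get differentiated. -/
lemma IsStrictNearlyKahler.exists_isAdaptedFrameAt (hJ : IsStrictNearlyKahler J)
    (hE : finrank ℝ E = 6) (x : M) : ∃ (a b c : Π x : M, TangentSpace I x) (f : M → ℝ),
      ∀ᶠ y in 𝓝 x, IsAdaptedFrameAt J a b c f y := by
  have : Nontrivial (TangentSpace I x) := nontrivial_of_finrank_pos (R := ℝ) (by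
    rw [finrank_tangentSpace, hE]; norm_num)
  obtain ⟨u, hu⟩ := exists_ne (0 : TangentSpace I x)
  obtain ⟨w, hw⟩ := hJ.strict x u hu
  set U : Π y : M, TangentSpace I y := FiberBundle.extend E u with hU
  set W : Π y : M, TangentSpace I y := FiberBundle.extend E w with hW
  have sU := eventually_smoothAt_extend u
  have sW := eventually_smoothAt_extend w
  have key : ∀ᶠ y in 𝓝 x, covDerivEnd J y (U y) (W y) ≠ 0 := by
    have h1 : ContMDiffAt I 𝓘(ℝ, ℝ) ∞ (fun y ↦ (inner ℝ (covJ J U W y) (covJ J U W y) : ℝ)) x :=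
      (hJ.smooth_covJ (smoothAt_extend u) (smoothAt_extend w)).inner
        (hJ.smooth_covJ (smoothAt_extend u) (smoothAt_extend w))
    have h2 : (inner ℝ (covJ J U W x) (covJ J U W x) : ℝ) ≠ 0 := by
      simp only [covJ, hU, hW, extend_self]
      simpa using hw
    filter_upwards [h1.continuousAt.eventually_ne h2] with y hy h
    exact hy (by simp [covJ, h])
  set a : Π y : M, TangentSpace I y := (fun y ↦ ‖U y‖⁻¹) • U with ha
  set v : Π y : M, TangentSpace I y := W - (fun y ↦ (inner ℝ (a y) (W y) : ℝ)) • a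
    - (fun y ↦ (inner ℝ (appJ J a y) (W y) : ℝ)) • appJ J a with hv
  set b : Π y : M, TangentSpace I y := (fun y ↦ ‖v y‖⁻¹) • v with hb
  set f : M → ℝ := fun y ↦ ‖covJ J a b y‖ with hf
  set c : Π y : M, TangentSpace I y := (fun y ↦ ‖covJ J a b y‖⁻¹) • covJ J a b with hc
  have A : ∀ {y : M}, covDerivEnd J y (U y) (W y) ≠ 0 → _ := fun {y} hy ↦
    (hJ.isNKTensor y).isAdapted_of_ne_zero (by rw [finrank_tangentSpace, hE]) hy
      (a := a y) (v := v y) (b := b y) rfl rfl rfl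
  refine ⟨a, b, c, f, ?_⟩
  filter_upwards [sU, sW, key, eventually_eventually_nhds.2 key] with y hUy hWy hy hy'
  obtain ⟨hu0, hv0, hB, -⟩ := A hy
  have sa : SmoothAt I a y := hUy.normalize hu0
  have sJa := hJ.smooth_appJ sa
  have sv : SmoothAt I v y :=
    (hWy.sub (SmoothAt.smul (sa.inner hWy) sa)).sub (SmoothAt.smul (sJa.inner hWy) sJa)
  have sb : SmoothAt I b y := sv.normalize hv0
  have sB := hJ.smooth_covJ sa sb
  exact ⟨sa, sb, sB.normalize hB, sB.norm hB, hy'.mono fun z hz ↦ (A hz).2.2.2,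
    norm_ne_zero_iff.2 hB⟩

/-- The trace `∑ ⟨∇_w eᵢ, J eᵢ⟩` of the connection form of the frame `a, b, c`. -/
def traceForm (J : Π x : M, TangentSpace I x →L[ℝ] TangentSpace I x)
    (a b c : Π x : M, TangentSpace I x) (x : M) (w : TangentSpace I x) : ℝ :=
  inner ℝ (leviCivita I M a x w) (J x (a x)) + inner ℝ (leviCivita I M b x w) (J x (b x))
    + inner ℝ (leviCivita I M c x w) (J x (c x))

lemma inner_leviCivita_self (hX : SmoothAt I X x) {r : ℝ}
    (h : ∀ᶠ y in 𝓝 x, (inner ℝ (X y) (X y) : ℝ) = r) (w : TangentSpace I x) :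
    (inner ℝ (leviCivita I M X x w) (X x) : ℝ) = 0 := by
  have h1 := leviCivita_metric_apply w hX.mdiff hX.mdiff
  rw [mvfderiv_congr (g := fun _ ↦ r) h, mvfderiv_const, zero_apply, real_inner_comm] at h1
  linarith [real_inner_comm (leviCivita I M X x w) (X x)]

namespace IsAdaptedFrameAt
open IsNearlyKahler

/-- Differentiate `f = ⟨(∇_a J)b, c⟩`. Differentiating a frame vector contributes multiples of `⟨∇_w
a, a⟩`, `⟨∇_w b, b⟩` or `⟨∇_w c, c⟩`, which vanish for unit fields. Only `∇²J` remains. -/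
lemma mvfderiv_eq (h : IsAdaptedFrameAt J a b c f x) (hJ : IsNearlyKahler J)
    (w : TangentSpace I x) : mvfderiv I f x w = secondForm J x w a b c := by
  have ha := h.adapted.self_of_nhds
  have hB := hJ.isNKTensor x
  have e : ∀ᶠ y in 𝓝 x, f y = inner ℝ (covJ J a b y) (c y) := by
    filter_upwards [h.adapted] with y hy
    rw [covJ, hy.Bab, real_inner_smul_left, hy.cc, mul_one]
  have za := inner_leviCivita_self h.smooth_a (h.adapted.mono fun _ h ↦ h.aa) w
  have zb := inner_leviCivita_self h.smooth_b (h.adapted.mono fun _ h ↦ h.bb) w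
  have zc := inner_leviCivita_self h.smooth_c (h.adapted.mono fun _ h ↦ h.cc) w
  have e1 : (inner ℝ (covDerivEnd J x (leviCivita I M a x w) (b x)) (c x) : ℝ) = 0 := by
    rw [hB.inner_cyc, hB.inner_cyc, ha.Bbc, real_inner_smul_left, real_inner_comm, za, mul_zero]
  have e2 : (inner ℝ (covDerivEnd J x (a x) (leviCivita I M b x w)) (c x) : ℝ) = 0 := by
    rw [hB.inner_cyc, ha.Bca, real_inner_smul_left, real_inner_comm, zb, mul_zero]
  have e3 : (inner ℝ (covDerivEnd J x (a x) (b x)) (leviCivita I M c x w) : ℝ) = 0 := by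
    rw [ha.Bab, real_inner_smul_left, real_inner_comm, zc, mul_zero]
  rw [mvfderiv_congr e,
    leviCivita_metric_apply w (hJ.smooth_covJ h.smooth_a h.smooth_b).mdiff h.smooth_c.mdiff]
  simp only [secondForm, secondCovJ, inner_sub_left, e1, e2, sub_zero]
  rw [covJ, e3, add_zero]

/-- Differentiate `⟨(∇_a J)b, Jc⟩ = 0`. The three terms in which a frame vector is differentiated
add up to `-f` times the trace. -/
lemma smul_traceForm_eq (h : IsAdaptedFrameAt J a b c f x) (hJ : IsNearlyKahler J)
    (w : TangentSpace I x) :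
    f x * traceForm J a b c x w = secondForm J x w a b (appJ J c) := by
  have ha := h.adapted.self_of_nhds
  have hB := hJ.isNKTensor x
  have e : ∀ᶠ y in 𝓝 x, (inner ℝ (covJ J a b y) (appJ J c y) : ℝ) = 0 := by
    filter_upwards [h.adapted] with y hy
    rw [covJ, appJ, hy.Bab, real_inner_smul_left, hJ.inner_J_self, mul_zero]
  have e1 : (inner ℝ (covDerivEnd J x (leviCivita I M a x w) (b x)) (J x (c x)) : ℝ)
      = -f x * inner ℝ (leviCivita I M a x w) (J x (a x)) := by
    rw [hB.inner_cyc, hB.inner_cyc, hB.J_right, ha.Bbc, map_smul, inner_neg_left,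
      real_inner_smul_left, real_inner_comm]
    ring
  have e2 : (inner ℝ (covDerivEnd J x (a x) (leviCivita I M b x w)) (J x (c x)) : ℝ)
      = -f x * inner ℝ (leviCivita I M b x w) (J x (b x)) := by
    rw [hB.inner_cyc, hB.J_left, ha.Bca, map_smul, inner_neg_left, real_inner_smul_left,
      real_inner_comm]
    ring
  have e3 : (inner ℝ (covDerivEnd J x (a x) (b x)) (leviCivita I M (appJ J c) x w) : ℝ)
      = -f x * inner ℝ (leviCivita I M c x w) (J x (c x)) := by
    rw [ha.Bab, real_inner_smul_left, hJ.leviCivita_appJ h.smooth_c.mdiff, inner_add_right,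
      real_inner_comm, hB.inner_right_self, real_inner_comm, hB.inner_J]
    ring
  have e4 := leviCivita_metric_apply w (hJ.smooth_covJ h.smooth_a h.smooth_b).mdiff
    (hJ.smooth_appJ h.smooth_c).mdiff
  rw [mvfderiv_congr (g := fun _ ↦ (0 : ℝ)) e, mvfderiv_const, zero_apply] at e4
  simp only [covJ, appJ] at e3 e4
  simp only [secondForm, secondCovJ, inner_sub_left]
  simp only [appJ, e1, e2]
  rw [e3] at e4
  rw [traceForm]
  linear_combination e4

lemma secondForm_appJ_cyc (h : IsAdaptedFrameAt J a b c f x) (hJ : IsNearlyKahler J)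
    (w : TangentSpace I x) :
    secondForm J x w b c (appJ J a) = secondForm J x w a b (appJ J c) := by
  rw [← h.smul_traceForm_eq hJ, ← h.cyc.smul_traceForm_eq hJ, traceForm, traceForm]
  ring

/-- The orthogonality needed in `IsNearlyKahler.secondForm_eq_zero` holds for `Z = c` and for `Z =
Jc`: there `(∇_a J)JZ` is `f Jb`, respectively `f b`, while `(∇_a J)b = f c`. -/
lemma secondForm_eq_zero (h : IsAdaptedFrameAt J a b c f x) (hJ : IsNearlyKahler J) :
    (secondForm J x (a x) a b c = 0 ∧ secondForm J x (J x (a x)) a b c = 0) ∧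
    (secondForm J x (a x) a b (appJ J c) = 0 ∧
      secondForm J x (J x (a x)) a b (appJ J c) = 0) := by
  have ha := h.adapted.self_of_nhds
  have hB := hJ.isNKTensor x
  have e1 := hJ.secondForm_eq_zero h.smooth_a h.smooth_b h.smooth_c (by
    rw [hB.J_right, ha.Bab, hB.swap, ha.Bca, map_neg, map_smul, neg_neg, real_inner_smul_left,
      real_inner_smul_right, ← neg_neg (inner ℝ (c x) _ : ℝ), ← hB.inner_J, real_inner_comm,
      ha.bJc]
    ring)
  have e2 := hJ.secondForm_eq_zero h.smooth_a h.smooth_b (hJ.smooth_appJ h.smooth_c) (by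
    rw [appJ, hJ.sq, ← neg_one_smul ℝ (c x), hB.smul_right, ha.Bab, hB.swap, ha.Bca,
      real_inner_smul_left, real_inner_smul_right, inner_neg_right, real_inner_smul_right,
      real_inner_comm, ha.bc]
    ring)
  rw [hJ.secondForm_appJ_appJ, neg_eq_zero] at e2
  exact ⟨⟨e1.1, e2.2⟩, e2.1, e1.2⟩

lemma eq_zero_of_frame (h : IsAdaptedFrameAt J a b c f x) (hJ : IsNearlyKahler J)
    (hE : finrank ℝ E = 6) (T : TangentSpace I x →L[ℝ] ℝ) (h1 : T (a x) = 0) (h2 : T (b x) = 0)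
    (h3 : T (c x) = 0) (h4 : T (J x (a x)) = 0) (h5 : T (J x (b x)) = 0)
    (h6 : T (J x (c x)) = 0) : T = 0 := by
  ext v
  have ho := h.adapted.self_of_nhds.orthonormal (hJ.isNKTensor x)
  rw [IsNKTensor.expand (by rw [finrank_tangentSpace, hE]) ho v]
  simp only [map_add, map_smul, h1, h2, h3, h4, h5, h6]
  simp

/-- The previous lemma covers the directions `a` and `Ja`; the cyclic rotations of the frame cover
the other four, with the same `f`. -/
lemma mvfderiv_eq_zero (h : IsAdaptedFrameAt J a b c f x) (hJ : IsNearlyKahler J)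
    (hE : finrank ℝ E = 6) : mvfderiv I f x = 0 := by
  have z1 := (h.secondForm_eq_zero hJ).1
  have z2 := (h.cyc.secondForm_eq_zero hJ).1
  have z3 := (h.cyc.cyc.secondForm_eq_zero hJ).1
  simp only [← mvfderiv_eq h hJ, ← mvfderiv_eq h.cyc hJ, ← mvfderiv_eq h.cyc.cyc hJ] at z1 z2 z3
  exact h.eq_zero_of_frame hJ hE _ z1.1 z2.1 z3.1 z1.2 z2.2 z3.2

lemma traceForm_eq_zero (h : IsAdaptedFrameAt J a b c f x) (hJ : IsNearlyKahler J)
    (hE : finrank ℝ E = 6) (w : TangentSpace I x) : traceForm J a b c x w = 0 := by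
  have z1 := (h.secondForm_eq_zero hJ).2
  have z2 := (h.cyc.secondForm_eq_zero hJ).2
  have z3 := (h.cyc.cyc.secondForm_eq_zero hJ).2
  simp only [h.cyc.secondForm_appJ_cyc hJ] at z3
  simp only [h.secondForm_appJ_cyc hJ, ← h.smul_traceForm_eq hJ, mul_eq_zero, h.ne_zero, false_or]
    at z1 z2 z3
  let T : TangentSpace I x →L[ℝ] ℝ :=
    (innerSL ℝ (J x (a x))).comp (leviCivita I M a x)
      + (innerSL ℝ (J x (b x))).comp (leviCivita I M b x)
      + (innerSL ℝ (J x (c x))).comp (leviCivita I M c x)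
  have hT : ∀ w, T w = traceForm J a b c x w := fun w ↦ by
    rw [traceForm, ← real_inner_comm (leviCivita I M a x w), ← real_inner_comm (leviCivita I M b x w),
      ← real_inner_comm (leviCivita I M c x w)]
    rfl
  simp only [← hT] at z1 z2 z3 ⊢
  rw [h.eq_zero_of_frame hJ hE T z1.1 z2.1 z3.1 z1.2 z2.2 z3.2, zero_apply]

end IsAdaptedFrameAt

/-- The constant at a point is determined by the pair `a, b`, for which the bracket on the right is
`1`, so it does not depend on the frame. It is locally constant because `df = 0`, hence constant on
the connected `M`. The last clause identifies `f²` with it in any frame. -/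
lemma IsStrictNearlyKahler.exists_isTypeConstant [I.Boundaryless] [ConnectedSpace M]
    (hJ : IsStrictNearlyKahler J) (hE : finrank ℝ E = 6) : ∃ α : ℝ, 0 < α ∧ IsTypeConstant J α ∧
      ∀ (x : M) (a b c : Π x : M, TangentSpace I x) (f : M → ℝ),
        IsAdaptedFrameAt J a b c f x → f x ^ 2 = α := by
  let P : ℝ → M → Prop := fun r x ↦ ∀ u v : TangentSpace I x, ‖covDerivEnd J x u v‖ ^ 2
    = r * (‖u‖ ^ 2 * ‖v‖ ^ 2 - (inner ℝ u v : ℝ) ^ 2 - (inner ℝ u (J x v) : ℝ) ^ 2)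
  have hfin : ∀ x : M, finrank ℝ (TangentSpace I x) = 6 := fun x ↦ by
    rw [finrank_tangentSpace, hE]
  have hfr : ∀ (x : M) (a b c : Π x : M, TangentSpace I x) (f : M → ℝ),
      IsAdaptedFrameAt J a b c f x → P (f x ^ 2) x := fun x a b c f h ↦
    h.adapted.self_of_nhds.norm_sq_B (hJ.isNKTensor x) (hfin x)
  have huniq : ∀ (x : M) (r r' : ℝ), P r x → P r' x → r = r' := by
    intro x r r' h h'
    obtain ⟨a, b, c, f, hab⟩ := hJ.exists_isAdaptedFrameAt hE x
    have h0 := hab.self_of_nhds.adapted.self_of_nhds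
    have h1 := (h (a x) (b x)).symm.trans (h' (a x) (b x))
    rw [h0.ab, h0.aJb, ← real_inner_self_eq_norm_sq, ← real_inner_self_eq_norm_sq, h0.aa, h0.bb] at h1
    linarith
  have hex : ∀ x : M, ∃ r, ∀ᶠ y in 𝓝 x, P r y := by
    intro x
    obtain ⟨a, b, c, f, h⟩ := hJ.exists_isAdaptedFrameAt hE x
    refine ⟨f x ^ 2, ?_⟩
    have hf := eventually_eq_of_mvfderiv_eq_zero (h.mono fun y hy ↦
      ⟨hy.smooth_f.mdifferentiableAt (by simp), hy.mvfderiv_eq_zero hJ.toIsNearlyKahler hE⟩)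
    filter_upwards [h, hf] with y hy hfy
    rw [← hfy]
    exact hfr y a b c f hy
  choose r hr using hex
  have hloc : IsLocallyConstant r := by
    rw [IsLocallyConstant.iff_eventually_eq]
    intro x
    filter_upwards [hr x] with y hy
    exact huniq y _ _ (hr y).self_of_nhds hy
  obtain ⟨x0⟩ := (inferInstance : Nonempty M)
  have hconst : ∀ x, r x = r x0 := fun x ↦ hloc.apply_eq_of_preconnectedSpace x x0
  have hP : ∀ x, P (r x0) x := fun x ↦ hconst x ▸ (hr x).self_of_nhds
  have hval : ∀ (x : M) (a b c : Π x : M, TangentSpace I x) (f : M → ℝ),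
      IsAdaptedFrameAt J a b c f x → f x ^ 2 = r x0 :=
    fun x a b c f h ↦ huniq x _ _ (hfr x a b c f h) (hP x)
  refine ⟨r x0, ?_, hP, hval⟩
  obtain ⟨a, b, c, f, h⟩ := hJ.exists_isAdaptedFrameAt hE x0
  rw [← hval x0 a b c f h.self_of_nhds]
  have := h.self_of_nhds.ne_zero
  positivity

end AdaptedFrame
end
end RiemGeom

namespace RiemGeom
noncomputable section
-- Gray's identity and the scalar curvature.
section ScalarCurvature
open Filter Topology
set_option linter.unusedSectionVars false

variable {E : Type*} [NormedAddCommGroup E] [NormedSpace ℝ E] [FiniteDimensional ℝ E]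
  {H : Type*} [TopologicalSpace H] {I : ModelWithCorners ℝ E H}
  {M : Type*} [TopologicalSpace M] [ChartedSpace H M] [IsManifold I ∞ M]
  [RiemannianBundle (fun x : M ↦ TangentSpace I x)]
  [IsContMDiffRiemannianBundle I ∞ E (fun x : M ↦ TangentSpace I x)]
  {J : Π x : M, TangentSpace I x →L[ℝ] TangentSpace I x}
  {X Y Z W a b c : Π x : M, TangentSpace I x} {f : M → ℝ} {x : M}

namespace IsNearlyKahler

variable (u v : TangentSpace I x)

/-- Gray's identity. -/
lemma riem_sub_riem_J (hJ : IsNearlyKahler J) :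
    riem x u v v u - riem x u v (J x v) (J x u) = ‖covDerivEnd J x u v‖ ^ 2 := by
  have hu := smoothAt_extend (I := I) u
  have hv := smoothAt_extend (I := I) v
  have e1 := hJ.riem_appJ hu hv hu (hJ.smooth_appJ hv)
  -- Moving `J` from one copy of `v` to the other and using skewness gives `Ψ(u;u,v,Jv) = -|(∇_u
  -- J)v|²` for `Ψ` = `secondForm`. By `e1` the difference of curvatures is the negative of this
  -- component.
  have e2 := hJ.secondForm_appJ hu hv (w := u) (Z := FiberBundle.extend E v)
  rw [hJ.secondForm_self hu] at e1
  rw [hJ.secondForm_swap_right hu (hJ.smooth_appJ hv) hv] at e2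
  have e3 : secondForm J x u (FiberBundle.extend E v) (FiberBundle.extend E u)
      (appJ J (FiberBundle.extend E v)) = - secondForm J x u (FiberBundle.extend E u)
        (FiberBundle.extend E v) (appJ J (FiberBundle.extend E v)) := hJ.secondForm_swap hv hu
  simp only [extend_self, appJ, hJ.sq] at e1 e2 e3
  rw [e3] at e1
  rw [← neg_one_smul ℝ v, riem_smul_four, riem_antisymm, riem_antisymm u v u v] at e1
  rw [real_inner_self_eq_norm_sq] at e2
  linarith

/-- The four sectional curvatures of a pair of complex lines. -/
lemma sum_riem (hJ : IsNearlyKahler J) :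
    riem x u v v u + riem x u (J x v) (J x v) u + riem x (J x u) v v (J x u)
      + riem x (J x u) (J x v) (J x v) (J x u)
      = 4 * ‖covDerivEnd J x u v‖ ^ 2 - 2 * riem x v (J x v) u (J x u) := by
  have h1 := hJ.riem_sub_riem_J u v
  have h2 := hJ.riem_sub_riem_J u (J x v)
  have h3 := hJ.riem_sub_riem_J (J x u) v
  have h4 := hJ.riem_sub_riem_J (J x u) (J x v)
  have n2 : ‖covDerivEnd J x u (J x v)‖ = ‖covDerivEnd J x u v‖ := by
    rw [hJ.covDerivEnd_J, norm_neg, hJ.norm_J]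
  have n3 : ‖covDerivEnd J x (J x u) v‖ = ‖covDerivEnd J x u v‖ := by
    rw [hJ.covDerivEnd_J_left, norm_neg, hJ.norm_J]
  have n4 : ‖covDerivEnd J x (J x u) (J x v)‖ = ‖covDerivEnd J x u v‖ := by
    rw [hJ.covDerivEnd_J, norm_neg, hJ.norm_J, n3]
  have nJ : ∀ a : TangentSpace I x, J x (J x a) = (-1 : ℝ) • a := fun a ↦ by
    rw [hJ.sq, neg_one_smul]
  rw [n2] at h2
  rw [n3] at h3
  rw [n4] at h4
  simp only [nJ, riem_smul_three, riem_smul_four] at h2 h3 h4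
  -- Gray's identity for the four pairs leaves curvatures in which `u, v, Ju, Jv` each occur once;
  -- the Bianchi identity merges them into `R(v,Jv,u,Ju)`.
  have b1 := riem_bianchi u v (J x v) (J x u)
  have b2 := riem_bianchi (J x u) v (J x v) u
  have s1 := riem_swap (J x v) u v (J x u)
  have s2 := riem_swap (J x v) (J x u) v u
  have s3 := riem_antisymm v (J x v) (J x u) u
  linarith

end IsNearlyKahler

namespace IsAdaptedFrameAt

lemma mvfderiv_inner_leviCivita (hJ : IsNearlyKahler J) (hX : SmoothAt I X x)
    (hY : SmoothAt I Y x) (w : TangentSpace I x) :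
    mvfderiv I (fun y ↦ (inner ℝ (leviCivita I M Y y (X y)) (J y (Y y)) : ℝ)) x w
      = inner ℝ (leviCivita I M (nabla X Y) x w) (J x (Y x))
        + inner ℝ (leviCivita I M Y x (X x)) (covDerivEnd J x w (Y x))
        + inner ℝ (leviCivita I M Y x (X x)) (J x (leviCivita I M Y x w)) := by
  have := leviCivita_metric_apply w (hX.nabla hY).mdiff (hJ.smooth_appJ hY).mdiff
  rw [hJ.leviCivita_appJ hY.mdiff, inner_add_right, ← add_assoc] at this
  exact this

/-- The curvature of the canonical bundle in terms of the connection form of a frame. -/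
lemma sum_riem_frame (h : IsAdaptedFrameAt J a b c f x)
    (ht : ∀ᶠ y in 𝓝 x, ∀ w, traceForm J a b c y w = 0) (hJ : IsNearlyKahler J)
    (u v : TangentSpace I x) :
    ((riem x u v (a x) (J x (a x)) + riem x u v (b x) (J x (b x)) + riem x u v (c x) (J x (c x)))
      + (inner ℝ (leviCivita I M a x v) (covDerivEnd J x u (a x))
        - inner ℝ (leviCivita I M a x u) (covDerivEnd J x v (a x))
        + 2 * inner ℝ (leviCivita I M a x v) (J x (leviCivita I M a x u)))
      + (inner ℝ (leviCivita I M b x v) (covDerivEnd J x u (b x))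
        - inner ℝ (leviCivita I M b x u) (covDerivEnd J x v (b x))
        + 2 * inner ℝ (leviCivita I M b x v) (J x (leviCivita I M b x u)))
      + (inner ℝ (leviCivita I M c x v) (covDerivEnd J x u (c x))
        - inner ℝ (leviCivita I M c x u) (covDerivEnd J x v (c x))
        + 2 * inner ℝ (leviCivita I M c x v) (J x (leviCivita I M c x u))) : ℝ) = 0 := by
  -- For the trace `τ`, this is the expansion of `U(τ(V)) = 0`. The lemma is then `Uτ(V) - Vτ(U) -
  -- τ([U,V]) = 0`, where second derivatives combine into curvature.
  have key : ∀ (U V : Π y : M, TangentSpace I y), SmoothAt I U x → SmoothAt I V x →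
      (inner ℝ (leviCivita I M (nabla V a) x (U x)) (J x (a x))
        + inner ℝ (leviCivita I M a x (V x)) (covDerivEnd J x (U x) (a x))
        + inner ℝ (leviCivita I M a x (V x)) (J x (leviCivita I M a x (U x))) : ℝ)
      + (inner ℝ (leviCivita I M (nabla V b) x (U x)) (J x (b x))
        + inner ℝ (leviCivita I M b x (V x)) (covDerivEnd J x (U x) (b x))
        + inner ℝ (leviCivita I M b x (V x)) (J x (leviCivita I M b x (U x))))
      + (inner ℝ (leviCivita I M (nabla V c) x (U x)) (J x (c x))
        + inner ℝ (leviCivita I M c x (V x)) (covDerivEnd J x (U x) (c x))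
        + inner ℝ (leviCivita I M c x (V x)) (J x (leviCivita I M c x (U x)))) = 0 := by
    intro U V hU hV
    have hd : ∀ {Y : Π y : M, TangentSpace I y}, SmoothAt I Y x →
        MDiffAt (fun y ↦ (inner ℝ (leviCivita I M Y y (V y)) (J y (Y y)) : ℝ)) x := fun hY ↦
      ((hV.nabla hY).inner (hJ.smooth_appJ hY)).mdifferentiableAt (by simp)
    rw [← mvfderiv_inner_leviCivita hJ hV h.smooth_a, ← mvfderiv_inner_leviCivita hJ hV h.smooth_b,
      ← mvfderiv_inner_leviCivita hJ hV h.smooth_c, ← add_apply, ← add_apply,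
      ← mvfderiv_add (hd h.smooth_a) (hd h.smooth_b),
      ← mvfderiv_add ((hd h.smooth_a).add (hd h.smooth_b)) (hd h.smooth_c)]
    have e := mvfderiv_congr (I := I) (g := fun _ ↦ (0 : ℝ)) (ht.mono fun y hy ↦ hy (V y))
    rw [mvfderiv_const] at e
    exact congrArg (fun T ↦ T (U x)) e
  have hu := smoothAt_extend (I := I) u
  have hv := smoothAt_extend (I := I) v
  have k1 := key _ _ hu hv
  have k2 := key _ _ hv hu
  have k3 := ht.self_of_nhds (mlieBracket I (FiberBundle.extend E u) (FiberBundle.extend E v) x)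
  have hr : ∀ {Y : Π y : M, TangentSpace I y}, SmoothAt I Y x → riem x u v (Y x) (J x (Y x))
      = inner ℝ (leviCivita I M (nabla (FiberBundle.extend E v) Y) x u) (J x (Y x))
        - inner ℝ (leviCivita I M (nabla (FiberBundle.extend E u) Y) x v) (J x (Y x))
        - inner ℝ (leviCivita I M Y x
          (mlieBracket I (FiberBundle.extend E u) (FiberBundle.extend E v) x)) (J x (Y x)) := by
    intro Y hY
    have := inner_curv_eq_riem hu hv hY (hJ.smooth_appJ hY)
    simp only [extend_self, appJ] at this
    rw [← this, curv, inner_sub_left, inner_sub_left, extend_self, extend_self]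
  rw [hr h.smooth_a, hr h.smooth_b, hr h.smooth_c]
  rw [traceForm] at k3
  have hs : ∀ p q : TangentSpace I x, (inner ℝ p (J x q) : ℝ) = -inner ℝ q (J x p) := fun p q ↦ by
    rw [real_inner_comm, hJ.inner_J_left]
  simp only [extend_self] at k1 k2
  rw [hs (leviCivita I M a x u), hs (leviCivita I M b x u), hs (leviCivita I M c x u)] at k2
  linarith

/-- Evaluation of `sum_riem_frame` at `(a, Ja)`. The coefficients `⟨∇_w eᵢ, eⱼ⟩` are skew, and `⟨∇_w
eᵢ, Jeⱼ⟩` is symmetric up to `⟨(∇_w J)eᵢ, eⱼ⟩`. Without that correction the quadratic terms would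
vanish, the trace of a product of two skew-Hermitian matrices being real. With it, all connection
coefficients still cancel and only `f²` survives. -/
lemma sum_riem_apply (h : IsAdaptedFrameAt J a b c f x)
    (ht : ∀ᶠ y in 𝓝 x, ∀ w, traceForm J a b c y w = 0) (hJ : IsNearlyKahler J)
    (hE : finrank ℝ E = 6) :
    riem x (a x) (J x (a x)) (a x) (J x (a x)) + riem x (a x) (J x (a x)) (b x) (J x (b x))
      + riem x (a x) (J x (a x)) (c x) (J x (c x)) = -f x ^ 2 := by
  have key := h.sum_riem_frame ht hJ (a x) (J x (a x))
  have h0 := h.adapted.self_of_nhds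
  have hB := hJ.isNKTensor x
  have hV : finrank ℝ (TangentSpace I x) = 6 := by rw [finrank_tangentSpace, hE]
  -- skew-symmetry of the real parts
  have sk : ∀ {Y Z : Π y : M, TangentSpace I y} {r : ℝ} (w : TangentSpace I x), SmoothAt I Y x →
      SmoothAt I Z x → (∀ᶠ y in 𝓝 x, (inner ℝ (Y y) (Z y) : ℝ) = r) →
      (inner ℝ (Z x) (leviCivita I M Y x w) : ℝ) = -inner ℝ (Y x) (leviCivita I M Z x w) := by
    intro Y Z r w hY hZ hYZ
    have := leviCivita_metric_apply w hY.mdiff hZ.mdiff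
    rw [mvfderiv_congr (g := fun _ ↦ r) hYZ, mvfderiv_const, zero_apply, real_inner_comm] at this
    linarith
  have sy : ∀ {Y Z : Π y : M, TangentSpace I y} (w : TangentSpace I x), SmoothAt I Y x →
      SmoothAt I Z x → (∀ᶠ y in 𝓝 x, (inner ℝ (Y y) (appJ J Z y) : ℝ) = 0) →
      (inner ℝ (J x (Z x)) (leviCivita I M Y x w) : ℝ)
        = inner ℝ (J x (Y x)) (leviCivita I M Z x w)
          + inner ℝ (covDerivEnd J x w (Y x)) (Z x) := by
    intro Y Z w hY hZ hYZ
    have := leviCivita_metric_apply w hY.mdiff (hJ.smooth_appJ hZ).mdiff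
    rw [mvfderiv_congr (g := fun _ ↦ (0 : ℝ)) hYZ, mvfderiv_const, zero_apply,
      hJ.leviCivita_appJ hZ.mdiff, inner_add_right, real_inner_comm] at this
    rw [hJ.inner_J_left (Y x), hJ.inner_covDerivEnd]
    simp only [appJ] at this
    linarith
  have aa := fun w ↦ sk w h.smooth_a h.smooth_a (h.adapted.mono fun _ h ↦ h.aa)
  have bb := fun w ↦ sk w h.smooth_b h.smooth_b (h.adapted.mono fun _ h ↦ h.bb)
  have cc := fun w ↦ sk w h.smooth_c h.smooth_c (h.adapted.mono fun _ h ↦ h.cc)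
  have ab := fun w ↦ sk w h.smooth_a h.smooth_b (h.adapted.mono fun _ h ↦ h.ab)
  have bc := fun w ↦ sk w h.smooth_b h.smooth_c (h.adapted.mono fun _ h ↦ h.bc)
  have ca := fun w ↦ sk w h.smooth_c h.smooth_a (h.adapted.mono fun _ h ↦ h.ca)
  have ab' := fun w ↦ sy w h.smooth_a h.smooth_b (h.adapted.mono fun _ h ↦ h.aJb)
  have bc' := fun w ↦ sy w h.smooth_b h.smooth_c (h.adapted.mono fun _ h ↦ h.bJc)
  have ca' := fun w ↦ sy w h.smooth_c h.smooth_a (h.adapted.mono fun _ h ↦ h.cJa)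
  have Bac : covDerivEnd J x (a x) (c x) = -(f x • b x) := by rw [hB.swap, h0.Bca]
  have BJaa : covDerivEnd J x (J x (a x)) (a x) = 0 := by rw [hB.J_left, hB.self, map_zero, neg_zero]
  have BJab : covDerivEnd J x (J x (a x)) (b x) = -(f x • J x (c x)) := by
    rw [hB.J_left, h0.Bab, map_smul]
  have BJac : covDerivEnd J x (J x (a x)) (c x) = f x • J x (b x) := by
    rw [hB.J_left, Bac, map_neg, map_smul, neg_neg]
  have aw := fun w ↦ h0.inner_eq hB hV (leviCivita I M a x (J x (a x))) (J x w)
  have bw := fun w ↦ h0.inner_eq hB hV (leviCivita I M b x (J x (a x))) (J x w)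
  have cw := fun w ↦ h0.inner_eq hB hV (leviCivita I M c x (J x (a x))) (J x w)
  rw [aw, bw, cw, hB.self, h0.Bab, Bac, BJaa, BJab, BJac] at key
  have hs : ∀ p q : TangentSpace I x, (inner ℝ p (J x q) : ℝ) = -inner ℝ (J x p) q := fun p q ↦ by
    rw [hJ.inner_J_left, neg_neg]
  have e1 := ab' (a x)
  have e2 := bc' (a x)
  have e3 := ca' (a x)
  have e4 := ab' (J x (a x))
  have e5 := bc' (J x (a x))
  have e6 := ca' (J x (a x))
  rw [hB.self, inner_zero_left] at e1
  rw [h0.Bab, real_inner_smul_left, h0.cc] at e2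
  rw [Bac, inner_neg_left, real_inner_smul_left, real_inner_comm (a x) (b x), h0.ab] at e3
  rw [BJaa, inner_zero_left] at e4
  rw [BJab, inner_neg_left, real_inner_smul_left, hJ.inner_J_left (c x) (c x), hJ.inner_J_self] at e5
  rw [BJac, real_inner_smul_left, real_inner_comm (a x) (J x (b x)), h0.aJb] at e6
  simp only [inner_zero_left, inner_neg_left, real_inner_smul_left, hs (a x), hs (b x), hs (c x),
    hJ.inner_map_map,
    real_inner_comm _ (leviCivita I M _ x _)] at key
  have nn : ∀ r : ℝ, r = -r → r = 0 := fun r hr ↦ by linarith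
  simp only [nn _ (aa _), nn _ (bb _), nn _ (cc _), ab, bc, ca, e1, e2, e3, e4, e5, e6] at key
  linear_combination key

/-- The scalar curvature is `30 f²`. -/
lemma scalarCurvature_eq (h : ∀ᶠ y in 𝓝 x, IsAdaptedFrameAt J a b c f y) (hJ : IsNearlyKahler J)
    (hE : finrank ℝ E = 6) : scalarCurvature I x = 30 * f x ^ 2 := by
  have hx := h.self_of_nhds
  have h0 := hx.adapted.self_of_nhds
  have hB := hJ.isNKTensor x
  have hV : finrank ℝ (TangentSpace I x) = 6 := by rw [finrank_tangentSpace, hE]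
  have ht : ∀ᶠ y in 𝓝 x, ∀ w, traceForm J a b c y w = 0 :=
    h.mono fun y hy w ↦ hy.traceForm_eq_zero hJ hE w
  have ht2 : ∀ᶠ y in 𝓝 x, ∀ w, traceForm J b c a y w = 0 :=
    h.mono fun y hy w ↦ hy.cyc.traceForm_eq_zero hJ hE w
  have ht3 : ∀ᶠ y in 𝓝 x, ∀ w, traceForm J c a b y w = 0 :=
    h.mono fun y hy w ↦ hy.cyc.cyc.traceForm_eq_zero hJ hE w
  have k1 := hx.sum_riem_apply ht hJ hE
  have k2 := hx.cyc.sum_riem_apply ht2 hJ hE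
  have k3 := hx.cyc.cyc.sum_riem_apply ht3 hJ hE
  have ho := h0.orthonormal hB
  let e : OrthonormalBasis (Fin 6) ℝ (TangentSpace I x) := OrthonormalBasis.mk ho
    (ho.linearIndependent.span_eq_top_of_card_eq_finrank' (by simp [hV])).ge
  have he : ⇑e = ![a x, b x, c x, J x (a x), J x (b x), J x (c x)] := OrthonormalBasis.coe_mk ..
  rw [RiemGeom.scalarCurvature_eq e, he]
  simp only [Fin.sum_univ_six, Matrix.cons_val]
  have n0 : ∀ z, ‖covDerivEnd J x z z‖ = 0 := fun z ↦ by rw [hB.self, norm_zero]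
  have ab : ‖covDerivEnd J x (a x) (b x)‖ ^ 2 = f x ^ 2 := by
    rw [← real_inner_self_eq_norm_sq, h0.Bab, real_inner_smul_left, real_inner_smul_right, h0.cc]
    ring
  have bc : ‖covDerivEnd J x (b x) (c x)‖ ^ 2 = f x ^ 2 := by
    rw [← real_inner_self_eq_norm_sq, h0.Bbc, real_inner_smul_left, real_inner_smul_right, h0.aa]
    ring
  have ca : ‖covDerivEnd J x (c x) (a x)‖ ^ 2 = f x ^ 2 := by
    rw [← real_inner_self_eq_norm_sq, h0.Bca, real_inner_smul_left, real_inner_smul_right, h0.bb]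
    ring
  have ba := hB.swap (b x) (a x)
  have cb := hB.swap (c x) (b x)
  have ac := hB.swap (a x) (c x)
  -- The scalar curvature is a sum over nine pairs of complex lines. The six off-diagonal ones
  -- contribute `4f²` each, and the curvature terms contribute `-2` times the total `-3f²` of `k1`,
  -- `k2`, `k3`.
  have s1 := hJ.sum_riem (a x) (a x)
  have s2 := hJ.sum_riem (a x) (b x)
  have s3 := hJ.sum_riem (a x) (c x)
  have s4 := hJ.sum_riem (b x) (a x)
  have s5 := hJ.sum_riem (b x) (b x)
  have s6 := hJ.sum_riem (b x) (c x)
  have s7 := hJ.sum_riem (c x) (a x)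
  have s8 := hJ.sum_riem (c x) (b x)
  have s9 := hJ.sum_riem (c x) (c x)
  rw [n0] at s1 s5 s9
  rw [ab] at s2
  rw [ac, norm_neg, ca] at s3
  rw [ba, norm_neg, ab] at s4
  rw [bc] at s6
  rw [ca] at s7
  rw [cb, norm_neg, bc] at s8
  linarith

end IsAdaptedFrameAt

lemma IsStrictNearlyKahler.exists_typeConstant_scalarCurvature [I.Boundaryless] [ConnectedSpace M]
    (hJ : IsStrictNearlyKahler J) (hE : finrank ℝ E = 6) : ∃ α : ℝ, 0 < α ∧ IsTypeConstant J α ∧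
      ∀ x : M, 9 * α = 3 / 10 * scalarCurvature I x := by
  obtain ⟨α, h1, h2, h3⟩ := hJ.exists_isTypeConstant hE
  refine ⟨α, h1, h2, fun x ↦ ?_⟩
  obtain ⟨a, b, c, f, h⟩ := hJ.exists_isAdaptedFrameAt hE x
  rw [IsAdaptedFrameAt.scalarCurvature_eq h hJ.toIsNearlyKahler hE,
    h3 x a b c f h.self_of_nhds]
  ring

end ScalarCurvature
end
end RiemGeom

namespace RiemGeom
noncomputable section
-- The differential of the fundamental form, on vector fields and in charts.
section ChartFields
open Filter Topology
set_option linter.unusedSectionVars false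

set_option synthInstance.maxHeartbeats 200000 in
/-- The exterior derivative of a pulled back 2-form, as a cyclic sum. -/
lemma cyclic_fderiv_pullback {E E' : Type*} [NormedAddCommGroup E] [NormedSpace ℝ E]
    [NormedAddCommGroup E'] [NormedSpace ℝ E'] {b : E → E →L[ℝ] E →L[ℝ] ℝ} {g : E' → E} {z : E'}
    (hb : DifferentiableAt ℝ b (g z)) (hg : ContDiffAt ℝ 2 g z)
    (hs : ∀ u v, b (g z) u v = -b (g z) v u) (p q r : E') :
    fderiv ℝ (fun z ↦ b (g z) (fderiv ℝ g z q) (fderiv ℝ g z r)) z p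
      + fderiv ℝ (fun z ↦ b (g z) (fderiv ℝ g z r) (fderiv ℝ g z p)) z q
      + fderiv ℝ (fun z ↦ b (g z) (fderiv ℝ g z p) (fderiv ℝ g z q)) z r
    = fderiv ℝ b (g z) (fderiv ℝ g z p) (fderiv ℝ g z q) (fderiv ℝ g z r)
      + fderiv ℝ b (g z) (fderiv ℝ g z q) (fderiv ℝ g z r) (fderiv ℝ g z p)
      + fderiv ℝ b (g z) (fderiv ℝ g z r) (fderiv ℝ g z p) (fderiv ℝ g z q) := by
  have h1 : HasFDerivAt g (fderiv ℝ g z) z :=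
    (hg.differentiableAt (by norm_num)).hasFDerivAt
  have h2 : HasFDerivAt (fderiv ℝ g) (fderiv ℝ (fderiv ℝ g) z) z :=
    ((hg.fderiv_right (m := 1) (by norm_num)).differentiableAt (by norm_num)).hasFDerivAt
  -- The second derivative of `g` is symmetric and `b` is skew at `g z`, so all terms containing it
  -- cancel in the cyclic sum.
  have hsymm : ∀ u v, fderiv ℝ (fderiv ℝ g) z u v = fderiv ℝ (fderiv ℝ g) z v u :=
    fun u v ↦ (hg.isSymmSndFDerivAt (by simp)).eq u v
  have key : ∀ p q r, fderiv ℝ (fun z ↦ b (g z) (fderiv ℝ g z q) (fderiv ℝ g z r)) z p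
      = fderiv ℝ b (g z) (fderiv ℝ g z p) (fderiv ℝ g z q) (fderiv ℝ g z r)
        + b (g z) (fderiv ℝ (fderiv ℝ g) z p q) (fderiv ℝ g z r)
        + b (g z) (fderiv ℝ g z q) (fderiv ℝ (fderiv ℝ g) z p r) := by
    intro p q r
    have hv : ∀ v, HasFDerivAt (fun z ↦ fderiv ℝ g z v)
        ((ContinuousLinearMap.apply ℝ E v).comp (fderiv ℝ (fderiv ℝ g) z)) z := fun v ↦
      (ContinuousLinearMap.apply ℝ E v).hasFDerivAt.comp z h2
    have h3 : HasFDerivAt (fun z ↦ b (g z)) ((fderiv ℝ b (g z)).comp (fderiv ℝ g z)) z :=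
      HasFDerivAt.comp (g := b) (g' := fderiv ℝ b (g z)) z hb.hasFDerivAt h1
    have h4 := h3.clm_apply (hv q)
    have h5 := h4.clm_apply (hv r)
    rw [h5.fderiv]
    simp
    ring
  rw [key p q r, key q r p, key r p q, hsymm q p, hsymm r p, hsymm r q]
  have s1 := hs (fderiv ℝ (fderiv ℝ g) z p q) (fderiv ℝ g z r)
  have s2 := hs (fderiv ℝ (fderiv ℝ g) z p r) (fderiv ℝ g z q)
  have s3 := hs (fderiv ℝ (fderiv ℝ g) z q r) (fderiv ℝ g z p)
  linarith

variable {E : Type*} [NormedAddCommGroup E] [NormedSpace ℝ E] [FiniteDimensional ℝ E]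
  {H : Type*} [TopologicalSpace H] {I : ModelWithCorners ℝ E H} [I.Boundaryless]
  {M : Type*} [TopologicalSpace M] [ChartedSpace H M] [IsManifold I ∞ M]

variable (I) in
/-- The vector field on `M` with constant coefficients `v` in the chart at `x`. -/
def chartField (x : M) (v : E) : Π y : M, TangentSpace I y := fun y ↦
  mfderiv 𝓘(ℝ, E) I (extChartAt I x).symm (extChartAt I x y) v

lemma chartField_eq_symm {x y : M} (hy : y ∈ (extChartAt I x).source) (v : E) :
    chartField I x v y = (trivializationAt E (TangentSpace I) x).symm y v := by
  rw [extChartAt_source] at hy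
  have := TangentBundle.symmL_trivializationAt (I := I) (𝕜 := ℝ) hy
  have h2 := congrArg (fun T ↦ T v) this
  simp only [I.range_eq_univ, mfderivWithin_univ] at h2
  rw [chartField]
  rw [Trivialization.symmL_apply _ (by exact hy)] at h2
  exact h2.symm

lemma smoothAt_chartField {x y : M} (hy : y ∈ (extChartAt I x).source) (v : E) :
    SmoothAt I (chartField I x v) y := by
  set t := trivializationAt E (TangentSpace I : M → Type _) x with ht
  have hb : t.baseSet = (extChartAt I x).source := by
    rw [extChartAt_source]; rfl
  have hy' : y ∈ t.baseSet := hb ▸ hy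
  refine SmoothAt.congr (X := fun z ↦ t.symm z v) ?_ ?_
  · rw [SmoothAt, ← contMDiffWithinAt_univ, t.contMDiffWithinAt_section _ hy', contMDiffWithinAt_univ]
    refine (contMDiffAt_const (c := v)).congr_of_eventuallyEq ?_
    filter_upwards [t.open_baseSet.mem_nhds hy'] with z hz
    rw [t.apply_mk_symm hz]
  · filter_upwards [t.open_baseSet.mem_nhds hy'] with z hz
    exact chartField_eq_symm (hb ▸ hz) v

lemma mlieBracket_chartField (x : M) (u v : E) :
    mlieBracket I (chartField I x u) (chartField I x v) x = 0 := by
  have e : ∀ w : E, mpullbackWithin 𝓘(ℝ, E) I (extChartAt I x).symm (chartField I x w) (range I)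
      =ᶠ[𝓝 (extChartAt I x x)] fun _ ↦ w := by
    intro w
    filter_upwards [extChartAt_target_mem_nhds (I := I) x] with y hy
    rw [mpullbackWithin_apply, chartField, (extChartAt I x).right_inv hy, I.range_eq_univ,
      mfderivWithin_univ]
    have hi := isInvertible_mfderivWithin_extChartAt_symm (I := I) hy
    rw [I.range_eq_univ, mfderivWithin_univ] at hi
    exact hi.inverse_apply_eq.2 rfl
  have h : ∀ P Q : E → E, P =ᶠ[𝓝 (extChartAt I x x)] (fun _ ↦ u) →
      Q =ᶠ[𝓝 (extChartAt I x x)] (fun _ ↦ v) → lieBracketWithin ℝ P Q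
        ((extChartAt I x).symm ⁻¹' univ ∩ range I) (extChartAt I x x) = 0 := by
    intro P Q hP hQ
    rw [preimage_univ, univ_inter, I.range_eq_univ, lieBracketWithin_univ,
      hP.lieBracket_vectorField_eq hQ]
    simp [lieBracket]
  have h := h _ _ (e u) (e v)
  exact (congrArg (mfderiv I 𝓘(ℝ, E) (extChartAt I x) x).inverse h).trans (map_zero _)

variable [RiemannianBundle (fun x : M ↦ TangentSpace I x)]
  [IsContMDiffRiemannianBundle I ∞ E (fun x : M ↦ TangentSpace I x)]
  {J : Π x : M, TangentSpace I x →L[ℝ] TangentSpace I x}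
  {X Y Z : Π x : M, TangentSpace I x} {x : M}

/-- `dω = 3 ⟨(∇J), ·⟩` on commuting vector fields. -/
lemma IsNearlyKahler.cyclic_mvfderiv (hJ : IsNearlyKahler J) (hX : SmoothAt I X x)
    (hY : SmoothAt I Y x) (hZ : SmoothAt I Z x) (hXY : mlieBracket I X Y x = 0)
    (hYZ : mlieBracket I Y Z x = 0) (hZX : mlieBracket I Z X x = 0) :
    mvfderiv I (fun y ↦ (inner ℝ (appJ J Y y) (Z y) : ℝ)) x (X x)
      + mvfderiv I (fun y ↦ (inner ℝ (appJ J Z y) (X y) : ℝ)) x (Y x)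
      + mvfderiv I (fun y ↦ (inner ℝ (appJ J X y) (Y y) : ℝ)) x (Z x)
      = 3 * inner ℝ (covDerivEnd J x (X x) (Y x)) (Z x) := by
  have hB := hJ.isNKTensor x
  rw [leviCivita_metric_apply _ (hJ.smooth_appJ hY).mdiff hZ.mdiff,
    leviCivita_metric_apply _ (hJ.smooth_appJ hZ).mdiff hX.mdiff,
    leviCivita_metric_apply _ (hJ.smooth_appJ hX).mdiff hY.mdiff,
    hJ.leviCivita_appJ hX.mdiff, hJ.leviCivita_appJ hY.mdiff, hJ.leviCivita_appJ hZ.mdiff]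
  -- For commuting fields `∇_X Y = ∇_Y X`, so the terms differentiating the fields cancel by
  -- skewness of `ω`. The three remaining terms agree by cyclicity of the 3-form, whence the factor
  -- 3.
  have t1 := leviCivita_torsionFree hX.mdiff hY.mdiff
  have t2 := leviCivita_torsionFree hY.mdiff hZ.mdiff
  have t3 := leviCivita_torsionFree hZ.mdiff hX.mdiff
  rw [hXY, sub_eq_zero] at t1
  rw [hYZ, sub_eq_zero] at t2
  rw [hZX, sub_eq_zero] at t3
  simp only [inner_add_left, appJ, t1, t2, t3]
  rw [hB.inner_cyc (u := Y x), hB.inner_cyc (u := Z x), hB.inner_cyc (u := Y x)]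
  have hs : ∀ p q : TangentSpace I x, (inner ℝ (J x p) q : ℝ) = -inner ℝ (J x q) p := fun p q ↦ by
    rw [hJ.inner_J_left, real_inner_comm]
  rw [hs (Y x), hs (Z x), hs (X x)]
  ring

variable (J) in
/-- The fundamental form in the chart at `x`. -/
def chartForm (x : M) (y : E) : E →L[ℝ] E →L[ℝ] ℝ :=
  ((innerSL ℝ).comp (J ((extChartAt I x).symm y))).bilinearComp
    (mfderiv 𝓘(ℝ, E) I (extChartAt I x).symm y) (mfderiv 𝓘(ℝ, E) I (extChartAt I x).symm y)

lemma chartForm_apply (y u v : E) : chartForm J x y u v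
    = (inner ℝ (J _ (mfderiv 𝓘(ℝ, E) I (extChartAt I x).symm y u))
      (mfderiv 𝓘(ℝ, E) I (extChartAt I x).symm y v) : ℝ) := rfl

lemma chartForm_apply_eq {y : E} (hy : y ∈ (extChartAt I x).target) (u v : E) :
    chartForm J x y u v = (inner ℝ (appJ J (chartField I x u) ((extChartAt I x).symm y))
      (chartField I x v ((extChartAt I x).symm y)) : ℝ) := by
  rw [chartForm_apply, appJ, chartField, chartField, (extChartAt I x).right_inv hy]

lemma contDiffOn_chartForm (hJ : IsAlmostHermitian J) :
    ContDiffOn ℝ ∞ (chartForm J x) (extChartAt I x).target := by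
  rw [contDiffOn_clm_apply]
  intro u
  rw [contDiffOn_clm_apply]
  intro v y hy
  have h1 := ((hJ.smooth_appJ (smoothAt_chartField ((extChartAt I x).map_target hy) u)).inner
    (smoothAt_chartField ((extChartAt I x).map_target hy) v))
  have h2 : ContMDiffAt 𝓘(ℝ, E) I ∞ (extChartAt I x).symm y :=
    (contMDiffOn_extChartAt_symm x).contMDiffAt ((isOpen_extChartAt_target x).mem_nhds hy)
  refine ContDiffAt.contDiffWithinAt ?_
  rw [← contMDiffAt_iff_contDiffAt]
  refine (h1.comp y h2).congr_of_eventuallyEq ?_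
  filter_upwards [(isOpen_extChartAt_target (I := I) x).mem_nhds hy] with z hz
  exact chartForm_apply_eq hz u v

/-- Chart fields with constant coefficients commute at `x`, so `cyclic_mvfderiv` applies to them;
their derivatives of `ω` are ordinary derivatives of its components in the chart. -/
lemma cyclic_fderiv_chartForm (hJ : IsNearlyKahler J) (u v w : E) :
    fderiv ℝ (chartForm J x) (extChartAt I x x) u v w
      + fderiv ℝ (chartForm J x) (extChartAt I x x) v w u
      + fderiv ℝ (chartForm J x) (extChartAt I x x) w u v
    = 3 * inner ℝ (covDerivEnd J x (chartField I x u x) (chartField I x v x))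
      (chartField I x w x) := by
  have hx : x ∈ (extChartAt I x).source := mem_extChartAt_source x
  have hd : DifferentiableAt ℝ (chartForm J x) (extChartAt I x x) :=
    ((contDiffOn_chartForm hJ.toIsAlmostHermitian).contDiffAt
      (extChartAt_target_mem_nhds x)).differentiableAt (by simp)
  have key : ∀ u v w : E, fderiv ℝ (chartForm J x) (extChartAt I x x) u v w
      = mvfderiv I (fun y ↦ (inner ℝ (appJ J (chartField I x v) y) (chartField I x w y) : ℝ)) x
        (chartField I x u x) := by
    intro u v w
    have h1 : fderiv ℝ (chartForm J x) (extChartAt I x x) u v w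
        = fderiv ℝ (fun y ↦ chartForm J x y v w) (extChartAt I x x) u := by
      have := ((hd.hasFDerivAt.clm_apply (hasFDerivAt_const v _)).clm_apply
        (hasFDerivAt_const w _)).fderiv
      rw [this]
      simp
    have h2 : MDiffAt (fun y ↦ (inner ℝ (appJ J (chartField I x v) y) (chartField I x w y) : ℝ))
        ((extChartAt I x).symm (extChartAt I x x)) := by
      rw [extChartAt_to_inv]
      exact ((hJ.smooth_appJ (smoothAt_chartField hx v)).inner
        (smoothAt_chartField hx w)).mdifferentiableAt (by simp)
    have h3 : MDifferentiableAt 𝓘(ℝ, E) I (extChartAt I x).symm (extChartAt I x x) :=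
      ((contMDiffOn_extChartAt_symm (n := ∞) x).contMDiffAt
        (extChartAt_target_mem_nhds x)).mdifferentiableAt (by simp)
    have h4 : (fun y ↦ chartForm J x y v w) =ᶠ[𝓝 (extChartAt I x x)]
        (fun y ↦ (inner ℝ (appJ J (chartField I x v) y) (chartField I x w y) : ℝ))
          ∘ (extChartAt I x).symm := by
      filter_upwards [extChartAt_target_mem_nhds (I := I) x] with z hz
      exact chartForm_apply_eq hz v w
    have h5 := mfderiv_comp _ h2 h3
    rw [mfderiv_eq_fderiv] at h5
    rw [h1, h4.fderiv_eq, h5]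
    -- The inverse chart returns `x` only up to a propositional equality, so the dependent base
    -- point is moved by substitution.
    have h6 : ∀ p, p = x → ∀ (k : M → ℝ) (v : E),
        (mfderiv I 𝓘(ℝ, ℝ) k p : E →L[ℝ] ℝ) v = (mfderiv I 𝓘(ℝ, ℝ) k x : E →L[ℝ] ℝ) v := by
      rintro p rfl k v; rfl
    exact h6 _ (extChartAt_to_inv x) _ _
  rw [key, key, key]
  exact hJ.cyclic_mvfderiv (smoothAt_chartField hx u) (smoothAt_chartField hx v)
    (smoothAt_chartField hx w) (mlieBracket_chartField ..) (mlieBracket_chartField ..)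
    (mlieBracket_chartField ..)

end ChartFields
end
end RiemGeom

namespace RiemGeom
noncomputable section
-- Pulling the fundamental form back to a vector space.
section Pullback
open Filter Topology
set_option linter.unusedSectionVars false

variable {E : Type*} [NormedAddCommGroup E] [NormedSpace ℝ E] [FiniteDimensional ℝ E]
  {H : Type*} [TopologicalSpace H] {I : ModelWithCorners ℝ E H} [I.Boundaryless]
  {M : Type*} [TopologicalSpace M] [ChartedSpace H M] [IsManifold I ∞ M]
  [RiemannianBundle (fun x : M ↦ TangentSpace I x)]
  [IsContMDiffRiemannianBundle I ∞ E (fun x : M ↦ TangentSpace I x)]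
  {J : Π x : M, TangentSpace I x →L[ℝ] TangentSpace I x}
  {E' : Type*} [NormedAddCommGroup E'] [NormedSpace ℝ E'] {G G' : E' → M} {z : E'}

variable (J) in
/-- The pullback `G^* ω` of the fundamental form by a map from a vector space. -/
def pullbackForm (G : E' → M) (z q r : E') : ℝ :=
  inner ℝ (J (G z) (mfderiv 𝓘(ℝ, E') I G z q)) (mfderiv 𝓘(ℝ, E') I G z r)

lemma pullbackForm_congr (h : G =ᶠ[𝓝 z] G') (q r : E') :
    pullbackForm J G z q r = pullbackForm J G' z q r := by
  have key : ∀ (x x' : M) (A A' : E' →L[ℝ] E), x = x' → A = A' →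
      (inner ℝ (J x (A q : TangentSpace I x)) (A r : TangentSpace I x) : ℝ)
        = inner ℝ (J x' (A' q : TangentSpace I x')) (A' r : TangentSpace I x') := by
    rintro x _ A _ rfl rfl; rfl
  exact key _ _ _ _ h.self_of_nhds (h.mfderiv_eq (I := 𝓘(ℝ, E')) (I' := I))

lemma pullbackForm_swap (hJ : IsAlmostHermitian J) (q r : E') :
    pullbackForm J G z q r = -pullbackForm J G z r q := by
  rw [pullbackForm, pullbackForm, hJ.inner_J_left, real_inner_comm]

lemma contMDiffAt_extChartAt_comp (hG : ContMDiffAt 𝓘(ℝ, E') I ∞ G z) :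
    ContDiffAt ℝ ∞ (extChartAt I (G z) ∘ G) z := by
  rw [← contMDiffAt_iff_contDiffAt]
  exact ContMDiffAt.comp z contMDiffAt_extChartAt hG

lemma eventually_extChartAt_symm_comp (hG : ContinuousAt G z) :
    ∀ᶠ z' in 𝓝 z, (extChartAt I (G z)).symm ((extChartAt I (G z) ∘ G) z') = G z' := by
  filter_upwards [hG.eventually (extChartAt_source_mem_nhds (I := I) (G z))] with z' hz'
  exact (extChartAt I (G z)).left_inv hz'

lemma pullbackForm_extChartAt_symm {x : M} {g : E' → E} (hg : DifferentiableAt ℝ g z)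
    (hz : g z ∈ (extChartAt I x).target) (q r : E') :
    pullbackForm J ((extChartAt I x).symm ∘ g) z q r
      = chartForm J x (g z) (fderiv ℝ g z q) (fderiv ℝ g z r) := by
  have h3 : MDifferentiableAt 𝓘(ℝ, E) I (extChartAt I x).symm (g z) :=
    ((contMDiffOn_extChartAt_symm (n := ∞) x).contMDiffAt
      ((isOpen_extChartAt_target x).mem_nhds hz)).mdifferentiableAt (by simp)
  have := mfderiv_comp z h3 hg.mdifferentiableAt
  rw [mfderiv_eq_fderiv] at this
  rw [pullbackForm, this]
  rfl

lemma eventually_pullbackForm_eq (hG : ContMDiffAt 𝓘(ℝ, E') I ∞ G z) :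
    ∀ᶠ z' in 𝓝 z, ∀ q r, pullbackForm J G z' q r
      = chartForm J (G z) ((extChartAt I (G z) ∘ G) z')
        (fderiv ℝ (extChartAt I (G z) ∘ G) z' q) (fderiv ℝ (extChartAt I (G z) ∘ G) z' r) := by
  have hg := contMDiffAt_extChartAt_comp hG
  have h1 : ∀ᶠ z' in 𝓝 z, DifferentiableAt ℝ (extChartAt I (G z) ∘ G) z' := by
    filter_upwards [(hg.of_le one_le_infty).eventually (by simp)] with z' h
    exact h.differentiableAt (by simp)
  have h2 : ∀ᶠ z' in 𝓝 z, (extChartAt I (G z) ∘ G) z' ∈ (extChartAt I (G z)).target :=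
    hg.continuousAt.eventually (extChartAt_target_mem_nhds (I := I) (G z))
  filter_upwards [h1, h2, eventually_eventually_nhds.2
    (eventually_extChartAt_symm_comp (I := I) hG.continuousAt)] with z' h1 h2 h3 q r
  rw [← pullbackForm_extChartAt_symm h1 h2]
  exact pullbackForm_congr (h3.mono fun w hw ↦ hw.symm) q r

lemma contDiffAt_pullbackForm (hJ : IsAlmostHermitian J) (hG : ContMDiffAt 𝓘(ℝ, E') I ∞ G z)
    (q r : E') : ContDiffAt ℝ ∞ (fun z ↦ pullbackForm J G z q r) z := by
  have hg := contMDiffAt_extChartAt_comp hG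
  have hg' : ContDiffAt ℝ ∞ (fderiv ℝ (extChartAt I (G z) ∘ G)) z :=
    hg.fderiv_right (by simp)
  have hb : ContDiffAt ℝ ∞ (chartForm J (G z)) ((extChartAt I (G z) ∘ G) z) :=
    (contDiffOn_chartForm hJ).contDiffAt (extChartAt_target_mem_nhds (G z))
  have hv : ∀ v, ContDiffAt ℝ ∞ (fun z' ↦ fderiv ℝ (extChartAt I (G z) ∘ G) z' v) z :=
    fun v ↦ hg'.clm_apply contDiffAt_const
  refine (((hb.comp z hg).clm_apply (hv q)).clm_apply (hv r)).congr_of_eventuallyEq ?_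
  exact (eventually_pullbackForm_eq hG).mono fun z' h ↦ h q r

/-- `d (G^* ω) = 3 G^* ⟨(∇J), ·⟩`. -/
lemma cyclic_fderiv_pullbackForm (hJ : IsNearlyKahler J) (hG : ContMDiffAt 𝓘(ℝ, E') I ∞ G z)
    (p q r : E') :
    fderiv ℝ (fun z ↦ pullbackForm J G z q r) z p + fderiv ℝ (fun z ↦ pullbackForm J G z r p) z q
      + fderiv ℝ (fun z ↦ pullbackForm J G z p q) z r
    = 3 * inner ℝ (covDerivEnd J (G z) (mfderiv 𝓘(ℝ, E') I G z p) (mfderiv 𝓘(ℝ, E') I G z q))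
        (mfderiv 𝓘(ℝ, E') I G z r) := by
  set g := extChartAt I (G z) ∘ G with hgdef
  have hg : ContDiffAt ℝ ∞ g z := contMDiffAt_extChartAt_comp hG
  have he := eventually_pullbackForm_eq (J := J) hG
  have e1 : ∀ q r, fderiv ℝ (fun z ↦ pullbackForm J G z q r) z
      = fderiv ℝ (fun z' ↦ chartForm J (G z) (g z') (fderiv ℝ g z' q) (fderiv ℝ g z' r)) z :=
    fun q r ↦ Filter.EventuallyEq.fderiv_eq (he.mono fun z' h ↦ h q r)
  have hd : DifferentiableAt ℝ (chartForm J (G z)) (g z) :=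
    ((contDiffOn_chartForm hJ.toIsAlmostHermitian).contDiffAt
      (extChartAt_target_mem_nhds (G z))).differentiableAt (by simp)
  rw [e1, e1, e1, cyclic_fderiv_pullback hd
    (hg.of_le (WithTop.coe_le_coe.2 le_top : ((2 : ℕ∞) : WithTop ℕ∞) ≤ ∞))]
  · have e2 : ∀ v, (chartField I (G z) (fderiv ℝ g z v) (G z) : TangentSpace I (G z))
        = mfderiv 𝓘(ℝ, E') I G z v := by
      intro v
      have h3 : MDifferentiableAt 𝓘(ℝ, E) I (extChartAt I (G z)).symm (g z) :=
        ((contMDiffOn_extChartAt_symm (n := ∞) (G z)).contMDiffAt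
          (extChartAt_target_mem_nhds (G z))).mdifferentiableAt (by simp)
      have h4 := mfderiv_comp z h3 (hg.differentiableAt (by simp)).mdifferentiableAt
      have h5 : (extChartAt I (G z)).symm ∘ g =ᶠ[𝓝 z] G :=
        eventually_extChartAt_symm_comp (I := I) hG.continuousAt
      rw [mfderiv_eq_fderiv] at h4
      have h6 := (h5.mfderiv_eq (I := 𝓘(ℝ, E')) (I' := I))
      exact congrArg (fun T : E' →L[ℝ] E ↦ T v) (h4.symm.trans h6)
    rw [← e2, ← e2, ← e2]
    exact cyclic_fderiv_chartForm hJ _ _ _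
  · intro u v
    have hs : ∀ a b : TangentSpace I ((extChartAt I (G z)).symm (g z)),
        (inner ℝ (J _ a) b : ℝ) = -inner ℝ (J _ b) a := fun a b ↦ by
      rw [hJ.inner_J_left, real_inner_comm]
    exact hs _ _

end Pullback

/-! ### The variation in a chart of `L`, and the differential of the variation form. -/

section Variation
open Filter Topology
set_option linter.unusedSectionVars false

variable {E : Type*} [NormedAddCommGroup E] [NormedSpace ℝ E] [FiniteDimensional ℝ E]
  {H : Type*} [TopologicalSpace H] {I : ModelWithCorners ℝ E H} [I.Boundaryless]
  {M : Type*} [TopologicalSpace M] [ChartedSpace H M] [IsManifold I ∞ M]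
  [RiemannianBundle (fun x : M ↦ TangentSpace I x)]
  [IsContMDiffRiemannianBundle I ∞ E (fun x : M ↦ TangentSpace I x)]
  {J : Π x : M, TangentSpace I x →L[ℝ] TangentSpace I x}
  {n : ℕ} {L : Type*} [TopologicalSpace L] [ChartedSpace (EuclideanSpace ℝ (Fin n)) L]
  [IsManifold (𝓡 n) ∞ L] {F : L × ℝ → M} {ε t : ℝ} {x : L} {y : EuclideanSpace ℝ (Fin n)}

variable (F x) in
/-- The variation in a chart of `L`. -/
def chartVariation (z : EuclideanSpace ℝ (Fin n) × ℝ) : M :=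
  F ((extChartAt (𝓡 n) x).symm z.1, z.2)

namespace IsLagrangianVariation

lemma contMDiffAt (hF : IsLagrangianVariation n J ε F) (ht : t ∈ Ioo (-ε) ε) :
    ContMDiffAt ((𝓡 n).prod 𝓘(ℝ, ℝ)) I ∞ F (x, t) :=
  hF.contMDiffOn.contMDiffAt ((isOpen_univ.prod isOpen_Ioo).mem_nhds ⟨mem_univ _, ht⟩)

lemma contMDiffAt_chartVariation (hF : IsLagrangianVariation n J ε F) (ht : t ∈ Ioo (-ε) ε)
    (hy : y ∈ (extChartAt (𝓡 n) x).target) :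
    ContMDiffAt 𝓘(ℝ, EuclideanSpace ℝ (Fin n) × ℝ) I ∞ (chartVariation F x) (y, t) := by
  have h1 : ContMDiffAt 𝓘(ℝ, EuclideanSpace ℝ (Fin n)) (𝓡 n) ∞ (extChartAt (𝓡 n) x).symm y :=
    (contMDiffOn_extChartAt_symm x).contMDiffAt ((isOpen_extChartAt_target x).mem_nhds hy)
  have h2 : ContMDiffAt 𝓘(ℝ, EuclideanSpace ℝ (Fin n) × ℝ) (𝓡 n) ∞
      (fun z : EuclideanSpace ℝ (Fin n) × ℝ ↦ (extChartAt (𝓡 n) x).symm z.1) (y, t) :=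
    ContMDiffAt.comp (y, t) h1 contDiffAt_fst.contMDiffAt
  have h3 : ContMDiffAt 𝓘(ℝ, EuclideanSpace ℝ (Fin n) × ℝ) 𝓘(ℝ, ℝ) ∞
      (fun z : EuclideanSpace ℝ (Fin n) × ℝ ↦ z.2) (y, t) := contDiffAt_snd.contMDiffAt
  exact ContMDiffAt.comp (y, t) (hF.contMDiffAt ht) (h2.prodMk h3)

lemma mfderiv_chartVariation_left (hF : IsLagrangianVariation n J ε F) (ht : t ∈ Ioo (-ε) ε)
    (hy : y ∈ (extChartAt (𝓡 n) x).target) (v : EuclideanSpace ℝ (Fin n)) :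
    mfderiv 𝓘(ℝ, EuclideanSpace ℝ (Fin n) × ℝ) I (chartVariation F x) (y, t) (v, (0 : ℝ))
      = mfderiv (𝓡 n) I (fun x ↦ F (x, t)) ((extChartAt (𝓡 n) x).symm y)
        (mfderiv 𝓘(ℝ, EuclideanSpace ℝ (Fin n)) (𝓡 n) (extChartAt (𝓡 n) x).symm y v) := by
  have h1 : MDifferentiableAt 𝓘(ℝ, EuclideanSpace ℝ (Fin n)) (𝓡 n) (extChartAt (𝓡 n) x).symm y :=
    ((contMDiffOn_extChartAt_symm (n := ∞) x).contMDiffAt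
      ((isOpen_extChartAt_target x).mem_nhds hy)).mdifferentiableAt (by simp)
  have h2 : MDifferentiableAt (𝓡 n) I (fun x ↦ F (x, t)) ((extChartAt (𝓡 n) x).symm y) :=
    ((hF.isLagrangian t ht).contMDiff _).mdifferentiableAt (by simp)
  have h3 := (hF.contMDiffAt_chartVariation ht hy).mdifferentiableAt (by simp)
  have h4 : HasFDerivAt (fun y : EuclideanSpace ℝ (Fin n) ↦ (y, t))
      (ContinuousLinearMap.inl ℝ (EuclideanSpace ℝ (Fin n)) ℝ) y := hasFDerivAt_prodMk_left y t
  have h5 := mfderiv_comp y h3 h4.differentiableAt.mdifferentiableAt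
  have h6 := mfderiv_comp y h2 h1
  rw [mfderiv_eq_fderiv, h4.fderiv] at h5
  exact congrArg (fun T : EuclideanSpace ℝ (Fin n) →L[ℝ] E ↦ T v) (h5.symm.trans h6)

lemma mfderiv_chartVariation_right (hF : IsLagrangianVariation n J ε F) (ht : t ∈ Ioo (-ε) ε)
    (hy : y ∈ (extChartAt (𝓡 n) x).target) :
    mfderiv 𝓘(ℝ, EuclideanSpace ℝ (Fin n) × ℝ) I (chartVariation F x) (y, t) (0, (1 : ℝ))
      = variationField F t ((extChartAt (𝓡 n) x).symm y) := by
  have h3 := (hF.contMDiffAt_chartVariation ht hy).mdifferentiableAt (by simp)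
  have h4 : HasFDerivAt (fun s : ℝ ↦ (y, s))
      (ContinuousLinearMap.inr ℝ (EuclideanSpace ℝ (Fin n)) ℝ) t := hasFDerivAt_prodMk_right y t
  have h5 := mfderiv_comp t h3 h4.differentiableAt.mdifferentiableAt
  rw [mfderiv_eq_fderiv, h4.fderiv] at h5
  exact congrArg (fun T : ℝ →L[ℝ] E ↦ T 1) h5.symm

variable (J F t x) in
/-- The variation 1-form in a chart of `L`. -/
def chartVariationForm (y : EuclideanSpace ℝ (Fin n)) : EuclideanSpace ℝ (Fin n) →L[ℝ] ℝ :=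
  (variationForm J F t ((extChartAt (𝓡 n) x).symm y)).comp
    (mfderiv 𝓘(ℝ, EuclideanSpace ℝ (Fin n)) (𝓡 n) (extChartAt (𝓡 n) x).symm y)

lemma chartVariationForm_apply (hF : IsLagrangianVariation n J ε F) (ht : t ∈ Ioo (-ε) ε)
    (hy : y ∈ (extChartAt (𝓡 n) x).target) (v : EuclideanSpace ℝ (Fin n)) :
    chartVariationForm J F t x y v
      = pullbackForm J (chartVariation F x) (y, t) (0, (1 : ℝ)) (v, (0 : ℝ)) := by
  rw [pullbackForm, hF.mfderiv_chartVariation_left ht hy, hF.mfderiv_chartVariation_right ht hy]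
  rfl

lemma contDiffOn_chartVariationForm (hF : IsLagrangianVariation n J ε F) (hJ : IsAlmostHermitian J)
    (ht : t ∈ Ioo (-ε) ε) :
    ContDiffOn ℝ ∞ (chartVariationForm J F t x) (extChartAt (𝓡 n) x).target := by
  rw [contDiffOn_clm_apply]
  intro v y hy
  refine ContDiffAt.contDiffWithinAt ?_
  have h1 := contDiffAt_pullbackForm hJ (hF.contMDiffAt_chartVariation ht hy) (0, (1 : ℝ)) (v, (0 : ℝ))
  have h2 : ContDiffAt ℝ ∞ (fun y : EuclideanSpace ℝ (Fin n) ↦ (y, t)) y :=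
    contDiffAt_id.prodMk contDiffAt_const
  refine (h1.comp y h2).congr_of_eventuallyEq ?_
  filter_upwards [(isOpen_extChartAt_target x).mem_nhds hy] with y' hy'
  exact hF.chartVariationForm_apply ht hy' v

lemma pullbackForm_eq_zero (hF : IsLagrangianVariation n J ε F) (ht : t ∈ Ioo (-ε) ε)
    (hy : y ∈ (extChartAt (𝓡 n) x).target) (u v : EuclideanSpace ℝ (Fin n)) :
    pullbackForm J (chartVariation F x) (y, t) (u, (0 : ℝ)) (v, (0 : ℝ)) = 0 := by
  rw [pullbackForm, hF.mfderiv_chartVariation_left ht hy, hF.mfderiv_chartVariation_left ht hy]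
  exact (hF.isLagrangian t ht).isotropic _ _ _

/-- All slices are Lagrangian, so the component vanishes on an open set of pairs `(y, t)`. Hence its
derivative is zero in the time direction as well. -/
lemma fderiv_pullbackForm_eq_zero (hF : IsLagrangianVariation n J ε F) (ht : t ∈ Ioo (-ε) ε)
    (hy : y ∈ (extChartAt (𝓡 n) x).target) (u v : EuclideanSpace ℝ (Fin n)) :
    fderiv ℝ (fun z ↦ pullbackForm J (chartVariation F x) z (u, (0 : ℝ)) (v, (0 : ℝ))) (y, t) = 0 := by
  have : (fun z ↦ pullbackForm J (chartVariation F x) z (u, (0 : ℝ)) (v, (0 : ℝ)))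
      =ᶠ[𝓝 (y, t)] fun _ ↦ 0 := by
    filter_upwards [((isOpen_extChartAt_target (I := 𝓡 n) x).prod isOpen_Ioo).mem_nhds ⟨hy, ht⟩]
      with z hz
    exact hF.pullbackForm_eq_zero hz.2 hz.1 u v
  rw [this.fderiv_eq]
  simp

/-- The 3-form `⟨(∇J) ·, ·⟩` vanishes on Lagrangian submanifolds. -/
lemma inner_covDerivEnd_eq_zero (hF : IsLagrangianVariation n J ε F) (hJ : IsNearlyKahler J)
    (ht : t ∈ Ioo (-ε) ε) (x : L) (u v w : TangentSpace (𝓡 n) x) :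
    (inner ℝ (covDerivEnd J (F (x, t)) (mfderiv (𝓡 n) I (fun x ↦ F (x, t)) x u)
      (mfderiv (𝓡 n) I (fun x ↦ F (x, t)) x v)) (mfderiv (𝓡 n) I (fun x ↦ F (x, t)) x w) : ℝ) = 0 := by
  set y := extChartAt (𝓡 n) x x with hy'
  have hy : y ∈ (extChartAt (𝓡 n) x).target := mem_extChartAt_target x
  have key := cyclic_fderiv_pullbackForm hJ (hF.contMDiffAt_chartVariation ht hy)
  have hx : (extChartAt (𝓡 n) x).symm y = x := extChartAt_to_inv x
  have hinv : ∀ u : TangentSpace (𝓡 n) x, ∃ a : EuclideanSpace ℝ (Fin n),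
      (mfderiv 𝓘(ℝ, EuclideanSpace ℝ (Fin n)) (𝓡 n) (extChartAt (𝓡 n) x).symm y a :
        EuclideanSpace ℝ (Fin n)) = u := by
    intro u
    have := isInvertible_mfderivWithin_extChartAt_symm (I := 𝓡 n) hy
    rw [(𝓡 n).range_eq_univ, mfderivWithin_univ] at this
    exact this.surjective u
  obtain ⟨a, ha⟩ := hinv u
  obtain ⟨b, hb⟩ := hinv v
  obtain ⟨c, hc⟩ := hinv w
  -- With three directions tangent to `L`, every derivative on the left vanishes.
  have k := key (a, (0 : ℝ)) (b, (0 : ℝ)) (c, (0 : ℝ))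
  rw [hF.fderiv_pullbackForm_eq_zero ht hy, hF.fderiv_pullbackForm_eq_zero ht hy,
    hF.fderiv_pullbackForm_eq_zero ht hy, hF.mfderiv_chartVariation_left ht hy,
    hF.mfderiv_chartVariation_left ht hy, hF.mfderiv_chartVariation_left ht hy] at k
  have tr : ∀ (x' : L) (a b c : EuclideanSpace ℝ (Fin n)), x' = x → a = u → b = v → c = w →
      (0 : ℝ) = 3 * inner ℝ (covDerivEnd J (F (x', t)) (mfderiv (𝓡 n) I (fun x ↦ F (x, t)) x' a)
        (mfderiv (𝓡 n) I (fun x ↦ F (x, t)) x' b)) (mfderiv (𝓡 n) I (fun x ↦ F (x, t)) x' c) →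
      (inner ℝ (covDerivEnd J (F (x, t)) (mfderiv (𝓡 n) I (fun x ↦ F (x, t)) x u)
        (mfderiv (𝓡 n) I (fun x ↦ F (x, t)) x v)) (mfderiv (𝓡 n) I (fun x ↦ F (x, t)) x w) : ℝ) = 0 := by
    rintro x' a b c rfl rfl rfl rfl h
    linarith
  exact tr _ _ _ _ hx ha hb hc (Eq.trans (by simp) k)

/-- The exterior derivative of the variation form in a chart. -/
lemma fderiv_chartVariationForm (hF : IsLagrangianVariation n J ε F) (hJ : IsNearlyKahler J)
    (ht : t ∈ Ioo (-ε) ε) (hy : y ∈ (extChartAt (𝓡 n) x).target)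
    (u v : EuclideanSpace ℝ (Fin n)) :
    fderiv ℝ (chartVariationForm J F t x) y u v - fderiv ℝ (chartVariationForm J F t x) y v u
      = -3 * inner ℝ (covDerivEnd J (F ((extChartAt (𝓡 n) x).symm y, t))
        (mfderiv (𝓡 n) I (fun x ↦ F (x, t)) ((extChartAt (𝓡 n) x).symm y)
          (mfderiv 𝓘(ℝ, EuclideanSpace ℝ (Fin n)) (𝓡 n) (extChartAt (𝓡 n) x).symm y u))
        (mfderiv (𝓡 n) I (fun x ↦ F (x, t)) ((extChartAt (𝓡 n) x).symm y)
          (mfderiv 𝓘(ℝ, EuclideanSpace ℝ (Fin n)) (𝓡 n) (extChartAt (𝓡 n) x).symm y v)))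
        (variationField F t ((extChartAt (𝓡 n) x).symm y)) := by
  have hG := hF.contMDiffAt_chartVariation ht hy
  -- The time derivative of the `(u, v)` component is zero; the other two terms on the left are
  -- `-dθ(u,v)`.
  have k := cyclic_fderiv_pullbackForm hJ hG (0, (1 : ℝ)) (u, (0 : ℝ)) (v, (0 : ℝ))
  have hd : DifferentiableAt ℝ (chartVariationForm J F t x) y :=
    ((hF.contDiffOn_chartVariationForm hJ.toIsAlmostHermitian ht).contDiffAt
      ((isOpen_extChartAt_target x).mem_nhds hy)).differentiableAt (by simp)
  have key : ∀ u v, fderiv ℝ (chartVariationForm J F t x) y u v = fderiv ℝ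
      (fun z ↦ pullbackForm J (chartVariation F x) z (0, (1 : ℝ)) (v, (0 : ℝ))) (y, t) (u, (0 : ℝ)) := by
    intro u v
    have h1 : fderiv ℝ (chartVariationForm J F t x) y u v
        = fderiv ℝ (fun y ↦ chartVariationForm J F t x y v) y u := by
      rw [(hd.hasFDerivAt.clm_apply (hasFDerivAt_const v _)).fderiv]
      simp
    have h2 : HasFDerivAt (fun y : EuclideanSpace ℝ (Fin n) ↦ (y, t))
      (ContinuousLinearMap.inl ℝ (EuclideanSpace ℝ (Fin n)) ℝ) y := hasFDerivAt_prodMk_left y t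
    have h3 := (contDiffAt_pullbackForm hJ.toIsAlmostHermitian hG (0, (1 : ℝ))
      (v, (0 : ℝ))).differentiableAt (by simp)
    have h4 := (h3.hasFDerivAt.comp y h2).fderiv
    have h5 : (fun y ↦ chartVariationForm J F t x y v) =ᶠ[𝓝 y]
        (fun z ↦ pullbackForm J (chartVariation F x) z (0, (1 : ℝ)) (v, (0 : ℝ))) ∘ fun y ↦ (y, t) := by
      filter_upwards [(isOpen_extChartAt_target x).mem_nhds hy] with y' hy'
      exact hF.chartVariationForm_apply ht hy' v
    rw [h1, h5.fderiv_eq, h4]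
    simp
  have hs : (fun z ↦ pullbackForm J (chartVariation F x) z (v, (0 : ℝ)) (0, (1 : ℝ)))
      = -fun z ↦ pullbackForm J (chartVariation F x) z (0, (1 : ℝ)) (v, (0 : ℝ)) := by
    funext z; exact pullbackForm_swap hJ.toIsAlmostHermitian _ _
  rw [hF.fderiv_pullbackForm_eq_zero ht hy, hs, fderiv_neg, hF.mfderiv_chartVariation_left ht hy,
    hF.mfderiv_chartVariation_left ht hy, hF.mfderiv_chartVariation_right ht hy] at k
  rw [(hJ.isNKTensor _).inner_cyc, key u v, key v u]
  simp only [zero_apply, neg_apply] at k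
  change _ = 3 * inner ℝ (covDerivEnd J (F ((extChartAt (𝓡 n) x).symm y, t)) _ _) _ at k
  linarith

end IsLagrangianVariation
end Variation
end
end RiemGeom

namespace RiemGeom
noncomputable section
-- The Hodge star in dimension three.
section HodgeStar
set_option linter.unusedSectionVars false

variable {V : Type*} [NormedAddCommGroup V] [InnerProductSpace ℝ V] [FiniteDimensional ℝ V]
  [Fact (finrank ℝ V = 3)] (o : Orientation ℝ V (Fin 3))

variable (V) in
/-- The orthonormal basis used in the definition of the Hodge star. -/
def hodgeBasis : OrthonormalBasis (Fin 3) ℝ V :=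
  (stdOrthonormalBasis ℝ V).reindex (finCongr (Fact.out : finrank ℝ V = 3))

lemma sum_orderEmb_one (f : (Fin 1 ↪o Fin 3) → ℝ) :
    ∑ s, f s = ∑ i : Fin 3, f (OrderEmbedding.ofStrictMono ![i] (by
      intro a b h; exact absurd h (by simp [Subsingleton.elim a b]))) := by
  symm
  refine Fintype.sum_bijective (fun i : Fin 3 ↦ OrderEmbedding.ofStrictMono ![i] _) ⟨?_, ?_⟩ _ _
    fun _ ↦ rfl
  · intro i j h
    exact DFunLike.congr_fun h 0
  · intro s
    refine ⟨s 0, ?_⟩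
    ext k
    rw [Subsingleton.elim k 0]
    rfl

/-- A two-element subset of `Fin 3` is indexed by the element it omits. -/
lemma sum_orderEmb_two (f : (Fin 2 ↪o Fin 3) → ℝ) :
    ∑ s, f s = ∑ i : Fin 3, f (Fin.succAboveOrderEmb i) := by
  symm
  refine Fintype.sum_bijective _ ⟨fun i j h ↦
    Fin.succAbove_left_injective (congrArg DFunLike.coe h), ?_⟩ _ _ fun _ ↦ rfl
  intro s
  have h : s 0 < s 1 := s.strictMono (by simp)
  obtain ⟨i, hi⟩ : ∃ i : Fin 3, i.succAbove 0 = s 0 ∧ i.succAbove 1 = s 1 := by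
    generalize s 0 = a at *
    generalize s 1 = b at *
    revert a b
    decide
  refine ⟨i, ?_⟩
  ext k
  fin_cases k
  · exact congrArg _ hi.1
  · exact congrArg _ hi.2

lemma hodgeStarLinear_one (h : 1 + 2 = 3) (η : V [⋀^Fin 1]→L[ℝ] ℝ) (w : Fin 2 → V) :
    hodgeStarLinear o h η w
      = ∑ i, η ![hodgeBasis V i] * o.volumeForm ![hodgeBasis V i, w 0, w 1] := by
  rw [hodgeStarLinear]
  simp only [ContinuousAlternatingMap.sum_apply, ContinuousAlternatingMap.smul_apply]
  rw [sum_orderEmb_one]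
  refine Finset.sum_congr rfl fun i _ ↦ ?_
  rw [smul_eq_mul]
  congr 1
  · congr 1
    ext k; fin_cases k; rfl
  · change o.volumeForm _ = _
    congr 1
    ext k; fin_cases k <;> rfl

lemma hodgeStarLinear_two (h : 2 + 1 = 3) (η : V [⋀^Fin 2]→L[ℝ] ℝ) (w : Fin 1 → V) :
    hodgeStarLinear o h η w
      = η ![hodgeBasis V 1, hodgeBasis V 2] * o.volumeForm ![hodgeBasis V 1, hodgeBasis V 2, w 0]
      + η ![hodgeBasis V 0, hodgeBasis V 2] * o.volumeForm ![hodgeBasis V 0, hodgeBasis V 2, w 0]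
      + η ![hodgeBasis V 0, hodgeBasis V 1] * o.volumeForm ![hodgeBasis V 0, hodgeBasis V 1, w 0] := by
  rw [hodgeStarLinear]
  simp only [ContinuousAlternatingMap.sum_apply, ContinuousAlternatingMap.smul_apply]
  rw [sum_orderEmb_two, Fin.sum_univ_three]
  simp only [smul_eq_mul]
  congr 1
  · congr 1
    all_goals congr 1
    all_goals first
      | (congr 1; ext k; fin_cases k <;> rfl)
      | (change o.volumeForm _ = _; congr 1; ext k; fin_cases k <;> rfl)
  · congr 1
    · congr 1
      ext k; fin_cases k <;> rfl
    · change o.volumeForm _ = _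
      congr 1
      ext k; fin_cases k <;> rfl

lemma volumeForm_swap_left (u v w : V) : o.volumeForm ![u, v, w] = -o.volumeForm ![v, u, w] := by
  have := o.volumeForm.map_swap ![v, u, w] (i := 0) (j := 1) (by decide)
  rw [← this]
  congr 1
  ext k; fin_cases k <;> rfl

lemma volumeForm_swap_right (u v w : V) : o.volumeForm ![u, v, w] = -o.volumeForm ![u, w, v] := by
  have := o.volumeForm.map_swap ![u, w, v] (i := 1) (j := 2) (by decide)
  rw [← this]
  congr 1
  ext k; fin_cases k <;> rfl

lemma volumeForm_self_left (u v : V) : o.volumeForm ![u, u, v] = 0 := by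
  have := volumeForm_swap_left o u u v
  linarith

lemma volumeForm_self_right (u v : V) : o.volumeForm ![u, v, v] = 0 := by
  have := volumeForm_swap_right o u v v
  linarith

lemma volumeForm_self_outer (u v : V) : o.volumeForm ![u, v, u] = 0 := by
  rw [volumeForm_swap_right, volumeForm_self_left, neg_zero]

/-- The Hodge star is an involution in dimension 3. -/
lemma hodgeStarLinear_hodgeStarLinear (h : 1 + 2 = 3) (h' : 2 + 1 = 3) (η : V [⋀^Fin 1]→L[ℝ] ℝ) :
    hodgeStarLinear o h' (hodgeStarLinear o h η) = η := by
  set e := hodgeBasis V with he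
  -- The basis in the definition need not be positively oriented, but only the square of its volume
  -- enters `**`.
  have hs : o.volumeForm ![e 0, e 1, e 2] ^ 2 = 1 := by
    have h1 := o.abs_volumeForm_apply_of_orthonormal e
    have h2 : ⇑e = ![e 0, e 1, e 2] := by ext k; fin_cases k <;> rfl
    rw [h2] at h1
    rw [← sq_abs, h1, one_pow]
  have key : ∀ i, hodgeStarLinear o h' (hodgeStarLinear o h η) ![e i] = η ![e i] := by
    intro i
    rw [hodgeStarLinear_two, hodgeStarLinear_one, hodgeStarLinear_one, hodgeStarLinear_one]
    simp only [← he, Fin.sum_univ_three, Matrix.cons_val, volumeForm_self_left,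
      volumeForm_self_outer]
    rw [volumeForm_swap_left o (e 1) (e 0), volumeForm_swap_left o (e 2) (e 0),
      volumeForm_swap_right o (e 0) (e 2) (e 1)]
    obtain rfl | rfl | rfl : i = 0 ∨ i = 1 ∨ i = 2 := by fin_cases i <;> simp
    · rw [volumeForm_swap_right o (e 1) (e 2) (e 0), volumeForm_swap_left o (e 1) (e 0),
        volumeForm_self_outer, volumeForm_self_outer]
      linear_combination η ![e 0] * hs
    · rw [volumeForm_swap_right o (e 0) (e 2) (e 1), volumeForm_self_outer, volumeForm_self_right]
      linear_combination η ![e 1] * hs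
    · rw [volumeForm_self_right, volumeForm_self_right]
      linear_combination η ![e 2] * hs
  refine ContinuousAlternatingMap.toAlternatingMap_injective
    (Basis.ext_alternating e.toBasis fun v _ ↦ ?_)
  have hv : (fun i ↦ e.toBasis (v i)) = ![e (v 0)] := by
    ext k; fin_cases k; simp
  rw [hv]
  exact key (v 0)

end HodgeStar
end
end RiemGeom

namespace RiemGeom
noncomputable section
-- The torsion on a Lagrangian subspace.
section LagrangianAlgebra
set_option linter.unusedSectionVars false

variable {V W : Type*} [NormedAddCommGroup W] [InnerProductSpace ℝ W] [FiniteDimensional ℝ W]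
  [NormedAddCommGroup V] [InnerProductSpace ℝ V] [FiniteDimensional ℝ V]
  {J : W →L[ℝ] W} {B : W → W → W} {A : V →L[ℝ] W} {α : ℝ}

/-- The 3-form `⟨T(A ·, A ·), A ·⟩`, where `T = -J B`. -/
def torsionForm (hB : IsNKTensor J B) (A : V →L[ℝ] W) : V [⋀^Fin 3]→ₗ[ℝ] ℝ where
  toFun v := inner ℝ (-J (B (A (v 0)) (A (v 1)))) (A (v 2))
  map_update_add' := by
    have hl : ∀ u v w, B (u + v) w = B u w + B v w := fun u v w ↦ by
      rw [hB.swap, hB.add_right, hB.swap u, hB.swap v]; abel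
    intro inst v i a b
    obtain rfl : inst = instDecidableEqFin 3 := Subsingleton.elim _ _
    fin_cases i <;>
      simp [Function.update, hl, hB.add_right, inner_add_left, inner_add_right] <;> ring
  map_update_smul' := by
    intro inst v i c a
    obtain rfl : inst = instDecidableEqFin 3 := Subsingleton.elim _ _
    fin_cases i <;>
      simp [Function.update, hB.smul_left, hB.smul_right, inner_smul_left, inner_smul_right]
  map_eq_zero_of_eq' := by
    have h01 : ∀ u w, (inner ℝ (-J (B u u)) w : ℝ) = 0 := fun u w ↦ by
      rw [hB.self, map_zero, neg_zero, inner_zero_left]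
    have h12 : ∀ u w, (inner ℝ (-J (B u w)) w : ℝ) = 0 := fun u w ↦ by
      rw [inner_neg_left, hB.inner_J, hB.inner_right_J, neg_zero, neg_zero]
    have h02 : ∀ u w, (inner ℝ (-J (B u w)) u : ℝ) = 0 := fun u w ↦ by
      rw [inner_neg_left, hB.inner_J, hB.inner_left_J, neg_zero, neg_zero]
    intro v i j hv hij
    have h : v 0 = v 1 ∨ v 1 = v 2 ∨ v 0 = v 2 := by
      fin_cases i <;> fin_cases j <;> simp_all
    obtain h | h | h := h
    · rw [h]; exact h01 _ _
    · rw [h]; exact h12 _ _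
    · rw [h]; exact h02 _ _

lemma torsionForm_apply (hB : IsNKTensor J B) (u v w : V) :
    torsionForm hB A ![u, v, w] = inner ℝ (-J (B (A u) (A v))) (A w) := rfl

/-- `A` is a linear Lagrangian isometric embedding on whose image the 3-form `⟨B(·, ·), ·⟩`
vanishes. -/
structure IsLagrangianMap (J : W →L[ℝ] W) (B : W → W → W) (A : V →L[ℝ] W) : Prop where
  inner_map_map : ∀ u v, (inner ℝ (A u) (A v) : ℝ) = inner ℝ u v
  isotropic : ∀ u v, (inner ℝ (J (A u)) (A v) : ℝ) = 0
  inner_B : ∀ u v w, (inner ℝ (B (A u) (A v)) (A w) : ℝ) = 0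

namespace IsLagrangianMap

lemma orthonormal (hA : IsLagrangianMap J B A) (hB : IsNKTensor J B)
    (e : OrthonormalBasis (Fin 3) ℝ V) :
    Orthonormal ℝ ![A (e 0), A (e 1), A (e 2), J (A (e 0)), J (A (e 1)), J (A (e 2))] := by
  have h : ∀ i j, (inner ℝ (A (e i)) (J (A (e j))) : ℝ) = 0 := fun i j ↦ by
    rw [real_inner_comm, hA.isotropic]
  have h' := orthonormal_iff_ite.1 e.orthonormal
  apply hB.orthonormal <;> simp only [h, hA.inner_map_map, h'] <;> simp

/-- By dimension `W = AV ⊕ JAV`, and the `JAV` components of `-J B(Au, Av)` are values of the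
vanishing form `⟨B(A·,A·), A·⟩` up to sign. So the torsion of tangent vectors is tangent. -/
lemma neg_J_B (hA : IsLagrangianMap J B A) (hB : IsNKTensor J B) (hW : finrank ℝ W = 6)
    (e : OrthonormalBasis (Fin 3) ℝ V) (u v : V) :
    -J (B (A u) (A v)) = ∑ i, torsionForm hB A ![u, v, e i] • A (e i) := by
  have h : ∀ w, (inner ℝ (J (A w)) (-J (B (A u) (A v))) : ℝ) = 0 := fun w ↦ by
    rw [inner_neg_right, hB.inner_J_J, real_inner_comm, hA.inner_B, neg_zero]
  conv_lhs => rw [IsNKTensor.expand hW (hA.orthonormal hB e) (-J (B (A u) (A v)))]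
  simp only [h, zero_smul, add_zero, Fin.sum_univ_three, torsionForm_apply,
    real_inner_comm (-J (B (A u) (A v)))]

/-- By tangency the torsion of `Ae₀, Ae₁` is a multiple of `Ae₂`, with coefficient the value of the
3-form on `e`. The type constant identity for this orthonormal isotropic pair gives its squared norm
`α`. -/
lemma torsionForm_sq (hA : IsLagrangianMap J B A) (hB : IsNKTensor J B) (hW : finrank ℝ W = 6)
    (hα : ∀ u v, ‖B u v‖ ^ 2
      = α * (‖u‖ ^ 2 * ‖v‖ ^ 2 - (inner ℝ u v : ℝ) ^ 2 - (inner ℝ u (J v) : ℝ) ^ 2))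
    (e : OrthonormalBasis (Fin 3) ℝ V) : torsionForm hB A e ^ 2 = α := by
  have h' := orthonormal_iff_ite.1 e.orthonormal
  have he : ∀ i, ‖A (e i)‖ ^ 2 = 1 := fun i ↦ by
    rw [← real_inner_self_eq_norm_sq, hA.inner_map_map, h', if_pos rfl]
  have h1 := hA.neg_J_B hB hW e (e 0) (e 1)
  have h2 : torsionForm hB A ![e 0, e 1, e 0] = 0 :=
    (torsionForm hB A).map_eq_zero_of_eq _ (i := 0) (j := 2) rfl (by decide)
  have h3 : torsionForm hB A ![e 0, e 1, e 1] = 0 :=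
    (torsionForm hB A).map_eq_zero_of_eq _ (i := 1) (j := 2) rfl (by decide)
  have h4 : ![e 0, e 1, e 2] = e := by ext k; fin_cases k <;> rfl
  rw [Fin.sum_univ_three, h2, h3, h4, zero_smul, zero_smul, zero_add, zero_add] at h1
  have h5 : ‖B (A (e 0)) (A (e 1))‖ ^ 2 = torsionForm hB A e ^ 2 := by
    rw [← real_inner_self_eq_norm_sq, ← hB.inner_J_J, ← inner_neg_neg, h1,
      real_inner_self_eq_norm_sq, norm_smul, mul_pow, he, mul_one, Real.norm_eq_abs, sq_abs]
  have h6 : (inner ℝ (A (e 0)) (J (A (e 1))) : ℝ) = 0 := by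
    rw [real_inner_comm, hA.isotropic]
  rw [← h5, hα, he, he, hA.inner_map_map, h', h6]
  simp

variable [Fact (finrank ℝ V = 3)]

lemma torsionForm_ne_zero (hA : IsLagrangianMap J B A) (hB : IsNKTensor J B)
    (hW : finrank ℝ W = 6) (hα0 : 0 < α)
    (hα : ∀ u v, ‖B u v‖ ^ 2
      = α * (‖u‖ ^ 2 * ‖v‖ ^ 2 - (inner ℝ u v : ℝ) ^ 2 - (inner ℝ u (J v) : ℝ) ^ 2)) :
    torsionForm hB A ≠ 0 := by
  intro h
  have := hA.torsionForm_sq hB hW hα (hodgeBasis V)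
  rw [h, AlternatingMap.zero_apply] at this
  linarith

/-- Top-degree forms are compared on one positively oriented orthonormal basis, where the
orientation selects the root `+√α`. -/
lemma torsionForm_eq (hA : IsLagrangianMap J B A) (hB : IsNKTensor J B)
    (hW : finrank ℝ W = 6)
    (hα : ∀ u v, ‖B u v‖ ^ 2
      = α * (‖u‖ ^ 2 * ‖v‖ ^ 2 - (inner ℝ u v : ℝ) ^ 2 - (inner ℝ u (J v) : ℝ) ^ 2))
    (o : Orientation ℝ V (Fin 3))
    (ho : ∀ b : Basis (Fin 3) ℝ V, b.orientation = o ↔ 0 < torsionForm hB A b) :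
    torsionForm hB A = √α • o.volumeForm := by
  have h3 : finrank ℝ V = 3 := Fact.out
  set e := o.finOrthonormalBasis (by norm_num) h3
  have he : e.toBasis.orientation = o := o.finOrthonormalBasis_orientation _ _
  have hp := (ho _).1 he
  have hs := hA.torsionForm_sq hB hW hα e
  rw [e.coe_toBasis] at hp
  have h : torsionForm hB A e = √α := by
    rw [← hs, Real.sqrt_sq hp.le]
  rw [o.volumeForm_robust e he, (torsionForm hB A).eq_smul_basis_det e.toBasis, e.coe_toBasis, h]

/-- `⟨T(A u, A v), z⟩ = √α (*η)(u, v)` for the 1-form `η = ⟨z, A ·⟩`. -/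
lemma inner_neg_J_B (hA : IsLagrangianMap J B A) (hB : IsNKTensor J B)
    (hW : finrank ℝ W = 6)
    (hα : ∀ u v, ‖B u v‖ ^ 2
      = α * (‖u‖ ^ 2 * ‖v‖ ^ 2 - (inner ℝ u v : ℝ) ^ 2 - (inner ℝ u (J v) : ℝ) ^ 2))
    (o : Orientation ℝ V (Fin 3))
    (ho : ∀ b : Basis (Fin 3) ℝ V, b.orientation = o ↔ 0 < torsionForm hB A b)
    (h : 1 + 2 = 3) (η : V [⋀^Fin 1]→L[ℝ] ℝ) (z : W)
    (hη : ∀ u, η ![u] = inner ℝ z (A u)) (w : Fin 2 → V) :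
    inner ℝ (-J (B (A (w 0)) (A (w 1)))) z = √α * hodgeStarLinear o h η w := by
  rw [hodgeStarLinear_one, hA.neg_J_B hB hW (hodgeBasis V), hA.torsionForm_eq hB hW hα o ho,
    sum_inner, Finset.mul_sum]
  refine Finset.sum_congr rfl fun i _ ↦ ?_
  rw [inner_smul_left, hη, real_inner_comm, AlternatingMap.smul_apply, smul_eq_mul,
    volumeForm_swap_right, volumeForm_swap_left, neg_neg]
  simp
  ring

end IsLagrangianMap

/-- Since `τ = τ(b) det_b`, the two forms lie on the same ray exactly when `τ(b)` is positive. -/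
lemma rayOfNeZero_orientation_iff {V : Type*} [AddCommGroup V] [Module ℝ V]
    {ι : Type*} [Fintype ι] [DecidableEq ι] (τ : V [⋀^ι]→ₗ[ℝ] ℝ) (hτ : τ ≠ 0) (b : Basis ι ℝ V) :
    b.orientation = rayOfNeZero ℝ τ hτ ↔ 0 < τ b := by
  have h := τ.eq_smul_basis_det b
  have h0 : τ b ≠ 0 := fun h0 ↦ hτ (by rw [h, h0, zero_smul])
  rw [Basis.orientation, ray_eq_iff]
  conv_lhs => rw [h]
  rw [sameRay_smul_right_iff_of_ne b.det_ne_zero h0]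

end LagrangianAlgebra
end
end RiemGeom

namespace RiemGeom
noncomputable section
-- Exterior derivatives of 1-forms computed in charts.
section ExteriorDerivative
open Filter Topology
set_option linter.unusedSectionVars false

variable {n : ℕ} {L : Type*} [TopologicalSpace L] [ChartedSpace (EuclideanSpace ℝ (Fin n)) L]
  {θ : Π x : L, TangentSpace (𝓡 n) x →L[ℝ] ℝ} {x : L}

variable (θ x) in
/-- A field of covectors in a chart. -/
def chartCovector (y : EuclideanSpace ℝ (Fin n)) : EuclideanSpace ℝ (Fin n) →L[ℝ] ℝ :=
  (θ ((extChartAt (𝓡 n) x).symm y)).comp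
    (mfderiv 𝓘(ℝ, EuclideanSpace ℝ (Fin n)) (𝓡 n) (extChartAt (𝓡 n) x).symm y)

/-- Smoothness of a field of covectors can be checked in charts. -/
lemma contMDiff_covector [IsManifold (𝓡 n) ∞ L]
    (h : ∀ x, ContDiffAt ℝ ∞ (chartCovector θ x) (extChartAt (𝓡 n) x x)) :
    ContMDiff (𝓡 n) ((𝓡 n).prod 𝓘(ℝ, EuclideanSpace ℝ (Fin n) →L[ℝ] ℝ)) ∞
      (fun x : L ↦ TotalSpace.mk' (EuclideanSpace ℝ (Fin n) →L[ℝ] ℝ)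
        (E := fun x : L ↦ TangentSpace (𝓡 n) x →L[ℝ] ℝ) x (θ x)) := by
  intro x
  refine (contMDiffAt_hom_bundle _).2 ⟨contMDiffAt_id, ?_⟩
  have h1 : ContMDiffAt (𝓡 n) 𝓘(ℝ, EuclideanSpace ℝ (Fin n) →L[ℝ] ℝ) ∞
      (chartCovector θ x ∘ extChartAt (𝓡 n) x) x :=
    ContMDiffAt.comp x (h x).contMDiffAt contMDiffAt_extChartAt
  refine h1.congr_of_eventuallyEq ?_
  filter_upwards [chart_source_mem_nhds (EuclideanSpace ℝ (Fin n)) x] with z hz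
  have hs := TangentBundle.symmL_trivializationAt (I := 𝓡 n) (𝕜 := ℝ) hz
  simp only [(𝓡 n).range_eq_univ, mfderivWithin_univ] at hs
  have hz' : (extChartAt (𝓡 n) x).symm (extChartAt (𝓡 n) x z) = z :=
    (extChartAt (𝓡 n) x).left_inv (by rwa [extChartAt_source])
  have tr : ∀ (z' : L) (T T' : EuclideanSpace ℝ (Fin n) →L[ℝ] EuclideanSpace ℝ (Fin n)),
      z' = z → T = T' → ContinuousLinearMap.comp (θ z) T = ContinuousLinearMap.comp (θ z') T' := by
    rintro z' T T' rfl rfl; rfl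
  refine Eq.trans ?_ (tr _ _ _ hz' hs)
  ext v
  simp [ContinuousLinearMap.inCoordinates]

lemma extDeriv_ofSubsingleton {E : Type*} [NormedAddCommGroup E] [NormedSpace ℝ E]
    {β : E → E →L[ℝ] ℝ} {y : E} (h : DifferentiableAt ℝ β y) (w : Fin 2 → E) :
    extDeriv (fun y ↦ ContinuousAlternatingMap.ofSubsingleton ℝ E ℝ (0 : Fin 1) (β y)) y w
      = fderiv ℝ β y (w 0) (w 1) - fderiv ℝ β y (w 1) (w 0) := by
  have h1 : DifferentiableAt ℝ
      (fun y ↦ ContinuousAlternatingMap.ofSubsingleton ℝ E ℝ (0 : Fin 1) (β y)) y :=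
    (ContinuousAlternatingMap.ofSubsingletonLIE (𝕜 := ℝ) (E := E) (F := ℝ)
      (0 : Fin 1)).differentiable.differentiableAt.comp y h
  have h2 : ∀ u v, fderiv ℝ (fun y ↦ β y v) y u = fderiv ℝ β y u v := fun u v ↦ by
    rw [(h.hasFDerivAt.clm_apply (hasFDerivAt_const v _)).fderiv]
    simp
  rw [extDeriv_apply h1, Fin.sum_univ_two]
  simp only [ContinuousAlternatingMap.ofSubsingleton_apply_apply, h2]
  simp [Fin.removeNth, sub_eq_add_neg]

lemma mextDeriv_oneForm (h : DifferentiableAt ℝ (chartCovector θ x) (extChartAt (𝓡 n) x x))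
    (w : Fin 2 → TangentSpace (𝓡 n) x) :
    mextDeriv (oneForm θ) x w
      = fderiv ℝ (chartCovector θ x) (extChartAt (𝓡 n) x x)
          (mfderiv (𝓡 n) 𝓘(ℝ, EuclideanSpace ℝ (Fin n)) (extChartAt (𝓡 n) x) x (w 0))
          (mfderiv (𝓡 n) 𝓘(ℝ, EuclideanSpace ℝ (Fin n)) (extChartAt (𝓡 n) x) x (w 1))
        - fderiv ℝ (chartCovector θ x) (extChartAt (𝓡 n) x x)
          (mfderiv (𝓡 n) 𝓘(ℝ, EuclideanSpace ℝ (Fin n)) (extChartAt (𝓡 n) x) x (w 1))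
          (mfderiv (𝓡 n) 𝓘(ℝ, EuclideanSpace ℝ (Fin n)) (extChartAt (𝓡 n) x) x (w 0)) :=
  extDeriv_ofSubsingleton h _

lemma mextDeriv_zero {k : ℕ} : mextDeriv (0 : DiffForm n L k) = 0 := by
  funext x
  have h : (fun y ↦ ((0 : DiffForm n L k) ((extChartAt (𝓡 n) x).symm y)).compContinuousLinearMap
      (mfderiv 𝓘(ℝ, EuclideanSpace ℝ (Fin n)) (𝓡 n) (extChartAt (𝓡 n) x).symm y))
      = fun _ ↦ (0 : EuclideanSpace ℝ (Fin n) [⋀^Fin k]→L[ℝ] ℝ) := by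
    funext y; rfl
  ext w
  have h2 : extDeriv (fun _ : EuclideanSpace ℝ (Fin n) ↦
      (0 : EuclideanSpace ℝ (Fin n) [⋀^Fin k]→L[ℝ] ℝ)) (extChartAt (𝓡 n) x x) = 0 := by
    have := extDeriv_smul (0 : ℝ) (x := extChartAt (𝓡 n) x x) (fun _ : EuclideanSpace ℝ (Fin n) ↦
      (0 : EuclideanSpace ℝ (Fin n) [⋀^Fin k]→L[ℝ] ℝ))
    rw [zero_smul, zero_smul] at this
    exact this
  rw [← h] at h2
  exact congrArg (fun T : EuclideanSpace ℝ (Fin n) [⋀^Fin (k + 1)]→L[ℝ] ℝ ↦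
    T fun i ↦ mfderiv (𝓡 n) 𝓘(ℝ, EuclideanSpace ℝ (Fin n)) (extChartAt (𝓡 n) x) x (w i)) h2

lemma mextDeriv_smul {k : ℕ} (c : ℝ) (η : DiffForm n L k) :
    mextDeriv (c • η) = c • mextDeriv η := by
  funext x
  ext w
  exact congrArg (fun T : EuclideanSpace ℝ (Fin n) [⋀^Fin (k + 1)]→L[ℝ] ℝ ↦
    T fun i ↦ mfderiv (𝓡 n) 𝓘(ℝ, EuclideanSpace ℝ (Fin n)) (extChartAt (𝓡 n) x) x (w i))
    (extDeriv_smul c (x := extChartAt (𝓡 n) x x) fun y ↦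
      (η ((extChartAt (𝓡 n) x).symm y)).compContinuousLinearMap
        (mfderiv 𝓘(ℝ, EuclideanSpace ℝ (Fin n)) (𝓡 n) (extChartAt (𝓡 n) x).symm y))

variable [IsManifold (𝓡 n) ∞ L]

lemma mfderiv_extChartAt_symm_mfderiv_extChartAt (x : L) (v : TangentSpace (𝓡 n) x) :
    (mfderiv 𝓘(ℝ, EuclideanSpace ℝ (Fin n)) (𝓡 n) (extChartAt (𝓡 n) x).symm (extChartAt (𝓡 n) x x)
      (mfderiv (𝓡 n) 𝓘(ℝ, EuclideanSpace ℝ (Fin n)) (extChartAt (𝓡 n) x) x v) :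
        EuclideanSpace ℝ (Fin n)) = v := by
  have := mfderivWithin_extChartAt_symm_comp_mfderiv_extChartAt' (I := 𝓡 n) (mem_extChartAt_source x)
  rw [(𝓡 n).range_eq_univ, mfderivWithin_univ] at this
  exact congrArg (fun T : EuclideanSpace ℝ (Fin n) →L[ℝ] EuclideanSpace ℝ (Fin n) ↦ T v) this

/-- `d θ = η` pointwise, if this holds in every chart. -/
lemma mextDeriv_oneForm_eq {η : DiffForm n L 2}
    (h : ContDiffOn ℝ ∞ (chartCovector θ x) (extChartAt (𝓡 n) x).target)
    (hη : ∀ y ∈ (extChartAt (𝓡 n) x).target, ∀ w : Fin 2 → EuclideanSpace ℝ (Fin n),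
      fderiv ℝ (chartCovector θ x) y (w 0) (w 1) - fderiv ℝ (chartCovector θ x) y (w 1) (w 0)
        = η ((extChartAt (𝓡 n) x).symm y) fun i ↦
          mfderiv 𝓘(ℝ, EuclideanSpace ℝ (Fin n)) (𝓡 n) (extChartAt (𝓡 n) x).symm y (w i)) :
    mextDeriv (oneForm θ) x = η x := by
  have hd := (h.contDiffAt (extChartAt_target_mem_nhds x)).differentiableAt (by simp)
  ext w
  rw [mextDeriv_oneForm hd]
  refine (hη _ (mem_extChartAt_target x) fun i ↦
    mfderiv (𝓡 n) 𝓘(ℝ, EuclideanSpace ℝ (Fin n)) (extChartAt (𝓡 n) x) x (w i)).trans ?_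
  have tr : ∀ (x' : L) (w' : Fin 2 → EuclideanSpace ℝ (Fin n)), x' = x → w' = w →
      η x' w' = η x w := by
    rintro x' w' rfl rfl; rfl
  exact tr _ _ (extChartAt_to_inv x) (funext fun i ↦ mfderiv_extChartAt_symm_mfderiv_extChartAt x (w i))

/-- `d² = 0` in the single chart at `x`. The hypothesis is stated on the whole chart domain because
`mextDeriv` at other points uses their own preferred charts; no chart independence of `d` is then
needed. -/
lemma mextDeriv_eq_zero {η : DiffForm n L 2}
    (h : ContDiffOn ℝ ∞ (chartCovector θ x) (extChartAt (𝓡 n) x).target)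
    (hη : ∀ y ∈ (extChartAt (𝓡 n) x).target, ∀ w : Fin 2 → EuclideanSpace ℝ (Fin n),
      fderiv ℝ (chartCovector θ x) y (w 0) (w 1) - fderiv ℝ (chartCovector θ x) y (w 1) (w 0)
        = η ((extChartAt (𝓡 n) x).symm y) fun i ↦
          mfderiv 𝓘(ℝ, EuclideanSpace ℝ (Fin n)) (𝓡 n) (extChartAt (𝓡 n) x).symm y (w i)) :
    mextDeriv η x = 0 := by
  have e : (fun y ↦ (η ((extChartAt (𝓡 n) x).symm y)).compContinuousLinearMap
      (mfderiv 𝓘(ℝ, EuclideanSpace ℝ (Fin n)) (𝓡 n) (extChartAt (𝓡 n) x).symm y))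
      =ᶠ[𝓝 (extChartAt (𝓡 n) x x)] extDeriv fun y ↦
        ContinuousAlternatingMap.ofSubsingleton ℝ (EuclideanSpace ℝ (Fin n)) ℝ (0 : Fin 1)
          (chartCovector θ x y) := by
    filter_upwards [extChartAt_target_mem_nhds (I := 𝓡 n) x] with y hy
    have hd := (h.contDiffAt ((isOpen_extChartAt_target x).mem_nhds hy)).differentiableAt (by simp)
    ext w
    rw [extDeriv_ofSubsingleton hd, hη y hy w]
    rfl
  have hs : ContDiffAt ℝ ∞ (fun y ↦
      ContinuousAlternatingMap.ofSubsingleton ℝ (EuclideanSpace ℝ (Fin n)) ℝ (0 : Fin 1)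
        (chartCovector θ x y)) (extChartAt (𝓡 n) x x) :=
    (ContinuousAlternatingMap.ofSubsingletonLIE (𝕜 := ℝ) (E := EuclideanSpace ℝ (Fin n)) (F := ℝ)
      (0 : Fin 1)).contDiff.contDiffAt.comp _ (h.contDiffAt (extChartAt_target_mem_nhds x))
  have h0 := extDeriv_extDeriv_apply hs (by
    rw [minSmoothness_of_isRCLikeNormedField]
    exact (WithTop.coe_le_coe.2 le_top : ((2 : ℕ∞) : WithTop ℕ∞) ≤ ∞))
  rw [← e.extDeriv_eq] at h0
  ext w
  exact congrArg (fun T : EuclideanSpace ℝ (Fin n) [⋀^Fin 3]→L[ℝ] ℝ ↦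
    T fun i ↦ mfderiv (𝓡 n) 𝓘(ℝ, EuclideanSpace ℝ (Fin n)) (extChartAt (𝓡 n) x) x (w i)) h0

end ExteriorDerivative
end
end RiemGeom

namespace RiemGeom
noncomputable section
-- From the first-order equation to the Hodge Laplacian.
section Eigenform
set_option linter.unusedSectionVars false

lemma hodgeStarLinear_smul {V : Type*} [NormedAddCommGroup V] [InnerProductSpace ℝ V]
    [FiniteDimensional ℝ V] {n p q : ℕ} [Fact (finrank ℝ V = n)] (o : Orientation ℝ V (Fin n))
    (h : p + q = n) (c : ℝ) (η : V [⋀^Fin p]→L[ℝ] ℝ) :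
    hodgeStarLinear o h (c • η) = c • hodgeStarLinear o h η := by
  simp [hodgeStarLinear, Finset.smul_sum, smul_smul]

section
variable {n : ℕ} {L : Type*} [TopologicalSpace L] [ChartedSpace (EuclideanSpace ℝ (Fin n)) L]
  [RiemannianBundle (fun x : L ↦ TangentSpace (𝓡 n) x)]
  (o : Π x : L, Orientation ℝ (TangentSpace (𝓡 n) x) (Fin n))

lemma hodgeStar_smul {p q : ℕ} (h : p + q = n) (c : ℝ) (η : DiffForm n L p) :
    hodgeStar o h (c • η) = c • hodgeStar o h η :=
  funext fun x ↦ hodgeStarLinear_smul (o x) h c (η x)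

lemma hodgeStar_zero {p q : ℕ} (h : p + q = n) : hodgeStar o h (0 : DiffForm n L p) = 0 := by
  have := hodgeStar_smul o h 0 (0 : DiffForm n L p)
  rwa [zero_smul, zero_smul] at this

end

section
variable {L : Type*} [TopologicalSpace L] [ChartedSpace (EuclideanSpace ℝ (Fin 3)) L]
  [RiemannianBundle (fun x : L ↦ TangentSpace (𝓡 3) x)]
  (o : Π x : L, Orientation ℝ (TangentSpace (𝓡 3) x) (Fin 3)) {c : ℝ} {η : DiffForm 3 L 1}

lemma codiff_eq_zero (hd : mextDeriv (hodgeStar o (p := 1) (q := 2) rfl η) = 0) :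
    codiff o (p := 0) (q := 2) rfl η = 0 := by
  funext x
  rw [codiff, hd, hodgeStar_zero]
  exact smul_zero _

/-- The term `dδη` drops out, and `δdη = *d*(c *η) = c *dη = c² **η` with `** = 1`. -/
lemma hodgeLaplacian_eq (h : mextDeriv η = c • hodgeStar o (p := 1) (q := 2) rfl η)
    (hd : mextDeriv (hodgeStar o (p := 1) (q := 2) rfl η) = 0) :
    hodgeLaplacian o (p := 0) (q := 1) rfl η = c ^ 2 • η := by
  have hs : hodgeStar o (p := 2) (q := 1) rfl (hodgeStar o (p := 1) (q := 2) rfl η) = η :=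
    funext fun x ↦ hodgeStarLinear_hodgeStarLinear (o x) rfl rfl (η x)
  have h1 : codiff o (p := 1) (q := 1) rfl (mextDeriv η) = c ^ 2 • η := by
    funext x
    have e : mextDeriv (hodgeStar o (p := 2) (q := 1) rfl (mextDeriv η))
        = (c ^ 2) • hodgeStar o (p := 1) (q := 2) rfl η := by
      rw [h, hodgeStar_smul, hs, mextDeriv_smul, h, smul_smul, sq]
    -- The exponent is 10, so on 2-forms in dimension three `δ = *d*` without sign.
    change (-1 : ℝ) ^ (3 * (1 + 2) + 1) • hodgeStar o (p := 2) (q := 1) rfl (mextDeriv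
      (hodgeStar o (p := 2) (q := 1) rfl (mextDeriv η))) x = _
    rw [e, hodgeStar_smul, hs]
    norm_num
  funext x
  change mextDeriv (codiff o (p := 0) (q := 2) rfl η) x
    + codiff o (p := 1) (q := 1) rfl (mextDeriv η) x = _
  rw [codiff_eq_zero o hd, mextDeriv_zero, h1]
  exact zero_add _

end

variable {E : Type*} [NormedAddCommGroup E] [NormedSpace ℝ E] [FiniteDimensional ℝ E]
  {H : Type*} [TopologicalSpace H] {I : ModelWithCorners ℝ E H} [I.Boundaryless]
  {M : Type*} [TopologicalSpace M] [ChartedSpace H M] [IsManifold I ∞ M]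
  [RiemannianBundle (fun x : M ↦ TangentSpace I x)]
  [IsContMDiffRiemannianBundle I ∞ E (fun x : M ↦ TangentSpace I x)]
  {J : Π x : M, TangentSpace I x →L[ℝ] TangentSpace I x}
  {L : Type*} [TopologicalSpace L] [ChartedSpace (EuclideanSpace ℝ (Fin 3)) L]
  [IsManifold (𝓡 3) ∞ L] {F : L × ℝ → M} {ε t α : ℝ}

namespace IsLagrangianVariation

lemma contMDiff_variationForm {n : ℕ} {L : Type*} [TopologicalSpace L]
    [ChartedSpace (EuclideanSpace ℝ (Fin n)) L] [IsManifold (𝓡 n) ∞ L] {F : L × ℝ → M}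
    (hF : IsLagrangianVariation n J ε F) (hJ : IsAlmostHermitian J) (ht : t ∈ Ioo (-ε) ε) :
    ContMDiff (𝓡 n) ((𝓡 n).prod 𝓘(ℝ, EuclideanSpace ℝ (Fin n) →L[ℝ] ℝ)) ∞
      (fun x : L ↦ TotalSpace.mk' (EuclideanSpace ℝ (Fin n) →L[ℝ] ℝ)
        (E := fun x : L ↦ TangentSpace (𝓡 n) x →L[ℝ] ℝ) x (variationForm J F t x)) :=
  contMDiff_covector fun x ↦ (hF.contDiffOn_chartVariationForm hJ ht).contDiffAt
    (extChartAt_target_mem_nhds x)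

variable [RiemannianBundle (fun x : L ↦ TangentSpace (𝓡 3) x)]

lemma isLagrangianMap (hF : IsLagrangianVariation 3 J ε F) (hJ : IsNearlyKahler J)
    (ht : t ∈ Ioo (-ε) ε) (x : L)
    (hg : ∀ u v : TangentSpace (𝓡 3) x, (inner ℝ u v : ℝ) = inner ℝ
      (mfderiv (𝓡 3) I (fun x ↦ F (x, t)) x u) (mfderiv (𝓡 3) I (fun x ↦ F (x, t)) x v)) :
    IsLagrangianMap (J (F (x, t))) (covDerivEnd J (F (x, t)))
      (mfderiv (𝓡 3) I (fun x ↦ F (x, t)) x) where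
  inner_map_map u v := (hg u v).symm
  isotropic := (hF.isLagrangian t ht).isotropic x
  inner_B := hF.inner_covDerivEnd_eq_zero hJ ht x

lemma exists_isTorsionOrientation (hF : IsLagrangianVariation 3 J ε F) (hJ : IsNearlyKahler J)
    (hα0 : 0 < α) (hα : IsTypeConstant J α) (ht : t ∈ Ioo (-ε) ε)
    (hg : ∀ (x : L) (u v : TangentSpace (𝓡 3) x), (inner ℝ u v : ℝ) = inner ℝ
      (mfderiv (𝓡 3) I (fun x ↦ F (x, t)) x u) (mfderiv (𝓡 3) I (fun x ↦ F (x, t)) x v)) :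
    ∃ o : Π x : L, Orientation ℝ (TangentSpace (𝓡 3) x) (Fin 3),
      IsTorsionOrientation J (fun x : L ↦ F (x, t)) o :=
  ⟨fun x ↦ rayOfNeZero ℝ (torsionForm (hJ.isNKTensor _) (mfderiv (𝓡 3) I (fun x ↦ F (x, t)) x))
    ((hF.isLagrangianMap hJ ht x (hg x)).torsionForm_ne_zero (hJ.isNKTensor _)
      (hF.isLagrangian t ht).finrank_eq hα0 (hα _)),
    fun _ b ↦ rayOfNeZero_orientation_iff _ _ b⟩

/-- `-3 ⟨(∇J)(dF ·, dF ·), V⟩ = 3 √α *θ`. -/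
lemma inner_covDerivEnd_variationField (hF : IsLagrangianVariation 3 J ε F) (hJ : IsNearlyKahler J)
    (hα : IsTypeConstant J α) (ht : t ∈ Ioo (-ε) ε)
    (hg : ∀ (x : L) (u v : TangentSpace (𝓡 3) x), (inner ℝ u v : ℝ) = inner ℝ
      (mfderiv (𝓡 3) I (fun x ↦ F (x, t)) x u) (mfderiv (𝓡 3) I (fun x ↦ F (x, t)) x v))
    (o : Π x : L, Orientation ℝ (TangentSpace (𝓡 3) x) (Fin 3))
    (ho : IsTorsionOrientation J (fun x : L ↦ F (x, t)) o) (x : L)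
    (w : Fin 2 → TangentSpace (𝓡 3) x) :
    -3 * (inner ℝ (covDerivEnd J (F (x, t)) (mfderiv (𝓡 3) I (fun x ↦ F (x, t)) x (w 0))
        (mfderiv (𝓡 3) I (fun x ↦ F (x, t)) x (w 1))) (variationField F t x) : ℝ)
      = ((3 * √α) • hodgeStar o (p := 1) (q := 2) rfl (oneForm (variationForm J F t))) x w := by
  have hA := hF.isLagrangianMap hJ ht x (hg x)
  have ho' : ∀ b : Basis (Fin 3) ℝ (TangentSpace (𝓡 3) x), b.orientation = o x ↔
      0 < torsionForm (hJ.isNKTensor (F (x, t))) (mfderiv (𝓡 3) I (fun x ↦ F (x, t)) x) b := ho x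
  have hη : ∀ u, oneForm (variationForm J F t) x ![u] = inner ℝ (J _ (variationField F t x))
      (mfderiv (𝓡 3) I (fun x ↦ F (x, t)) x u) := fun u ↦ rfl
  -- Here `θ = ⟨JV, dF_t ·⟩`, so `z = JV`, and orthogonality of `J` turns `⟨-J(∇J), JV⟩` into `-⟨∇J,
  -- V⟩`.
  have h := hA.inner_neg_J_B (hJ.isNKTensor _) (hF.isLagrangian t ht).finrank_eq (hα _) (o x) ho'
    rfl _ _ hη w
  rw [inner_neg_left, hJ.inner_map_map] at h
  have e : ((3 * √α) • hodgeStar o (p := 1) (q := 2) rfl (oneForm (variationForm J F t))) x w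
      = (3 * √α) * hodgeStarLinear (o x) rfl (oneForm (variationForm J F t) x) w := rfl
  rw [e, mul_assoc, ← h]
  ring

lemma fderiv_chartCovector_variationForm (hF : IsLagrangianVariation 3 J ε F)
    (hJ : IsNearlyKahler J) (hα : IsTypeConstant J α) (ht : t ∈ Ioo (-ε) ε)
    (hg : ∀ (x : L) (u v : TangentSpace (𝓡 3) x), (inner ℝ u v : ℝ) = inner ℝ
      (mfderiv (𝓡 3) I (fun x ↦ F (x, t)) x u) (mfderiv (𝓡 3) I (fun x ↦ F (x, t)) x v))
    (o : Π x : L, Orientation ℝ (TangentSpace (𝓡 3) x) (Fin 3))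
    (ho : IsTorsionOrientation J (fun x : L ↦ F (x, t)) o) (x : L)
    (y : EuclideanSpace ℝ (Fin 3)) (hy : y ∈ (extChartAt (𝓡 3) x).target)
    (w : Fin 2 → EuclideanSpace ℝ (Fin 3)) :
    fderiv ℝ (chartCovector (variationForm J F t) x) y (w 0) (w 1)
        - fderiv ℝ (chartCovector (variationForm J F t) x) y (w 1) (w 0)
      = ((3 * √α) • hodgeStar o (p := 1) (q := 2) rfl (oneForm (variationForm J F t)))
        ((extChartAt (𝓡 3) x).symm y) fun i ↦
          mfderiv 𝓘(ℝ, EuclideanSpace ℝ (Fin 3)) (𝓡 3) (extChartAt (𝓡 3) x).symm y (w i) := by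
  rw [← hF.inner_covDerivEnd_variationField hJ hα ht hg o ho]
  exact hF.fderiv_chartVariationForm hJ ht hy (w 0) (w 1)

lemma mextDeriv_oneForm_variationForm (hF : IsLagrangianVariation 3 J ε F) (hJ : IsNearlyKahler J)
    (hα : IsTypeConstant J α) (ht : t ∈ Ioo (-ε) ε)
    (hg : ∀ (x : L) (u v : TangentSpace (𝓡 3) x), (inner ℝ u v : ℝ) = inner ℝ
      (mfderiv (𝓡 3) I (fun x ↦ F (x, t)) x u) (mfderiv (𝓡 3) I (fun x ↦ F (x, t)) x v))
    (o : Π x : L, Orientation ℝ (TangentSpace (𝓡 3) x) (Fin 3))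
    (ho : IsTorsionOrientation J (fun x : L ↦ F (x, t)) o) :
    mextDeriv (oneForm (variationForm J F t))
      = (3 * √α) • hodgeStar o (p := 1) (q := 2) rfl (oneForm (variationForm J F t)) :=
  funext fun x ↦ mextDeriv_oneForm_eq
    (hF.contDiffOn_chartVariationForm hJ.toIsAlmostHermitian ht)
    (hF.fderiv_chartCovector_variationForm hJ hα ht hg o ho x)

/-- `*θ` is `dθ` divided by the nonzero constant `3√α`, and `ddθ = 0`. Only smoothness of `θ`
enters; the metric on `L` is never differentiated. -/
lemma mextDeriv_hodgeStar_variationForm (hF : IsLagrangianVariation 3 J ε F) (hJ : IsNearlyKahler J)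
    (hα0 : 0 < α) (hα : IsTypeConstant J α) (ht : t ∈ Ioo (-ε) ε)
    (hg : ∀ (x : L) (u v : TangentSpace (𝓡 3) x), (inner ℝ u v : ℝ) = inner ℝ
      (mfderiv (𝓡 3) I (fun x ↦ F (x, t)) x u) (mfderiv (𝓡 3) I (fun x ↦ F (x, t)) x v))
    (o : Π x : L, Orientation ℝ (TangentSpace (𝓡 3) x) (Fin 3))
    (ho : IsTorsionOrientation J (fun x : L ↦ F (x, t)) o) :
    mextDeriv (hodgeStar o (p := 1) (q := 2) rfl (oneForm (variationForm J F t))) = 0 := by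
  have h : mextDeriv ((3 * √α) •
      hodgeStar o (p := 1) (q := 2) rfl (oneForm (variationForm J F t))) = 0 :=
    funext fun x ↦ mextDeriv_eq_zero (θ := variationForm J F t)
      (η := (3 * √α) • hodgeStar o (p := 1) (q := 2) rfl (oneForm (variationForm J F t)))
      (hF.contDiffOn_chartVariationForm hJ.toIsAlmostHermitian ht)
      (hF.fderiv_chartCovector_variationForm hJ hα ht hg o ho x)
  rw [mextDeriv_smul] at h
  have hc : 3 * √α ≠ 0 := mul_ne_zero (by norm_num) (Real.sqrt_pos.2 hα0).ne'
  calc _ = (3 * √α)⁻¹ • (3 * √α) • mextDeriv (hodgeStar o (p := 1) (q := 2) rfl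
        (oneForm (variationForm J F t))) := by rw [smul_smul, inv_mul_cancel₀ hc, one_smul]
    _ = 0 := by rw [h, smul_zero]

end IsLagrangianVariation

end Eigenform
end
end RiemGeom

theorem mainTheorem7
    {M : Type*} [TopologicalSpace M] [ConnectedSpace M]
    [ChartedSpace (EuclideanSpace ℝ (Fin 6)) M] [IsManifold (𝓡 6) ∞ M]
    [RiemannianBundle (fun x : M ↦ TangentSpace (𝓡 6) x)]
    [IsContMDiffRiemannianBundle (𝓡 6) ∞ (EuclideanSpace ℝ (Fin 6))
      (fun x : M ↦ TangentSpace (𝓡 6) x)]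
    (J : Π x : M, TangentSpace (𝓡 6) x →L[ℝ] TangentSpace (𝓡 6) x)
    (hJ : RiemGeom.IsStrictNearlyKahler J)
    {L : Type*} [TopologicalSpace L]
    [ChartedSpace (EuclideanSpace ℝ (Fin 3)) L] [IsManifold (𝓡 3) ∞ L]
    (ε : ℝ) (F : L × ℝ → M) (hF : RiemGeom.IsLagrangianVariation 3 J ε F) :
    ∃ α : ℝ, 0 < α ∧ RiemGeom.IsTypeConstant J α ∧
      (∀ p : M, 9 * α = 3 / 10 * RiemGeom.scalarCurvature (𝓡 6) p) ∧
      ∀ (t : ℝ) (ht : t ∈ Ioo (-ε) ε),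
        -- `L` carries the metric induced by `F_t`
        letI : RiemannianBundle (fun x : L ↦ TangentSpace (𝓡 3) x) :=
          ⟨RiemGeom.inducedMetric (fun x : L ↦ F (x, t)) (hF.isLagrangian t ht).injective⟩
        let θ : Π x : L, TangentSpace (𝓡 3) x →L[ℝ] ℝ := RiemGeom.variationForm J F t
        ContMDiff (𝓡 3) ((𝓡 3).prod 𝓘(ℝ, EuclideanSpace ℝ (Fin 3) →L[ℝ] ℝ)) ∞
            (fun x : L ↦ TotalSpace.mk' (EuclideanSpace ℝ (Fin 3) →L[ℝ] ℝ)
              (E := fun x : L ↦ TangentSpace (𝓡 3) x →L[ℝ] ℝ) x (θ x)) ∧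
        -- `L` carries the orientation induced by the torsion
        ∃ o : Π x : L, Orientation ℝ (TangentSpace (𝓡 3) x) (Fin 3),
          RiemGeom.IsTorsionOrientation J (fun x : L ↦ F (x, t)) o ∧
          RiemGeom.mextDeriv (RiemGeom.oneForm θ) =
            (3 * √α) • RiemGeom.hodgeStar o (p := 1) (q := 2) rfl (RiemGeom.oneForm θ) ∧
          RiemGeom.codiff o (p := 0) (q := 2) rfl (RiemGeom.oneForm θ) = 0 ∧
          RiemGeom.hodgeLaplacian o (p := 0) (q := 1) rfl (RiemGeom.oneForm θ) =
            (9 * α) • RiemGeom.oneForm θ := by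
  obtain ⟨α, hα0, hα, hs⟩ := hJ.exists_typeConstant_scalarCurvature finrank_euclideanSpace_fin
  refine ⟨α, hα0, hα, hs, fun t ht ↦ ?_⟩
  let _ : RiemannianBundle (fun x : L ↦ TangentSpace (𝓡 3) x) :=
    ⟨RiemGeom.inducedMetric (fun x : L ↦ F (x, t)) (hF.isLagrangian t ht).injective⟩
  have hg : ∀ (x : L) (u v : TangentSpace (𝓡 3) x), (inner ℝ u v : ℝ) = inner ℝ
      (mfderiv (𝓡 3) (𝓡 6) (fun x ↦ F (x, t)) x u)
      (mfderiv (𝓡 3) (𝓡 6) (fun x ↦ F (x, t)) x v) := fun _ _ _ ↦ rfl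
  have hK := hJ.toIsNearlyKahler
  obtain ⟨o, ho⟩ := hF.exists_isTorsionOrientation hK hα0 hα ht hg
  have hd := hF.mextDeriv_oneForm_variationForm hK hα ht hg o ho
  have hd0 := hF.mextDeriv_hodgeStar_variationForm hK hα0 hα ht hg o ho
  refine ⟨hF.contMDiff_variationForm hK.toIsAlmostHermitian ht, o, ho, hd,
    RiemGeom.codiff_eq_zero o hd0, ?_⟩
  refine (RiemGeom.hodgeLaplacian_eq o hd hd0).trans ?_
  rw [mul_pow, Real.sq_sqrt hα0.le]
  norm_num
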